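/- Let $\mathbb K$ be $\mathbb R$ or $\mathbb C$; all spaces are over $\mathbb K$. A map $\Omega:X\to Y$ between quasi-normed spaces is \emph{quasi-linear} if $\Omega(cx)=c\,\Omega(x)$ for all scalars $c$ and all $x\in X$, and there is a constant $C$ with $\|\Omega(x+y)-\Omega(x)-\Omega(y)\|\le C(\|x\|+\|y\|)$ for all $x,y\in X$. It is \emph{locally trivial} if there is a constant $C$ such that for every finite-dimensional subspace $F\subset X$ there is a linear map $L_F:F\to Y$ with $\|\Omega(x)-L_F(x)\|\le C\|x\|$ for all $x\in F$. Let $E$ be $\ell_p$ ($0<p<\infty$) or $c_0$, with unit vectors $(e_n)$. A subspace $S\subset X$ is a \emph{copy of $E$ spanned by} a sequence $(u_n)$ in $X$ if $S$ is the closed linear span of $(u_n)$ and there is a linear isomorphism $T:E\to S$, bounded with bounded inverse, such that $Te_n=u_n$ for all $n$. (i) Let $0<p<\infty$, let $\mu$ be a $\sigma$-finite measure, let $Y$ be a quasi-normed space (for instance, a quasi-Banach space), and let $\Omega:L_p(\mu)\to Y$ be a quasi-linear map that is not locally trivial. Then there is a sequence $(u_n)$ of disjointly supported vectors of $L_p(\mu)$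 spanning a copy $S$ of $\ell_p$ such that the restriction $\Omega|_S$ is not locally trivial. (ii) Let $\mu$ be a $\sigma$-finite measure, let $Y$ be a quasi-normed space, and let $\Omega:L_\infty(\mu)\to Y$ be a quasi-linear map that is not locally trivial. Then there is a sequence $(u_n)$ of disjointly supported vectors of $L_\infty(\mu)$ spanning a copy $S$ of $c_0$ such that $\Omega|_S$ is not locally trivial. (iii) Let $K$ be a compact Hausdorff space, let $Y$ be a normed space (for instance, a Banach space), and let $\Omega:C(K)\to Y$ be a quasi-linear map that is not locally trivial. Then there is a sequence $(u_n)$ of disjointly supported functions in $C(K)$ (that is, $u_mu_n=0$ for $m\neq n$) spanning a copy $S$ of $c_0$ such that $\Omega|_S$ is not locally trivial. -/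

import Mathlib

open scoped ENNReal ZeroAtInfty

/-- `N` is a quasi-norm on the vector space `X`. -/
structure IsQuasiNorm (𝕜 : Type*) {X : Type*} [RCLike 𝕜] [AddCommGroup X] [Module 𝕜 X]
    (N : X → ℝ) : Prop where
  nonneg : ∀ x, 0 ≤ N x
  eq_zero_iff : ∀ x, N x = 0 ↔ x = 0
  smul : ∀ (c : 𝕜) (x : X), N (c • x) = ‖c‖ * N x
  add_le : ∃ κ : ℝ, ∀ x y, N (x + y) ≤ κ * (N x + N y)

section

variable (𝕜 : Type*) {X Y E : Type*} [RCLike 𝕜] [AddCommGroup X] [Module 𝕜 X]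
  [AddCommGroup Y] [Module 𝕜 Y] [AddCommGroup E] [Module 𝕜 E]

/-- `Ω : X → Y` is quasi-linear for the (quasi-)norms `NX` on `X` and `NY` on `Y`:
it is homogeneous and `NY (Ω (x + y) - Ω x - Ω y) ≤ C (NX x + NX y)`. -/
def IsQuasiLinear (NX : X → ℝ) (NY : Y → ℝ) (Ω : X → Y) : Prop :=
  (∀ (c : 𝕜) (x : X), Ω (c • x) = c • Ω x) ∧
    ∃ C : ℝ, ∀ x y : X, NY (Ω (x + y) - Ω x - Ω y) ≤ C * (NX x + NX y)

/-- `Ω : X → Y` is locally trivial: there is one constant `C` such that on every finite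
dimensional subspace `F` some linear map `L`
satisfies `‖Ω|_F - L‖ ≤ C`. -/
def IsLocallyTrivial (NX : X → ℝ) (NY : Y → ℝ) (Ω : X → Y) : Prop :=
  ∃ C : ℝ, ∀ F : Submodule 𝕜 X, FiniteDimensional 𝕜 F →
    ∃ L : F →ₗ[𝕜] Y, ∀ x : F, NY (Ω x - L x) ≤ C * NX x

/-- The restriction of `Ω` to the subspace `S` (with the inherited quasi-norm) is locally
trivial. -/
def IsLocallyTrivialOn (NX : X → ℝ) (NY : Y → ℝ) (Ω : X → Y) (S : Submodule 𝕜 X) : Prop :=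
  IsLocallyTrivial 𝕜 (fun x : S => NX x) NY (fun x : S => Ω x)

/-- `S` is the closed linear span of the sequence `u`, the closure being taken for the
quasi-norm `NX`. -/
def IsClosedSpan (NX : X → ℝ) (u : ℕ → X) (S : Submodule 𝕜 X) : Prop :=
  ∀ x : X, x ∈ S ↔ ∀ ε : ℝ, 0 < ε → ∃ y ∈ Submodule.span 𝕜 (Set.range u), NX (x - y) < ε

/-- The subspace `S` of `X` is a copy of the sequence space `E` (with canonical unit vectors
`e n`) spanned by `u`: it is the closed linear span of `u`, and there is a linear isomorphism of
`E` onto `S`, bounded with bounded inverse, that carries `e n` to `u n`. -/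
def IsCopySpannedBy (NE : E → ℝ) (e : ℕ → E) (NX : X → ℝ) (u : ℕ → X)
    (S : Submodule 𝕜 X) : Prop :=
  IsClosedSpan 𝕜 NX u S ∧
    ∃ T : E ≃ₗ[𝕜] S, (∀ n, (T (e n) : X) = u n) ∧
      ∃ c C : ℝ, 0 < c ∧ ∀ a : E, c * NE a ≤ NX (T a) ∧ NX (T a) ≤ C * NE a

/-- The canonical unit vector of `c₀ = C₀(ℕ, 𝕜)`. -/
def c0Single (n : ℕ) : C₀(ℕ, 𝕜) where
  toFun := Pi.single n 1
  continuous_toFun := continuous_of_discreteTopology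
  zero_at_infty' := by
    rw [Filter.cocompact_eq_cofinite, Nat.cofinite_eq_atTop]
    refine tendsto_const_nhds.congr' ?_
    filter_upwards [Filter.eventually_gt_atTop n] with m hm
    simp [Pi.single_apply, hm.ne']

end

/-! ### Quasi-norms and quasi-linear maps: nonnegative constants. -/

section QuasiNorm

variable {𝕜 : Type*} [RCLike 𝕜] {X Y : Type*} [AddCommGroup X] [Module 𝕜 X]
  [AddCommGroup Y] [Module 𝕜 Y] {NX : X → ℝ} {NY : Y → ℝ} {Ω : X → Y}

/-! Call `Ω` near linear on a finite family if some linear map on its span is within a constant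
times the norm of `Ω`. The theorem rests on two facts.

Extraction. Suppose `Ω` is not uniformly near linear on finite disjoint families. Then there are
finite disjoint families `w n`, also disjoint from one another, such that no linear map is within
`n` of `Ω` on the span of `w n`. Enumerated and normalized, they form `(u_n)`. Normalized disjoint
vectors span an isometric copy of `ℓ_p` or `c₀`, and a subspace containing all the bad spans cannot
be locally trivial. In `L_p` the families come from cutting a bad set into a piece that is bad at
level `n` and a remainder that is still bad (`exists_not_nearLinearOnDisjoint_and_diff`). In `C(K)`
a partition of unity finds a point all of whose neighbourhoods are bad; bad families can be made to
vanish near that point, so the next one fits into the neighbourhood left free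
(`exists_not_nearLinear_vanishing_near`).

Reduction. If `Ω` is uniformly near linear on finite disjoint families, it is locally trivial. In
`L_p` this is density of simple functions plus a perturbation lemma,
`exists_nearLinear_of_approx_gauge`, whose constant does not see the dimension. In `C(K)` a
finite-dimensional subspace lives on a compact subset of a Euclidean space, of uncontrolled
dimension. Approximation by finitely many disjoint families gives local triviality there with some
constant `Γ` that depends on the dimension. `IsLocallyTrivialWith.exists_contraction` then improves
any constant `Γ` to `3 / 4 * Γ + B` with `B` independent of dimension, and iteration leaves a
universal bound.

The contraction uses many shifted grids ("colours"). For each colour a function is the sum of a part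
near a disjoint family and a remainder living in the gaps of the grid; each point lies in the gaps
of at most `N` colours. Let the colours be the edges of a graph with half as many vertices as edges
in which any `N` edges form a forest. At every point the active edges can be assigned injectively to
endpoints, so the remainders regroup, with bounded splitting error, into one disjoint sum per
vertex. Averaging over the colours therefore costs `Γ / 2` instead of `Γ`. This averaging is where
`Y` must be normed. -/

theorem IsQuasiNorm.map_zero (hX : IsQuasiNorm 𝕜 NX) : NX 0 = 0 := (hX.eq_zero_iff 0).2 rfl

theorem IsQuasiNorm.exists_one_le (hX : IsQuasiNorm 𝕜 NX) :
    ∃ κ : ℝ, 1 ≤ κ ∧ ∀ x y, NX (x + y) ≤ κ * (NX x + NX y) := by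
  obtain ⟨κ, hκ⟩ := hX.add_le
  refine ⟨max κ 1, le_max_right _ _, fun x y => (hκ x y).trans ?_⟩
  gcongr
  · exact add_nonneg (hX.nonneg x) (hX.nonneg y)
  · exact le_max_left _ _

theorem IsQuasiLinear.exists_nonneg (hX : IsQuasiNorm 𝕜 NX) (hΩ : IsQuasiLinear 𝕜 NX NY Ω) :
    ∃ C : ℝ, 0 ≤ C ∧ ∀ x y, NY (Ω (x + y) - Ω x - Ω y) ≤ C * (NX x + NX y) := by
  obtain ⟨C, hC⟩ := hΩ.2
  refine ⟨max C 0, le_max_right _ _, fun x y => (hC x y).trans ?_⟩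
  gcongr
  · exact add_nonneg (hX.nonneg x) (hX.nonneg y)
  · exact le_max_left _ _

theorem IsQuasiLinear.map_zero (hΩ : IsQuasiLinear 𝕜 NX NY Ω) : Ω 0 = 0 := by
  simpa using hΩ.1 0 0

end QuasiNorm

/-! ### Near linearity: sums, perturbations, and passage to finite-dimensional subspaces. -/

section NearLinear

/-- `H : V → Y` is within distance `C`, relative to the gauge `q` on `V`, of a linear map. -/
def NearLinear (𝕜 : Type*) {V Y : Type*} [RCLike 𝕜] [AddCommGroup V] [Module 𝕜 V]
    [AddCommGroup Y] [Module 𝕜 Y] (q : V → ℝ) (NY : Y → ℝ) (C : ℝ) (H : V → Y) : Prop :=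
  ∃ L : V →ₗ[𝕜] Y, ∀ v, NY (H v - L v) ≤ C * q v

universe v

variable {𝕜 : Type*} [RCLike 𝕜] {X Y : Type*} [AddCommGroup X] [Module 𝕜 X]
  [AddCommGroup Y] [Module 𝕜 Y] {NX : X → ℝ} {NY : Y → ℝ} {Ω : X → Y}
  {V W : Type*} [AddCommGroup V] [Module 𝕜 V] [AddCommGroup W] [Module 𝕜 W]

theorem NearLinear.mono {q q' : V → ℝ} {C C' : ℝ} {H : V → Y} (h : NearLinear 𝕜 q NY C H)
    (hq : ∀ v, C * q v ≤ C' * q' v) : NearLinear 𝕜 q' NY C' H := by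
  obtain ⟨L, hL⟩ := h
  exact ⟨L, fun v => (hL v).trans (hq v)⟩

theorem NearLinear.mono_const {q : V → ℝ} {C C' : ℝ} {H : V → Y} (h : NearLinear 𝕜 q NY C H)
    (hq : ∀ v, 0 ≤ q v) (hC : C ≤ C') : NearLinear 𝕜 q NY C' H :=
  h.mono fun v => mul_le_mul_of_nonneg_right hC (hq v)

theorem NearLinear.comp {q : V → ℝ} {C : ℝ} {H : V → Y} (h : NearLinear 𝕜 q NY C H)
    (S : W →ₗ[𝕜] V) : NearLinear 𝕜 (q ∘ S) NY C (H ∘ S) := by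
  obtain ⟨L, hL⟩ := h
  exact ⟨L ∘ₗ S, fun v => hL (S v)⟩

/-- A quasi-linear map is linear on a line. -/
theorem IsQuasiLinear.nearLinear_smulRight (hY : IsQuasiNorm 𝕜 NY)
    (hΩ : IsQuasiLinear 𝕜 NX NY Ω) (q : V → ℝ) (l : V →ₗ[𝕜] 𝕜) (x : X) :
    NearLinear 𝕜 q NY 0 (Ω ∘ l.smulRight x) :=
  ⟨l.smulRight (Ω x), fun v => by simp [hΩ.1, hY.map_zero]⟩

/-- The point is the order of quantifiers: the constants are fixed before `V`, `q` and the maps `T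
j`, so they serve all families at once. Each summand costs one quasi-linearity error and two
quasi-triangle inequalities. -/
theorem exists_nearLinear_sum (hX : IsQuasiNorm 𝕜 NX) (hY : IsQuasiNorm 𝕜 NY)
    (hΩ : IsQuasiLinear 𝕜 NX NY Ω) {ι : Type*} (s : Finset ι) (Cs : ι → ℝ) :
    ∃ C : ℝ, 0 ≤ C ∧ ∃ B : ℝ, 0 ≤ B ∧ ∀ (V : Type v) [AddCommGroup V] [Module 𝕜 V] (q : V → ℝ)
      (T : ι → V →ₗ[𝕜] X), (∀ v, 0 ≤ q v) → (∀ j ∈ s, ∀ v, NX (T j v) ≤ q v) →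
      (∀ j ∈ s, NearLinear 𝕜 q NY (Cs j) (Ω ∘ T j)) →
      (∀ v, NX ((∑ j ∈ s, T j) v) ≤ B * q v) ∧
        NearLinear 𝕜 q NY C (Ω ∘ (∑ j ∈ s, T j : V →ₗ[𝕜] X)) := by
  classical
  obtain ⟨κ, hκ1, hκ⟩ := hX.exists_one_le
  obtain ⟨κ', hκ1', hκ'⟩ := hY.exists_one_le
  obtain ⟨D, hD0, hD⟩ := hΩ.exists_nonneg hX
  induction s using Finset.induction_on with
  | empty =>
    refine ⟨0, le_rfl, 0, le_rfl, fun V _ _ q T hq hT hN => ⟨?_, 0, ?_⟩⟩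
    · simp [hX.map_zero]
    · simp [hΩ.map_zero, hY.map_zero]
  | insert i s his ih =>
    obtain ⟨C, hC, B, hB, ih⟩ := ih
    refine ⟨κ' * (D * (1 + B) + κ' * (|Cs i| + C)), by positivity, κ * (1 + B), by positivity,
      fun V _ _ q T hq hT hN => ?_⟩
    obtain ⟨h1, L, hL⟩ := ih V q T hq (fun j hj => hT j (Finset.mem_insert_of_mem hj))
      (fun j hj => hN j (Finset.mem_insert_of_mem hj))
    obtain ⟨L', hL'⟩ := hN i (Finset.mem_insert_self _ _)
    have hTi := hT i (Finset.mem_insert_self _ _)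
    rw [Finset.sum_insert his]
    refine ⟨fun v => ?_, L' + L, fun v => ?_⟩
    · rw [LinearMap.add_apply, mul_assoc]
      refine (hκ _ _).trans ?_
      have := h1 v
      have := hTi v
      gcongr
      linarith
    · set S := ∑ j ∈ s, T j
      have e : (Ω ∘ (T i + S)) v - (L' + L) v =
          (Ω (T i v + S v) - Ω (T i v) - Ω (S v)) + ((Ω (T i v) - L' v) + (Ω (S v) - L v)) := by
        simp only [Function.comp, LinearMap.add_apply]; abel
      rw [e]
      have a1 : NY (Ω (T i v + S v) - Ω (T i v) - Ω (S v)) ≤ D * (1 + B) * q v := by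
        refine (hD _ _).trans ?_
        rw [mul_assoc]
        have := h1 v
        have := hTi v
        gcongr
        linarith
      have a2 : NY ((Ω (T i v) - L' v) + (Ω (S v) - L v)) ≤ κ' * (|Cs i| + C) * q v := by
        refine (hκ' _ _).trans ?_
        rw [mul_assoc]
        have := hL v
        have := (hL' v).trans (mul_le_mul_of_nonneg_right (le_abs_self _) (hq v))
        gcongr
        simp only [Function.comp] at *
        linarith
      refine (hκ' _ _).trans ?_
      rw [mul_assoc]
      gcongr
      linarith

theorem exists_nearLinear_add (hX : IsQuasiNorm 𝕜 NX) (hY : IsQuasiNorm 𝕜 NY)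
    (hΩ : IsQuasiLinear 𝕜 NX NY Ω) (C₁ C₂ : ℝ) :
    ∃ C : ℝ, 0 ≤ C ∧ ∀ (V : Type v) [AddCommGroup V] [Module 𝕜 V] (q : V → ℝ)
      (T₁ T₂ : V →ₗ[𝕜] X), (∀ v, 0 ≤ q v) → (∀ v, NX (T₁ v) ≤ q v) → (∀ v, NX (T₂ v) ≤ q v) →
      NearLinear 𝕜 q NY C₁ (Ω ∘ T₁) → NearLinear 𝕜 q NY C₂ (Ω ∘ T₂) →
      NearLinear 𝕜 q NY C (Ω ∘ ⇑(T₁ + T₂)) := by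
  obtain ⟨C, hC, B, -, h⟩ := exists_nearLinear_sum.{v} hX hY hΩ (Finset.univ : Finset (Fin 2))
    ![C₁, C₂]
  refine ⟨C, hC, fun V _ _ q T₁ T₂ hq h1 h2 h3 h4 => ?_⟩
  have := (h V q ![T₁, T₂] hq (by simp [Fin.forall_fin_two, h1, h2])
    (by simp [Fin.forall_fin_two, h3, h4])).2
  rwa [Fin.sum_univ_two] at this

theorem IsQuasiNorm.exists_le_norm {n : Type*} [Fintype n] (hX : IsQuasiNorm 𝕜 NX)
    (T : (n → 𝕜) →ₗ[𝕜] X) : ∃ B : ℝ, 0 ≤ B ∧ ∀ a, NX (T a) ≤ B * ‖a‖ := by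
  classical
  -- Only the bound `B` on the quasi-norm of a sum is wanted, so the zero map plays the role of `Ω`.
  have hz : IsQuasiLinear 𝕜 NX NX (0 : X → X) :=
    ⟨by simp, 0, by simp [hX.map_zero]⟩
  obtain ⟨C, -, B, hB, h⟩ := exists_nearLinear_sum hX hX hz (Finset.univ : Finset n) 0
  set M := ∑ i, NX (T (Pi.single i 1)) with hM
  have hM0 : 0 ≤ M := Finset.sum_nonneg fun i _ => hX.nonneg _
  refine ⟨B * M, by positivity, fun a => ?_⟩
  have := (h (n → 𝕜) (fun a => M * ‖a‖)
    (fun i => (LinearMap.proj i : (n → 𝕜) →ₗ[𝕜] 𝕜).smulRight (T (Pi.single i 1)))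
    (fun v => by positivity) (fun i _ v => ?_) (fun i _ => ⟨0, fun v => ?_⟩)).1 a
  · convert this using 1
    · congr 1
      simp only [LinearMap.sum_apply, LinearMap.smulRight_apply, LinearMap.proj_apply]
      simp_rw [← map_smul]
      rw [← map_sum]
      congr 1
      exact pi_eq_sum_univ' a
    · ring
  · simp only [LinearMap.smulRight_apply, LinearMap.proj_apply, hX.smul]
    rw [mul_comm]
    exact mul_le_mul (Finset.single_le_sum (f := fun i => NX (T (Pi.single i 1)))
      (fun i _ => hX.nonneg _) (Finset.mem_univ i)) (norm_le_pi_norm v i) (norm_nonneg _) hM0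
  · simp [hX.map_zero]

/-- On a finite-dimensional space every quasi-norm dominates every norm. -/
theorem IsQuasiNorm.exists_norm_le {n : Type*} [Fintype n] (hX : IsQuasiNorm 𝕜 NX)
    (T : (n → 𝕜) →ₗ[𝕜] X) (hT : Function.Injective T) :
    ∃ c : ℝ, 0 < c ∧ ∀ a, ‖a‖ ≤ c * NX (T a) := by
  obtain ⟨κ, hκ1, hκ⟩ := hX.exists_one_le
  obtain ⟨B, hB, hTB⟩ := hX.exists_le_norm T
  by_contra! hcon
  have : ∀ k : ℕ, ∃ a : n → 𝕜, ‖a‖ = 1 ∧ ((k : ℝ) + 1) * NX (T a) ≤ 1 := by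
    intro k
    obtain ⟨a, ha⟩ := hcon (k + 1) (by positivity)
    have ha0 : 0 < ‖a‖ := lt_of_le_of_lt (mul_nonneg (by positivity) (hX.nonneg _)) ha
    refine ⟨((‖a‖⁻¹ : ℝ) : 𝕜) • a, ?_, ?_⟩
    · simp [norm_smul, ha0.ne']
    · rw [map_smul, hX.smul]
      simp only [RCLike.norm_ofReal, abs_inv, abs_norm]
      rw [← mul_assoc, mul_comm _ (‖a‖⁻¹), mul_assoc, inv_mul_le_iff₀ ha0]
      linarith
  choose a ha1 ha2 using this
  obtain ⟨b, hb, φ, hφ, hlim⟩ := (isCompact_sphere (0 : n → 𝕜) 1).tendsto_subseq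
    (x := a) (fun k => by simp [ha1])
  have hb1 : ‖b‖ = 1 := by simpa using hb
  -- A quasi-norm need not be continuous, so the limit point is compared with the sequence through
  -- `T b = T (b - a (φ k)) + T (a (φ k))`.
  have key : NX (T b) ≤ 0 := by
    have hle : ∀ k, NX (T b) ≤ κ * (B * ‖b - a (φ k)‖ + 1 / ((k : ℝ) + 1)) := by
      intro k
      have e : T b = T (b - a (φ k)) + T (a (φ k)) := by simp
      rw [e]
      refine (hκ _ _).trans ?_
      have h1 := hTB (b - a (φ k))
      have h2 : NX (T (a (φ k))) ≤ 1 / ((k : ℝ) + 1) := by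
        rw [le_div_iff₀ (by positivity), mul_comm]
        refine le_trans ?_ (ha2 (φ k))
        have := hφ.id_le k
        gcongr
        · exact hX.nonneg _
        · exact this
      gcongr
    refine ge_of_tendsto' (x := Filter.atTop) ?_ hle
    have h1 : Filter.Tendsto (fun k => ‖b - a (φ k)‖) Filter.atTop (nhds 0) := by
      have := (tendsto_const_nhds (x := b)).sub hlim
      simpa using this.norm
    have h2 := tendsto_one_div_add_atTop_nhds_zero_nat (𝕜 := ℝ)
    simpa using ((h1.const_mul B).add h2).const_mul κ
  have hb0 : T b = 0 := (hX.eq_zero_iff _).1 (le_antisymm key (hX.nonneg _))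
  have : b = 0 := hT (by simpa using hb0)
  simp [this] at hb1

/-- If an injective `T` can be approximated arbitrarily well by maps `T'` with `Ω ∘ T'` uniformly
near linear, then `Ω ∘ T` is near linear, with a constant that does not depend on `T`. -/
theorem exists_nearLinear_of_approx_gauge (hX : IsQuasiNorm 𝕜 NX) (hY : IsQuasiNorm 𝕜 NY)
    (hΩ : IsQuasiLinear 𝕜 NX NY Ω) (C₀ : ℝ) :
    ∃ C : ℝ, 0 ≤ C ∧ ∀ (n : Type v) [Fintype n] [DecidableEq n] (T : (n → 𝕜) →ₗ[𝕜] X),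
      Function.Injective T →
      (∀ ε : ℝ, 0 < ε → ∃ T' : (n → 𝕜) →ₗ[𝕜] X,
        (∀ i, NX (T (Pi.single i 1) - T' (Pi.single i 1)) ≤ ε) ∧
        NearLinear 𝕜 (fun v => NX (T v) + NX (T' v)) NY C₀ (Ω ∘ T')) →
      NearLinear 𝕜 (NX ∘ T) NY C (Ω ∘ T) := by
  obtain ⟨κ, hκ1, hκ⟩ := hX.exists_one_le
  obtain ⟨D, hD0, hD⟩ := hΩ.exists_nonneg hX
  obtain ⟨κ', hκ1', hκ'⟩ := hY.exists_one_le
  refine ⟨κ' * (D * (2 * κ + 1) + κ' * (|C₀| * (1 + 2 * κ) + 1)), by positivity,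
    fun n _ _ T hT hap => ?_⟩
  obtain ⟨c, hc0, hc⟩ := hX.exists_norm_le T hT
  obtain ⟨E, hE, B, hB, hsum⟩ := exists_nearLinear_sum hX hY hΩ (Finset.univ : Finset n) 0
  -- `B` and `E` depend on the dimension and `c` on `T`; this choice of precision absorbs them all.
  -- Both `T - T'` and the error of `Ω` on it, a sum of maps of rank at most one, are then bounded
  -- by `NX (T a)` with constant `1`.
  obtain ⟨T', hT', L₁, hL₁⟩ := hap (1 / ((B + E + 1) * c)) (by positivity)
  set ε := 1 / ((B + E + 1) * c) with hε
  have hε0 : 0 < ε := by positivity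
  obtain ⟨hB1, L₂, hL₂⟩ := hsum (n → 𝕜) (fun a => ε * ‖a‖)
    (fun i => (LinearMap.proj i : (n → 𝕜) →ₗ[𝕜] 𝕜).smulRight ((T - T') (Pi.single i 1)))
    (fun v => by positivity) (fun i _ v => by
      simp only [LinearMap.smulRight_apply, LinearMap.proj_apply, hX.smul]
      rw [mul_comm]
      exact mul_le_mul (hT' i) (norm_le_pi_norm v i) (norm_nonneg _) hε0.le)
    (fun i _ => hΩ.nearLinear_smulRight hY _ _ _)
  have hTT : (∑ i, (LinearMap.proj i : (n → 𝕜) →ₗ[𝕜] 𝕜).smulRight ((T - T') (Pi.single i 1))) =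
      T - T' := by
    ext i
    simp [Pi.single_apply]
  rw [hTT] at hB1 hL₂
  have hEN : ∀ a, (B + E + 1) * (ε * ‖a‖) ≤ NX (T a) := by
    intro a
    have := hc a
    calc (B + E + 1) * (ε * ‖a‖) ≤ (B + E + 1) * (ε * (c * NX (T a))) := by gcongr
      _ = NX (T a) := by rw [hε]; field_simp
  refine ⟨L₁ + L₂, fun a => ?_⟩
  have hN0 := hX.nonneg (T a)
  have p0 : 0 ≤ ε * ‖a‖ := by positivity
  have p1 : NX ((T - T') a) ≤ NX (T a) := (hB1 a).trans (by nlinarith [hEN a])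
  have p2 : NY (Ω ((T - T') a) - L₂ a) ≤ NX (T a) := (hL₂ a).trans (by nlinarith [hEN a])
  have p3 : NX (T' a) ≤ 2 * κ * NX (T a) := by
    have e : T' a = T a + (-1 : 𝕜) • (T - T') a := by simp
    rw [e]
    refine (hκ _ _).trans ?_
    rw [hX.smul, norm_neg, norm_one, one_mul]
    nlinarith
  have p4 : NY (Ω (T' a) - L₁ a) ≤ |C₀| * (1 + 2 * κ) * NX (T a) := by
    refine (hL₁ a).trans ?_
    calc C₀ * (NX (T a) + NX (T' a)) ≤ |C₀| * (NX (T a) + NX (T' a)) := by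
          gcongr
          · exact add_nonneg hN0 (hX.nonneg _)
          · exact le_abs_self _
      _ ≤ |C₀| * (NX (T a) + 2 * κ * NX (T a)) := by gcongr
      _ = _ := by ring
  have e : (Ω ∘ T) a - (L₁ + L₂) a = (Ω (T' a + (T - T') a) - Ω (T' a) - Ω ((T - T') a)) +
      ((Ω (T' a) - L₁ a) + (Ω ((T - T') a) - L₂ a)) := by
    have : T' a + (T - T') a = T a := by simp
    rw [this, LinearMap.add_apply, Function.comp]
    abel
  rw [e]
  have q1 : NY (Ω (T' a + (T - T') a) - Ω (T' a) - Ω ((T - T') a)) ≤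
      D * (2 * κ + 1) * NX (T a) := by
    refine (hD _ _).trans ?_
    rw [mul_assoc]
    gcongr
    linarith
  have q2 : NY ((Ω (T' a) - L₁ a) + (Ω ((T - T') a) - L₂ a)) ≤
      κ' * (|C₀| * (1 + 2 * κ) + 1) * NX (T a) := by
    refine (hκ' _ _).trans ?_
    rw [mul_assoc]
    gcongr
    linarith
  refine (hκ' _ _).trans ?_
  simp only [Function.comp]
  rw [mul_assoc]
  gcongr
  linarith

theorem exists_nearLinear_of_approx (hX : IsQuasiNorm 𝕜 NX) (hY : IsQuasiNorm 𝕜 NY)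
    (hΩ : IsQuasiLinear 𝕜 NX NY Ω) (C₀ : ℝ) :
    ∃ C : ℝ, 0 ≤ C ∧ ∀ (n : Type v) [Fintype n] [DecidableEq n] (T : (n → 𝕜) →ₗ[𝕜] X),
      Function.Injective T →
      (∀ ε : ℝ, 0 < ε → ∃ T' : (n → 𝕜) →ₗ[𝕜] X,
        (∀ i, NX (T (Pi.single i 1) - T' (Pi.single i 1)) ≤ ε) ∧
        NearLinear 𝕜 (NX ∘ T') NY C₀ (Ω ∘ T')) →
      NearLinear 𝕜 (NX ∘ T) NY C (Ω ∘ T) := by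
  obtain ⟨C, hC, h⟩ := exists_nearLinear_of_approx_gauge hX hY hΩ |C₀|
  refine ⟨C, hC, fun n _ _ T hT hap => h n T hT fun ε hε => ?_⟩
  obtain ⟨T', h1, h2⟩ := hap ε hε
  refine ⟨T', h1, h2.mono fun v => ?_⟩
  refine (mul_le_mul_of_nonneg_right (le_abs_self _) (hX.nonneg _)).trans ?_
  exact mul_le_mul_of_nonneg_left (le_add_of_nonneg_left (hX.nonneg _)) (abs_nonneg _)

/-- `Ω` is locally trivial with constant `C`. -/
def IsLocallyTrivialWith (𝕜 : Type*) {X Y : Type*} [RCLike 𝕜] [AddCommGroup X] [Module 𝕜 X]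
    [AddCommGroup Y] [Module 𝕜 Y] (NX : X → ℝ) (NY : Y → ℝ) (Ω : X → Y) (C : ℝ) : Prop :=
  ∀ F : Submodule 𝕜 X, FiniteDimensional 𝕜 F →
    ∃ L : F →ₗ[𝕜] Y, ∀ x : F, NY (Ω x - L x) ≤ C * NX x

theorem isLocallyTrivialWith_of_forall_injective {C : ℝ}
    (h : ∀ (n : ℕ) (T : (Fin n → 𝕜) →ₗ[𝕜] X), Function.Injective T →
      NearLinear 𝕜 (NX ∘ T) NY C (Ω ∘ T)) : IsLocallyTrivialWith 𝕜 NX NY Ω C := by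
  intro F hF
  let b := Module.finBasis 𝕜 F
  obtain ⟨L, hL⟩ := h _ (F.subtype ∘ₗ b.equivFun.symm.toLinearMap)
    (F.injective_subtype.comp b.equivFun.symm.injective)
  refine ⟨L ∘ₗ b.equivFun.toLinearMap, fun x => ?_⟩
  simpa using hL (b.equivFun x)

/-- On the span of a finite family a locally trivial map is near linear. -/
theorem IsLocallyTrivialWith.nearLinear {C : ℝ} (h : IsLocallyTrivialWith 𝕜 NX NY Ω C)
    [FiniteDimensional 𝕜 V] (T : V →ₗ[𝕜] X) : NearLinear 𝕜 (NX ∘ T) NY C (Ω ∘ T) := by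
  obtain ⟨L, hL⟩ := h (LinearMap.range T) inferInstance
  exact ⟨L ∘ₗ T.rangeRestrict, fun v => hL (T.rangeRestrict v)⟩

/-- A constant of local triviality on `S` would serve every family, contradicting `hw n` as soon as
`n` exceeds it. -/
theorem not_isLocallyTrivialOn {ι : ℕ → Type} [∀ n, Fintype (ι n)] (hX : ∀ x, 0 ≤ NX x)
    (w : ∀ n, ι n → X)
    (hw : ∀ n : ℕ, ¬ NearLinear 𝕜 (NX ∘ Fintype.linearCombination 𝕜 (w n)) NY n
      (Ω ∘ Fintype.linearCombination 𝕜 (w n))) (S : Submodule 𝕜 X) (hS : ∀ n i, w n i ∈ S) :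
    ¬ IsLocallyTrivialOn 𝕜 NX NY Ω S := by
  intro h
  obtain ⟨C, hC⟩ := h
  obtain ⟨n, hn⟩ := exists_nat_ge C
  refine hw n ?_
  have hC' : IsLocallyTrivialWith 𝕜 (fun x : S => NX x) NY (fun x : S => Ω x) C := hC
  have := hC'.nearLinear (Fintype.linearCombination 𝕜 fun i => (⟨w n i, hS n i⟩ : S))
  obtain ⟨L, hL⟩ := this.mono_const (fun v => hX _) hn
  refine ⟨L, fun v => ?_⟩
  have e : ((Fintype.linearCombination 𝕜 fun i => (⟨w n i, hS n i⟩ : S)) v : X) =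
      Fintype.linearCombination 𝕜 (w n) v := by
    simp [Fintype.linearCombination_apply]
  simpa [e] using hL v

/-- Zero members can be discarded. This is needed for normalization and for the injectivity demanded
by the perturbation lemma. -/
theorem nearLinear_linearCombination_of_ne_zero {ι : Type*} [Fintype ι] (w : ι → X)
    [DecidablePred fun i => w i ≠ 0] {C : ℝ}
    (h : NearLinear 𝕜 (NX ∘ Fintype.linearCombination 𝕜 fun i : {i // w i ≠ 0} => w i) NY C
      (Ω ∘ Fintype.linearCombination 𝕜 fun i : {i // w i ≠ 0} => w i)) :
    NearLinear 𝕜 (NX ∘ Fintype.linearCombination 𝕜 w) NY C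
      (Ω ∘ Fintype.linearCombination 𝕜 w) := by
  have e : ⇑(Fintype.linearCombination 𝕜 (fun i : {i // w i ≠ 0} => w i)) ∘
      ⇑(LinearMap.funLeft 𝕜 𝕜 (Subtype.val : {i // w i ≠ 0} → ι)) =
      ⇑(Fintype.linearCombination 𝕜 w) := by
    funext a
    simp only [Function.comp, Fintype.linearCombination_apply, LinearMap.funLeft_apply]
    rw [← Finset.sum_subtype (Finset.univ.filter fun i => w i ≠ 0) (by simp)
      (fun i => a i • w i)]
    refine Finset.sum_filter_of_ne fun i _ h h0 => h (by simp [h0])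
  have := h.comp (LinearMap.funLeft 𝕜 𝕜 (Subtype.val : {i // w i ≠ 0} → ι))
  rwa [Function.comp_assoc, Function.comp_assoc, e] at this

end NearLinear

/-! ### Disjoint families in `L_p`: splitting a bad set. -/

section LpFamilies

open MeasureTheory

variable {𝕜 : Type*} [RCLike 𝕜] {α : Type*} [MeasurableSpace α] {μ : Measure α} {p : ℝ≥0∞}

theorem isQuasiNorm_Lp (hp : 0 < p) : IsQuasiNorm 𝕜 (fun f : Lp 𝕜 p μ => ‖f‖) where
  nonneg f := by rw [Lp.norm_def]; exact ENNReal.toReal_nonneg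
  eq_zero_iff f := Lp.norm_eq_zero_iff hp
  smul c f := by
    rw [Lp.norm_def, Lp.norm_def, eLpNorm_congr_ae (Lp.coeFn_smul c f), eLpNorm_const_smul,
      ENNReal.toReal_mul]
    simp
  add_le := by
    refine ⟨(ENNReal.LpAddConst p).toReal, fun f g => ?_⟩
    rw [Lp.norm_def, Lp.norm_def, Lp.norm_def, eLpNorm_congr_ae (Lp.coeFn_add f g),
      ← ENNReal.toReal_add (Lp.eLpNorm_ne_top f) (Lp.eLpNorm_ne_top g), ← ENNReal.toReal_mul]
    refine ENNReal.toReal_mono ?_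
      (eLpNorm_add_le' (Lp.aestronglyMeasurable f) (Lp.aestronglyMeasurable g) p)
    exact ENNReal.mul_ne_top (ENNReal.LpAddConst_lt_top p).ne
      (ENNReal.add_ne_top.2 ⟨(Lp.eLpNorm_ne_top f), (Lp.eLpNorm_ne_top g)⟩)

/-- Multiplication by the indicator function of a measurable set, as a linear map on `L_p`. -/
noncomputable def lpIndicator (𝕜 : Type*) [RCLike 𝕜] (μ : Measure α) (p : ℝ≥0∞) {A : Set α}
    (hA : MeasurableSet A) : Lp 𝕜 p μ →ₗ[𝕜] Lp 𝕜 p μ where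
  toFun f := ((Lp.memLp f).indicator hA).toLp
  map_add' f g := by
    rw [← MemLp.toLp_add, MemLp.toLp_eq_toLp_iff, ← Set.indicator_add']
    filter_upwards [Lp.coeFn_add f g] with t ht
    by_cases h : t ∈ A <;> simp only [h, Set.indicator_of_mem, Set.indicator_of_notMem, not_false_iff, ht]
  map_smul' c f := by
    rw [RingHom.id_apply, ← MemLp.toLp_const_smul, MemLp.toLp_eq_toLp_iff]
    filter_upwards [Lp.coeFn_smul c f] with t ht
    by_cases h : t ∈ A <;> simp [h, ht]

theorem coeFn_lpIndicator {A : Set α} (hA : MeasurableSet A) (f : Lp 𝕜 p μ) :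
    (lpIndicator 𝕜 μ p hA f : α → 𝕜) =ᵐ[μ] A.indicator f := by
  rw [lpIndicator, LinearMap.coe_mk, AddHom.coe_mk]
  exact MemLp.coeFn_toLp _

theorem norm_lpIndicator_le {A : Set α} (hA : MeasurableSet A) (f : Lp 𝕜 p μ) :
    ‖lpIndicator 𝕜 μ p hA f‖ ≤ ‖f‖ := by
  refine Lp.norm_le_norm_of_ae_le ?_
  filter_upwards [coeFn_lpIndicator hA f] with t ht
  rw [ht]
  exact norm_indicator_le_norm_self _ _

theorem lpIndicator_add_compl {A : Set α} (hA : MeasurableSet A) (f : Lp 𝕜 p μ) :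
    lpIndicator 𝕜 μ p hA f + lpIndicator 𝕜 μ p hA.compl f = f := by
  ext1
  filter_upwards [coeFn_lpIndicator hA f, coeFn_lpIndicator hA.compl f,
    Lp.coeFn_add (lpIndicator 𝕜 μ p hA f) (lpIndicator 𝕜 μ p hA.compl f)] with t h1 h2 h3
  rw [h3, Pi.add_apply, h1, h2]
  by_cases h : t ∈ A <;> simp [h]

theorem lpIndicator_eq_self {A : Set α} (hA : MeasurableSet A) {f : Lp 𝕜 p μ}
    (hf : ∀ᵐ t ∂μ, t ∉ A → f t = 0) : lpIndicator 𝕜 μ p hA f = f := by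
  ext1
  filter_upwards [coeFn_lpIndicator hA f, hf] with t h1 h2
  rw [h1]
  by_cases h : t ∈ A
  · simp [h]
  · simp [h, h2 h]

theorem lpIndicator_eq_zero {A : Set α} (hA : MeasurableSet A) {f : Lp 𝕜 p μ}
    (hf : ∀ᵐ t ∂μ, t ∈ A → f t = 0) : lpIndicator 𝕜 μ p hA f = 0 := by
  ext1
  filter_upwards [coeFn_lpIndicator hA f, hf, Lp.coeFn_zero 𝕜 p μ] with t h1 h2 h3
  rw [h1, h3]
  by_cases h : t ∈ A
  · simp [h, h2 h]
  · simp [h]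

theorem comp_linearCombination {X Y : Type*} [AddCommGroup X] [Module 𝕜 X] [AddCommGroup Y]
    [Module 𝕜 Y] {ι : Type*} [Fintype ι] (P : X →ₗ[𝕜] Y) (w : ι → X) :
    P ∘ₗ Fintype.linearCombination 𝕜 w = Fintype.linearCombination 𝕜 (P ∘ w) := by
  ext; simp [Fintype.linearCombination_apply]

variable {Y : Type*} [AddCommGroup Y] [Module 𝕜 Y] {NY : Y → ℝ} {Ω : Lp 𝕜 p μ → Y}

/-- `Ω` is within `C` of a linear map on the span of each finite family of disjointly supported
functions that vanish off `A`. -/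
def NearLinearOnDisjoint (NY : Y → ℝ) (Ω : Lp 𝕜 p μ → Y) (C : ℝ) (A : Set α) : Prop :=
  ∀ (ι : Type) [Fintype ι] (w : ι → Lp 𝕜 p μ),
    (∀ i j, i ≠ j → ∀ᵐ t ∂μ, w i t = 0 ∨ w j t = 0) → (∀ i, ∀ᵐ t ∂μ, t ∉ A → w i t = 0) →
    NearLinear 𝕜 (fun v => ‖Fintype.linearCombination 𝕜 w v‖) NY C
      (Ω ∘ Fintype.linearCombination 𝕜 w)

theorem NearLinearOnDisjoint.mono_const {C C' : ℝ} {A : Set α}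
    (h : NearLinearOnDisjoint NY Ω C A) (hC : C ≤ C') : NearLinearOnDisjoint NY Ω C' A :=
  fun ι _ w h1 h2 => (h ι w h1 h2).mono_const
    (fun v => by rw [Lp.norm_def]; exact ENNReal.toReal_nonneg) hC

theorem NearLinearOnDisjoint.comp_lpIndicator {C : ℝ} {D E : Set α} (hD : MeasurableSet D)
    (h : NearLinearOnDisjoint NY Ω C E) {ι : Type} [Fintype ι] {w : ι → Lp 𝕜 p μ}
    (hd : ∀ i j, i ≠ j → ∀ᵐ t ∂μ, w i t = 0 ∨ w j t = 0)
    (hw : ∀ i, ∀ᵐ t ∂μ, t ∉ E → t ∈ D → w i t = 0) :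
    NearLinear 𝕜 (fun v => ‖Fintype.linearCombination 𝕜 w v‖) NY |C|
      (Ω ∘ ⇑(lpIndicator 𝕜 μ p hD ∘ₗ Fintype.linearCombination 𝕜 w)) := by
  have hd' : ∀ i, ∀ᵐ t ∂μ, (lpIndicator 𝕜 μ p hD ∘ w) i t = D.indicator (w i) t :=
    fun i => coeFn_lpIndicator hD (w i)
  have := (h.mono_const (le_abs_self C)) ι (lpIndicator 𝕜 μ p hD ∘ w) (fun i j hij => by
      filter_upwards [hd' i, hd' j, hd i j hij] with t h1 h2 h3
      rw [h1, h2]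
      by_cases h : t ∈ D <;> simp [h, h3])
    (fun i => by
      filter_upwards [hd' i, hw i] with t h1 h2 h3
      rw [h1]
      by_cases h : t ∈ D
      · simp [h, h2 h3 h]
      · simp [h])
  rw [← comp_linearCombination] at this
  exact this.mono fun v => mul_le_mul_of_nonneg_left (norm_lpIndicator_le hD _) (abs_nonneg C)

/-- Cut every function along `A`: multiplication by an indicator keeps families disjoint and does
not increase norms, and the part off `A` lives in `B`. -/
theorem NearLinearOnDisjoint.union (hp : 0 < p) (hY : IsQuasiNorm 𝕜 NY)
    (hΩ : IsQuasiLinear 𝕜 (fun f : Lp 𝕜 p μ => ‖f‖) NY Ω) {C₁ C₂ : ℝ} {A B : Set α}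
    (hA : MeasurableSet A) (h₁ : NearLinearOnDisjoint NY Ω C₁ A)
    (h₂ : NearLinearOnDisjoint NY Ω C₂ B) : ∃ C, NearLinearOnDisjoint NY Ω C (A ∪ B) := by
  obtain ⟨C, hC, h⟩ := exists_nearLinear_add (isQuasiNorm_Lp hp) hY hΩ |C₁| |C₂|
  refine ⟨C, fun ι _ w hd hs => ?_⟩
  have hT : lpIndicator 𝕜 μ p hA ∘ₗ Fintype.linearCombination 𝕜 w +
      lpIndicator 𝕜 μ p hA.compl ∘ₗ Fintype.linearCombination 𝕜 w =
      Fintype.linearCombination 𝕜 w :=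
    LinearMap.ext fun v => lpIndicator_add_compl hA _
  have := h (ι → 𝕜) (fun v => ‖Fintype.linearCombination 𝕜 w v‖)
    (lpIndicator 𝕜 μ p hA ∘ₗ Fintype.linearCombination 𝕜 w)
    (lpIndicator 𝕜 μ p hA.compl ∘ₗ Fintype.linearCombination 𝕜 w)
    (fun v => (isQuasiNorm_Lp (𝕜 := 𝕜) hp).nonneg _)
    (fun v => norm_lpIndicator_le hA _) (fun v => norm_lpIndicator_le hA.compl _)
    (h₁.comp_lpIndicator hA hd fun i => Filter.Eventually.of_forall fun t h h' => absurd h' h)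
    (h₂.comp_lpIndicator hA.compl hd fun i => by
      filter_upwards [hs i] with t ht h1 h2
      exact ht (by simp_all))
  rwa [hT] at this

/-- If no such `A` existed, every good subset of `R` would be good with the one constant `n`.
Applied to the supports of the members of a family, this bounds all families in `R` uniformly, since
one member with a bad support can be set aside: `Ω` is exactly linear on a line. -/
theorem exists_not_nearLinearOnDisjoint_and_diff (hp : 0 < p) (hY : IsQuasiNorm 𝕜 NY)
    (hΩ : IsQuasiLinear 𝕜 (fun f : Lp 𝕜 p μ => ‖f‖) NY Ω) {R : Set α} (hR : MeasurableSet R)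
    (hbad : ∀ C, ¬ NearLinearOnDisjoint NY Ω C R) (n : ℝ) :
    ∃ A ⊆ R, MeasurableSet A ∧ ¬ NearLinearOnDisjoint NY Ω n A ∧
      ∀ C, ¬ NearLinearOnDisjoint NY Ω C (R \ A) := by
  classical
  by_contra! hcon
  -- A good set failing at level `n` would have a good complement in `R` by `hcon`, and then `R`
  -- itself would be good.
  have H1 : ∀ A ⊆ R, MeasurableSet A → (∃ C, NearLinearOnDisjoint NY Ω C A) →
      NearLinearOnDisjoint NY Ω n A := by
    intro A hAR hA ⟨C, hC⟩
    by_contra hn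
    obtain ⟨C', hC'⟩ := hcon A hAR hA hn
    obtain ⟨C'', h⟩ := hC.union hp hY hΩ hA hC'
    rw [Set.union_sdiff_cancel hAR] at h
    exact hbad _ h
  obtain ⟨C, hC, h⟩ := exists_nearLinear_add (isQuasiNorm_Lp hp) hY hΩ |n| 0
  refine hbad (max C n) fun ι _ w hd hs => ?_
  have hq : ∀ f : Lp 𝕜 p μ, 0 ≤ ‖f‖ := (isQuasiNorm_Lp (𝕜 := 𝕜) hp).nonneg
  set B : ι → Set α := fun i => R ∩ (w i) ⁻¹' {0}ᶜ with hB
  have hBm : ∀ i, MeasurableSet (B i) := fun i => hR.inter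
    ((Lp.stronglyMeasurable (w i)).measurable (measurableSet_singleton 0).compl)
  have hsB : ∀ i, ∀ᵐ t ∂μ, t ∉ B i → w i t = 0 := fun i => by
    filter_upwards [hs i] with t h1 h2
    by_contra h3
    exact h2 ⟨by_contra fun h4 => h3 (h1 h4), h3⟩
  by_cases hex : ∃ i, ∀ C, ¬ NearLinearOnDisjoint NY Ω C (B i)
  -- If the support `B i` is bad, `R \ B i` is good, hence good at level `n`, and it carries all the
  -- other members.
  · obtain ⟨i, hi⟩ := hex
    have h1 := H1 (R \ B i) Set.sdiff_subset (hR.diff (hBm i))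
      (hcon (B i) Set.inter_subset_left (hBm i) (hi n))
    have hsum : lpIndicator 𝕜 μ p (hBm i).compl ∘ₗ Fintype.linearCombination 𝕜 w +
        lpIndicator 𝕜 μ p (hBm i) ∘ₗ Fintype.linearCombination 𝕜 w =
        Fintype.linearCombination 𝕜 w :=
      LinearMap.ext fun v => by
        rw [add_comm]
        exact lpIndicator_add_compl (hBm i) _
    have e2 : lpIndicator 𝕜 μ p (hBm i) ∘ₗ Fintype.linearCombination 𝕜 w =
        (LinearMap.proj i : (ι → 𝕜) →ₗ[𝕜] 𝕜).smulRight (w i) := by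
      ext1 j
      ext1
      rw [comp_linearCombination]
      simp only [LinearMap.comp_apply, LinearMap.single_apply, LinearMap.smulRight_apply,
        Fintype.linearCombination_apply_single, LinearMap.proj_apply, Function.comp]
      rcases eq_or_ne j i with rfl | hj
      · simp [lpIndicator_eq_self (hBm j) (hsB j)]
      · have : lpIndicator 𝕜 μ p (hBm i) (w j) = 0 := lpIndicator_eq_zero _ (by
          filter_upwards [hd j i hj] with t h1 h2
          exact h1.resolve_right h2.2)
        simp [this, hj.symm]
    have h3 := h1.comp_lpIndicator (hBm i).compl hd (by
      intro j
      filter_upwards [hs j] with t h1 h2 h3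
      exact h1 fun h4 => h2 ⟨h4, h3⟩)
    have h4 := h (ι → 𝕜) (fun v => ‖Fintype.linearCombination 𝕜 w v‖)
      (lpIndicator 𝕜 μ p (hBm i).compl ∘ₗ Fintype.linearCombination 𝕜 w)
      (lpIndicator 𝕜 μ p (hBm i) ∘ₗ Fintype.linearCombination 𝕜 w) (fun v => hq _)
      (fun v => norm_lpIndicator_le (hBm i).compl _) (fun v => norm_lpIndicator_le (hBm i) _) h3
      (by rw [e2]; exact hΩ.nearLinear_smulRight hY _ _ _)
    rw [hsum] at h4
    exact h4.mono_const (fun v => hq _) (le_max_left _ _)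
  · push Not at hex
    -- All supports are good, so their finite union is good; its constant depends on the family, but
    -- `H1` replaces it by `n`.
    have hU : ∀ s : Finset ι, MeasurableSet (⋃ i ∈ s, B i) ∧
        ∃ C, NearLinearOnDisjoint NY Ω C (⋃ i ∈ s, B i) := by
      intro s
      induction s using Finset.induction_on with
      | empty =>
        refine ⟨by simp, 0, fun κ _ v _ hv => ⟨0, fun a => ?_⟩⟩
        have : v = 0 := funext fun i => by
          rw [← lpIndicator_eq_self (f := v i) MeasurableSet.empty (by simpa using hv i)]
          exact lpIndicator_eq_zero _ (by simp)
        simp [this, Fintype.linearCombination_apply, hΩ.map_zero, hY.map_zero]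
      | insert i s his ih =>
        rw [Finset.set_biUnion_insert]
        obtain ⟨C, hC⟩ := hex i
        obtain ⟨C', hC'⟩ := ih.2
        exact ⟨(hBm i).union ih.1, hC.union hp hY hΩ (hBm i) hC'⟩
    have h1 := H1 (⋃ i ∈ (Finset.univ : Finset ι), B i)
      (Set.iUnion₂_subset fun i _ => Set.inter_subset_left) (hU _).1 (hU _).2
    refine (h1 ι w hd fun i => ?_).mono_const (fun v => hq _) (le_max_right _ _)
    filter_upwards [hsB i] with t h1 h2
    exact h1 fun h3 => h2 (Set.mem_biUnion (Finset.mem_coe.2 (Finset.mem_univ i)) h3)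

/-- Exhaustion: `R n` is the still bad remainder, from which a set bad at level `n` is removed next.
-/
theorem exists_disjoint_not_nearLinearOnDisjoint (hp : 0 < p) (hY : IsQuasiNorm 𝕜 NY)
    (hΩ : IsQuasiLinear 𝕜 (fun f : Lp 𝕜 p μ => ‖f‖) NY Ω)
    (hbad : ∀ C, ¬ NearLinearOnDisjoint NY Ω C Set.univ) :
    ∃ A : ℕ → Set α, Pairwise (Function.onFun Disjoint A) ∧
      ∀ n : ℕ, ¬ NearLinearOnDisjoint NY Ω n (A n) := by
  choose F hFR hFm hFn hFb using
    fun (R : {R : Set α // MeasurableSet R ∧ ∀ C, ¬ NearLinearOnDisjoint NY Ω C R}) (n : ℕ) =>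
      exists_not_nearLinearOnDisjoint_and_diff hp hY hΩ R.2.1 R.2.2 n
  let R : ℕ → {R : Set α // MeasurableSet R ∧ ∀ C, ¬ NearLinearOnDisjoint NY Ω C R} := fun n =>
    Nat.rec ⟨Set.univ, MeasurableSet.univ, hbad⟩
      (fun n R => ⟨R.1 \ F R n, R.2.1.diff (hFm R n), hFb R n⟩) n
  have hR : ∀ n, (R (n + 1)).1 = (R n).1 \ F (R n) n := fun n => rfl
  have hanti : Antitone fun n => (R n).1 :=
    antitone_nat_of_succ_le fun n => by rw [hR]; exact Set.sdiff_subset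
  refine ⟨fun n => F (R n) n, ?_, fun n => hFn (R n) n⟩
  have hlt : ∀ m n, m < n → Disjoint (F (R m) m) (F (R n) n) := by
    intro m n hmn
    refine Set.disjoint_of_subset_right ((hFR (R n) n).trans (hanti (Nat.succ_le_of_lt hmn))) ?_
    exact Set.disjoint_sdiff_right
  intro m n hmn
  rcases hmn.lt_or_gt with h | h
  · exact hlt m n h
  · exact (hlt n m h).symm

end LpFamilies

/-! ### Density of simple functions, and bad disjoint families in `L_p`. -/

section LpDensity

open MeasureTheory

variable {𝕜 : Type*} [RCLike 𝕜] {α : Type*} [MeasurableSpace α] {μ : Measure α} {p : ℝ≥0∞}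

/-- For `p = ∞` the essential range lies in a compact ball, so rounding to finitely many points of a
dense sequence gives a uniform approximation. -/
theorem MeasureTheory.MemLp.exists_simpleFunc_eLpNorm_sub_le {E : Type*} [NormedAddCommGroup E]
    [ProperSpace E] {f : α → E} (hf : MemLp f p μ) {ε : ℝ≥0∞} (hε : ε ≠ 0) :
    ∃ g : SimpleFunc α E, eLpNorm (f - ⇑g) p μ ≤ ε ∧ MemLp g p μ := by
  rcases eq_or_ne p ∞ with rfl | hp
  · borelize E
    obtain ⟨R, hR⟩ : ∃ R : ℝ, ∀ᵐ t ∂μ, ‖f t‖ ≤ R := by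
      have hlt := hf.2
      rw [eLpNorm_exponent_top] at hlt
      refine ⟨(eLpNormEssSup f μ).toReal, ?_⟩
      filter_upwards [ae_le_eLpNormEssSup (f := f) (μ := μ)] with t ht
      rw [← toReal_enorm]
      exact ENNReal.toReal_mono hlt.ne ht
    let e := TopologicalSpace.denseSeq E
    have hcov : Metric.closedBall (0 : E) R ⊆ ⋃ N, ⋃ k ≤ N, Metric.eball (e k) ε := by
      intro x _
      obtain ⟨k, hk⟩ := (TopologicalSpace.denseRange_denseSeq E).exists_mem_open
        (Metric.isOpen_eball (x := x) (ε := ε)) ⟨x, Metric.mem_eball_self hε.bot_lt⟩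
      simp only [Set.mem_iUnion]
      exact ⟨k, k, le_rfl, Metric.mem_eball_comm.1 hk⟩
    obtain ⟨N, hN⟩ := (isCompact_closedBall (0 : E) R).elim_directed_cover
      (fun N => ⋃ k ≤ N, Metric.eball (e k) ε)
      (fun N => isOpen_biUnion fun k _ => Metric.isOpen_eball) hcov
      (Monotone.directed_le fun m n hmn => Set.biUnion_subset_biUnion_left fun k hk => le_trans (show k ≤ m from hk) hmn)
    refine ⟨(SimpleFunc.nearestPt e N).comp (hf.1.mk f) hf.1.measurable_mk, ?_,
      SimpleFunc.memLp_top _ _⟩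
    rw [eLpNorm_exponent_top]
    refine essSup_le_of_ae_le _ ?_
    filter_upwards [hf.1.ae_eq_mk, hR] with t h1 h2
    have h3 := hN (mem_closedBall_zero_iff.2 h2)
    simp only [Set.mem_iUnion] at h3
    obtain ⟨k, hk, h3⟩ := h3
    rw [Pi.sub_apply, SimpleFunc.coe_comp, Function.comp, ← h1, ← edist_eq_enorm_sub, edist_comm]
    refine (SimpleFunc.edist_nearestPt_le e _ hk).trans ?_
    rw [edist_comm]
    exact h3.le
  · obtain ⟨g, hg, hg'⟩ := hf.exists_simpleFunc_eLpNorm_sub_lt hp hε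
    exact ⟨g, hg.le, hg'⟩

/-- Finitely many functions in `L_p` can be approximated by linear combinations of finitely many
disjointly supported functions. -/
theorem exists_disjoint_approx {n : Type*} [Fintype n] [DecidableEq n] (f : n → Lp 𝕜 p μ) {ε : ℝ}
    (hε : 0 < ε) :
    ∃ (k : ℕ) (w : Fin k → Lp 𝕜 p μ) (S : (n → 𝕜) →ₗ[𝕜] (Fin k → 𝕜)),
      (∀ i j, i ≠ j → ∀ᵐ t ∂μ, w i t = 0 ∨ w j t = 0) ∧
      ∀ i, ‖f i - Fintype.linearCombination 𝕜 w (S (Pi.single i 1))‖ ≤ ε := by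
  classical
  have hF : MemLp (fun t i => f i t) p μ := MemLp.of_eval fun i => Lp.memLp (f i)
  -- One vector-valued simple function approximates all the `f i` together; the indicators of its
  -- level sets are the disjoint functions.
  obtain ⟨g, hg, hgm⟩ := hF.exists_simpleFunc_eLpNorm_sub_le
    (ε := ENNReal.ofReal ε) (by simpa using hε)
  -- The value `0` is dropped because its level set may have infinite measure.
  let s := g.range.filter (· ≠ 0)
  let e := s.equivFin.symm
  have hmem : ∀ j, MemLp ((g ⁻¹' {(e j : n → 𝕜)}).indicator fun _ => (1 : 𝕜)) p μ := by
    intro j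
    have h0 : (e j : n → 𝕜) ≠ 0 := (Finset.mem_filter.1 (e j).2).2
    refine hgm.of_le_mul (c := ‖(e j : n → 𝕜)‖⁻¹) ?_ (Filter.Eventually.of_forall fun t => ?_)
    · exact (stronglyMeasurable_const.indicator (g.measurableSet_fiber _)).aestronglyMeasurable
    · by_cases h : g t = e j
      · simp [h, h0]
      · simp only [Set.mem_preimage, Set.mem_singleton_iff, h, not_false_iff,
          Set.indicator_of_notMem, norm_zero]
        positivity
  refine ⟨s.card, fun j => (hmem j).toLp,
    LinearMap.pi fun j => Fintype.linearCombination 𝕜 (e j : n → 𝕜), fun i j hij => ?_, fun i => ?_⟩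
  · filter_upwards [(hmem i).coeFn_toLp, (hmem j).coeFn_toLp] with t h1 h2
    rw [h1, h2]
    by_cases h : g t = e i
    · right
      have : g t ≠ e j := fun h' => hij (e.injective (Subtype.ext (h.symm.trans h')))
      simp [this]
    · left
      simp [h]
  · have hi : ⇑(Fintype.linearCombination 𝕜 (fun j => (hmem j).toLp)
        ((LinearMap.pi fun j => Fintype.linearCombination 𝕜 (e j : n → 𝕜)) (Pi.single i 1))) =ᵐ[μ]
        fun t => g t i := by
      simp only [Fintype.linearCombination_apply, LinearMap.pi_apply]
      refine (Lp.coeFn_finsetSum _ _).trans ?_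
      have h1 : ∀ᵐ t ∂μ, ∀ j, ((e j : n → 𝕜) i • (hmem j).toLp : Lp 𝕜 p μ) t =
          (e j : n → 𝕜) i * (g ⁻¹' {(e j : n → 𝕜)}).indicator (fun _ => (1 : 𝕜)) t := by
        rw [ae_all_iff]
        intro j
        filter_upwards [(hmem j).coeFn_toLp, Lp.coeFn_smul ((e j : n → 𝕜) i) (hmem j).toLp] with
          t h1 h2
        rw [h2, Pi.smul_apply, h1, smul_eq_mul]
      filter_upwards [h1] with t ht
      rw [Finset.sum_apply]
      have : ∀ j, ((∑ k, (Pi.single i 1 : n → 𝕜) k • (e j : n → 𝕜) k) • (hmem j).toLp : Lp 𝕜 p μ) t =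
          (e j : n → 𝕜) i * (g ⁻¹' {(e j : n → 𝕜)}).indicator (fun _ => (1 : 𝕜)) t := by
        intro j
        rw [← ht j]
        simp [Pi.single_apply]
      simp only [this]
      by_cases h0 : g t = 0
      · rw [h0]
        refine Finset.sum_eq_zero fun j _ => ?_
        have : (e j : n → 𝕜) ≠ 0 := (Finset.mem_filter.1 (e j).2).2
        simp [h0, this.symm]
      · have hts : g t ∈ s := Finset.mem_filter.2 ⟨g.mem_range_self t, h0⟩
        rw [Finset.sum_eq_single (e.symm ⟨g t, hts⟩)]
        · simp
        · intro j _ hj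
          have : g t ≠ e j := fun h => hj (by
            rw [Equiv.eq_symm_apply]; exact Subtype.ext h.symm)
          simp [this]
        · simp
    rw [Lp.norm_def]
    refine ENNReal.toReal_le_of_le_ofReal hε.le (le_trans ?_ hg)
    refine eLpNorm_mono_ae ?_
    filter_upwards [Lp.coeFn_sub (f i) (Fintype.linearCombination 𝕜 (fun j => (hmem j).toLp)
        ((LinearMap.pi fun j => Fintype.linearCombination 𝕜 (e j : n → 𝕜)) (Pi.single i 1))), hi]
      with t h1 h2
    rw [h1, Pi.sub_apply, h2]
    exact norm_le_pi_norm (fun i => f i t - g t i) i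

variable {Y : Type*} [AddCommGroup Y] [Module 𝕜 Y] {NY : Y → ℝ} {Ω : Lp 𝕜 p μ → Y}

theorem NearLinearOnDisjoint.isLocallyTrivial (hp : 0 < p) (hY : IsQuasiNorm 𝕜 NY)
    (hΩ : IsQuasiLinear 𝕜 (fun f : Lp 𝕜 p μ => ‖f‖) NY Ω) {C : ℝ}
    (h : NearLinearOnDisjoint NY Ω C Set.univ) :
    IsLocallyTrivial 𝕜 (fun f : Lp 𝕜 p μ => ‖f‖) NY Ω := by
  obtain ⟨C', -, h'⟩ := exists_nearLinear_of_approx (isQuasiNorm_Lp hp) hY hΩ C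
  refine ⟨C', isLocallyTrivialWith_of_forall_injective fun n T hT => h' _ T hT fun ε hε => ?_⟩
  obtain ⟨k, w, S, hd, hw⟩ := exists_disjoint_approx (fun i => T (Pi.single i 1)) hε
  exact ⟨Fintype.linearCombination 𝕜 w ∘ₗ S, hw, (h _ w hd (by simp)).comp S⟩

theorem exists_disjoint_families_Lp (hp : 0 < p) (hY : IsQuasiNorm 𝕜 NY)
    (hΩ : IsQuasiLinear 𝕜 (fun f : Lp 𝕜 p μ => ‖f‖) NY Ω)
    (hbad : ¬ IsLocallyTrivial 𝕜 (fun f : Lp 𝕜 p μ => ‖f‖) NY Ω) :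
    ∃ (ι : ℕ → Type) (_ : ∀ n, Fintype (ι n)) (w : ∀ n, ι n → Lp 𝕜 p μ), (∀ n i, w n i ≠ 0) ∧
      (∀ x y : Σ n, ι n, x ≠ y → ∀ᵐ t ∂μ, w x.1 x.2 t = 0 ∨ w y.1 y.2 t = 0) ∧
      ∀ n : ℕ, ¬ NearLinear 𝕜 ((fun f => ‖f‖) ∘ Fintype.linearCombination 𝕜 (w n)) NY n
        (Ω ∘ Fintype.linearCombination 𝕜 (w n)) := by
  classical
  obtain ⟨A, hA, hn⟩ := exists_disjoint_not_nearLinearOnDisjoint hp hY hΩ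
    fun C hC => hbad (hC.isLocallyTrivial hp hY hΩ)
  unfold NearLinearOnDisjoint at hn
  push Not at hn
  choose κ hκ v hv1 hv2 hv3 using hn
  refine ⟨fun n => {i : κ n // v n i ≠ 0}, fun n => inferInstance, fun n i => v n i,
    fun n i => i.2, ?_, fun n h => hv3 n (nearLinear_linearCombination_of_ne_zero (v n) h)⟩
  rintro ⟨m, i, hi⟩ ⟨n, j, hj⟩ hne
  rcases eq_or_ne m n with rfl | hmn
  · exact hv1 m i j fun h => hne (by subst h; rfl)
  · filter_upwards [hv2 m i, hv2 n j] with t h1 h2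
    by_cases ht : t ∈ A m
    · exact Or.inr (h2 (Set.disjoint_left.1 (hA hmn) ht))
    · exact Or.inl (h1 ht)

end LpDensity

/-! ### From bad families to one normalized sequence. -/

section Enumeration

variable {𝕜 : Type*} [RCLike 𝕜] {X Y : Type*} [AddCommGroup X] [Module 𝕜 X]
  [AddCommGroup Y] [Module 𝕜 Y] {NX : X → ℝ} {NY : Y → ℝ} {Ω : X → Y}

theorem exists_normalized_sequence (hX : IsQuasiNorm 𝕜 NX) (hY : IsQuasiNorm 𝕜 NY)
    (hΩ : IsQuasiLinear 𝕜 NX NY Ω) {ι : ℕ → Type} [∀ n, Fintype (ι n)] (w : ∀ n, ι n → X)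
    (hw0 : ∀ n i, w n i ≠ 0)
    (hw : ∀ n : ℕ, ¬ NearLinear 𝕜 (NX ∘ Fintype.linearCombination 𝕜 (w n)) NY n
      (Ω ∘ Fintype.linearCombination 𝕜 (w n))) :
    ∃ (e : ℕ ≃ Σ n, ι n) (u : ℕ → X) (c : ℕ → 𝕜), (∀ k, u k = c k • w (e k).1 (e k).2) ∧
      (∀ k, NX (u k) = 1) ∧ ∀ S : Submodule 𝕜 X, (∀ k, u k ∈ S) →
        ¬ IsLocallyTrivialOn 𝕜 NX NY Ω S := by
  -- An empty family is trivially near linear; nonemptiness makes the union of the families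
  -- infinite, hence enumerable by all of `ℕ`.
  have hne : ∀ n, Nonempty (ι n) := by
    intro n
    by_contra hemp
    rw [not_nonempty_iff] at hemp
    refine hw n ⟨0, fun v => ?_⟩
    simp [Fintype.linearCombination_apply, hΩ.map_zero, hY.map_zero, hX.map_zero]
  let i₀ := fun n => (hne n).some
  have : Infinite (Σ n, ι n) := Infinite.of_injective (fun n => ⟨n, i₀ n⟩) fun m n h => by
    simpa using congrArg Sigma.fst h
  obtain ⟨e⟩ : Nonempty (ℕ ≃ Σ n, ι n) := nonempty_equiv_of_countable
  have hpos : ∀ n i, NX (w n i) ≠ 0 := fun n i h => hw0 n i ((hX.eq_zero_iff _).1 h)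
  refine ⟨e, fun k => (((NX (w (e k).1 (e k).2))⁻¹ : ℝ) : 𝕜) • w (e k).1 (e k).2, _,
    fun k => rfl, fun k => ?_, fun S hS => not_isLocallyTrivialOn hX.nonneg w hw S fun n i => ?_⟩
  · rw [hX.smul]
    simp [abs_of_nonneg (hX.nonneg _), hpos]
  · have h1 := hS (e.symm ⟨n, i⟩)
    beta_reduce at h1
    rw [Equiv.apply_symm_apply] at h1
    have h2 := S.smul_mem ((NX (w n i) : ℝ) : 𝕜) h1
    simpa [smul_smul, hpos] using h2

end Enumeration

/-! ### Normalized disjoint functions span an isometric copy of `ℓ_p`. -/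

section CopyOfLp

open MeasureTheory Filter Topology

variable {𝕜 : Type*} [RCLike 𝕜] {α : Type*} [MeasurableSpace α] {μ : Measure α} {p : ℝ≥0∞}
  {f : ℕ → Lp 𝕜 p μ}

theorem ae_exists_forall_ne_eq_zero
    (hd : ∀ m n, m ≠ n → ∀ᵐ t ∂μ, f m t = 0 ∨ f n t = 0) :
    ∀ᵐ t ∂μ, ∃ n₀, ∀ n, n ≠ n₀ → f n t = 0 := by
  have : ∀ᵐ t ∂μ, ∀ m n, m ≠ n → f m t = 0 ∨ f n t = 0 := by
    simp only [ae_all_iff]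
    exact hd
  filter_upwards [this] with t ht
  by_cases h : ∃ n₀, f n₀ t ≠ 0
  · obtain ⟨n₀, h₀⟩ := h
    exact ⟨n₀, fun n hn => (ht n n₀ hn).resolve_right h₀⟩
  · push Not at h
    exact ⟨0, fun n _ => h n⟩

theorem tsum_mul_eq_of_forall_ne {R : Type*} [NonUnitalNonAssocSemiring R] [TopologicalSpace R]
    {x : ℕ → R} {n₀ : ℕ} (h : ∀ n, n ≠ n₀ → x n = 0) (a : ℕ → R) :
    ∑' n, a n * x n = a n₀ * x n₀ :=
  tsum_eq_single n₀ fun n hn => by rw [h n hn, mul_zero]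

theorem aestronglyMeasurable_tsum_disjoint (hd : ∀ m n, m ≠ n → ∀ᵐ t ∂μ, f m t = 0 ∨ f n t = 0)
    (a : ℕ → 𝕜) : AEStronglyMeasurable (fun t => ∑' n, a n * f n t) μ := by
  refine aestronglyMeasurable_of_tendsto_ae atTop
    (f := fun N t => ∑ n ∈ Finset.range N, a n * f n t) (fun N => ?_) ?_
  · refine Finset.aestronglyMeasurable_fun_sum _ fun n _ => ?_
    exact (Lp.aestronglyMeasurable (f n)).const_mul (a n)
  · filter_upwards [ae_exists_forall_ne_eq_zero hd] with t ⟨n₀, h⟩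
    have : HasSum (fun n => a n * f n t) (a n₀ * f n₀ t) :=
      hasSum_single n₀ fun n hn => by rw [h n hn, mul_zero]
    rw [this.tsum_eq]
    exact this.tendsto_sum_nat

/-- At almost every point at most one term survives, so the power of the sum is the sum of the
powers. -/
theorem lintegral_tsum_disjoint (hp : 0 < p) (hp' : p ≠ ∞)
    (hd : ∀ m n, m ≠ n → ∀ᵐ t ∂μ, f m t = 0 ∨ f n t = 0) (hf : ∀ n, ‖f n‖ = 1) (a : ℕ → 𝕜) :
    ∫⁻ t, ‖∑' n, a n * f n t‖ₑ ^ p.toReal ∂μ = ∑' n, ‖a n‖ₑ ^ p.toReal := by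
  have hr : 0 < p.toReal := ENNReal.toReal_pos hp.ne' hp'
  have h1 : ∀ n, ∫⁻ t, ‖f n t‖ₑ ^ p.toReal ∂μ = 1 := by
    intro n
    have h := hf n
    rw [Lp.norm_def, ENNReal.toReal_eq_one_iff, eLpNorm_eq_lintegral_rpow_enorm_toReal hp.ne' hp'] at h
    rw [← ENNReal.rpow_one (∫⁻ t, ‖f n t‖ₑ ^ p.toReal ∂μ), ← one_div_mul_cancel hr.ne',
      ENNReal.rpow_mul, h, ENNReal.one_rpow]
  calc ∫⁻ t, ‖∑' n, a n * f n t‖ₑ ^ p.toReal ∂μ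
      = ∫⁻ t, ∑' n, ‖a n‖ₑ ^ p.toReal * ‖f n t‖ₑ ^ p.toReal ∂μ := by
        refine lintegral_congr_ae ?_
        filter_upwards [ae_exists_forall_ne_eq_zero hd] with t ⟨n₀, h⟩
        rw [tsum_mul_eq_of_forall_ne h, enorm_mul, ENNReal.mul_rpow_of_nonneg _ _ hr.le]
        rw [tsum_mul_eq_of_forall_ne (x := fun n => ‖f n t‖ₑ ^ p.toReal) (n₀ := n₀)]
        intro n hn
        simp [h n hn, hr]
    _ = ∑' n, ‖a n‖ₑ ^ p.toReal := by
        rw [lintegral_tsum]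
        · refine tsum_congr fun n => ?_
          rw [lintegral_const_mul' _ _ (ENNReal.rpow_ne_top_of_nonneg hr.le enorm_ne_top), h1,
            mul_one]
        · intro n
          exact ((Lp.aestronglyMeasurable (f n)).enorm.pow_const _).const_mul _

theorem tsum_enorm_rpow_lt_top_iff (hp : 0 < p) (hp' : p ≠ ∞) (a : ℕ → 𝕜) :
    ∑' n, ‖a n‖ₑ ^ p.toReal < ∞ ↔ Memℓp a p := by
  have hr : 0 < p.toReal := ENNReal.toReal_pos hp.ne' hp'
  have e : ∀ n, ‖a n‖ₑ ^ p.toReal = ENNReal.ofReal (‖a n‖ ^ p.toReal) := fun n => by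
    rw [← ofReal_norm, ENNReal.ofReal_rpow_of_nonneg (norm_nonneg _) hr.le]
  rw [memℓp_gen_iff hr]
  simp only [e]
  refine ⟨fun h => ?_, fun h => ?_⟩
  · have := ENNReal.summable_toReal h.ne
    refine this.congr fun n => ?_
    rw [ENNReal.toReal_ofReal (by positivity)]
  · rw [← ENNReal.ofReal_tsum_of_nonneg (fun n => by positivity) h]
    exact ENNReal.ofReal_lt_top

theorem toReal_tsum_enorm_rpow (hp : 0 < p) (hp' : p ≠ ∞) (a : lp (fun _ : ℕ => 𝕜) p) :
    ((∑' n, ‖a n‖ₑ ^ p.toReal) ^ (1 / p.toReal)).toReal = ‖a‖ := by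
  have hr : 0 < p.toReal := ENNReal.toReal_pos hp.ne' hp'
  have e : ∀ n, ‖a n‖ₑ ^ p.toReal = ENNReal.ofReal (‖a n‖ ^ p.toReal) := fun n => by
    rw [← ofReal_norm, ENNReal.ofReal_rpow_of_nonneg (norm_nonneg _) hr.le]
  rw [lp.norm_eq_tsum_rpow hr, ← ENNReal.toReal_rpow]
  simp only [e]
  rw [← ENNReal.ofReal_tsum_of_nonneg (fun n => by positivity) ((memℓp_gen_iff hr).1 (lp.memℓp a)),
    ENNReal.toReal_ofReal (tsum_nonneg fun n => by positivity)]

/-- One direction defines the embedding; the other puts the coefficients of a limit back into `ℓ_p`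
and so shows that the range is closed. -/
theorem memLp_tsum_disjoint_iff (hp : 0 < p) (hp' : p ≠ ∞)
    (hd : ∀ m n, m ≠ n → ∀ᵐ t ∂μ, f m t = 0 ∨ f n t = 0) (hf : ∀ n, ‖f n‖ = 1) (a : ℕ → 𝕜) :
    MemLp (fun t => ∑' n, a n * f n t) p μ ↔ Memℓp a p := by
  rw [← tsum_enorm_rpow_lt_top_iff hp hp', ← lintegral_tsum_disjoint hp hp' hd hf,
    ← eLpNorm_lt_top_iff_lintegral_rpow_enorm_lt_top hp.ne' hp']
  exact ⟨fun h => h.2, fun h => ⟨aestronglyMeasurable_tsum_disjoint hd a, h⟩⟩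

/-- The isometry `a ↦ ∑ aₙ fₙ` of `ℓ_p` into `L_p` given by normalized disjointly supported
functions. -/
noncomputable def lpEmbedding (hp : 0 < p) (hp' : p ≠ ∞)
    (hd : ∀ m n, m ≠ n → ∀ᵐ t ∂μ, f m t = 0 ∨ f n t = 0) (hf : ∀ n, ‖f n‖ = 1) :
    lp (fun _ : ℕ => 𝕜) p →ₗ[𝕜] Lp 𝕜 p μ where
  toFun a := MemLp.toLp _ ((memLp_tsum_disjoint_iff hp hp' hd hf a).2 (lp.memℓp a))
  map_add' a b := by
    rw [← MemLp.toLp_add, MemLp.toLp_eq_toLp_iff]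
    filter_upwards [ae_exists_forall_ne_eq_zero hd] with t ⟨n₀, h⟩
    rw [Pi.add_apply, tsum_mul_eq_of_forall_ne h, tsum_mul_eq_of_forall_ne h,
      tsum_mul_eq_of_forall_ne h, lp.coeFn_add, Pi.add_apply, add_mul]
  map_smul' c a := by
    rw [RingHom.id_apply, ← MemLp.toLp_const_smul, MemLp.toLp_eq_toLp_iff]
    filter_upwards [ae_exists_forall_ne_eq_zero hd] with t ⟨n₀, h⟩
    rw [Pi.smul_apply, tsum_mul_eq_of_forall_ne h, tsum_mul_eq_of_forall_ne h, lp.coeFn_smul,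
      Pi.smul_apply, smul_eq_mul, smul_eq_mul, mul_assoc]

variable (hp : 0 < p) (hp' : p ≠ ∞) (hd : ∀ m n, m ≠ n → ∀ᵐ t ∂μ, f m t = 0 ∨ f n t = 0)
  (hf : ∀ n, ‖f n‖ = 1)

theorem coeFn_lpEmbedding (a : lp (fun _ : ℕ => 𝕜) p) :
    (lpEmbedding hp hp' hd hf a : α → 𝕜) =ᵐ[μ] fun t => ∑' n, a n * f n t := by
  rw [lpEmbedding, LinearMap.coe_mk, AddHom.coe_mk]
  exact MemLp.coeFn_toLp _

theorem norm_lpEmbedding (a : lp (fun _ : ℕ => 𝕜) p) : ‖lpEmbedding hp hp' hd hf a‖ = ‖a‖ := by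
  rw [Lp.norm_def, eLpNorm_congr_ae (coeFn_lpEmbedding hp hp' hd hf a),
    eLpNorm_eq_lintegral_rpow_enorm_toReal hp.ne' hp', lintegral_tsum_disjoint hp hp' hd hf,
    toReal_tsum_enorm_rpow hp hp']

theorem lpEmbedding_single (n : ℕ) :
    lpEmbedding hp hp' hd hf (lp.single p n (1 : 𝕜)) = f n := by
  ext1
  filter_upwards [coeFn_lpEmbedding hp hp' hd hf (lp.single p n (1 : 𝕜)),
    ae_exists_forall_ne_eq_zero hd] with t h1 ⟨n₀, h2⟩
  rw [h1, tsum_mul_eq_of_forall_ne h2, lp.coeFn_single]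
  rcases eq_or_ne n n₀ with rfl | h
  · simp
  · simp [h.symm, h2 n h]

theorem span_le_range_lpEmbedding :
    Submodule.span 𝕜 (Set.range f) ≤ LinearMap.range (lpEmbedding hp hp' hd hf) := by
  rw [Submodule.span_le]
  rintro _ ⟨n, rfl⟩
  exact ⟨_, lpEmbedding_single hp hp' hd hf n⟩

/-- The argument is pointwise and so includes `p < 1`: a subsequence of the approximants converges
almost everywhere, each coefficient converges because `f n` is nonzero on a set of positive measure,
and the limit series represents `x`. -/
theorem mem_range_lpEmbedding_of_approx {x : Lp 𝕜 p μ}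
    (hx : ∀ ε : ℝ, 0 < ε → ∃ y ∈ Submodule.span 𝕜 (Set.range f), ‖x - y‖ < ε) :
    x ∈ LinearMap.range (lpEmbedding hp hp' hd hf) := by
  have : ∀ k : ℕ, ∃ a : lp (fun _ : ℕ => 𝕜) p,
      ‖x - lpEmbedding hp hp' hd hf a‖ < 1 / ((k : ℝ) + 1) := by
    intro k
    obtain ⟨y, hy, hxy⟩ := hx (1 / ((k : ℝ) + 1)) (by positivity)
    obtain ⟨a, rfl⟩ := span_le_range_lpEmbedding hp hp' hd hf hy
    exact ⟨a, hxy⟩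
  choose a ha using this
  have hlim : Tendsto (fun k => eLpNorm (⇑(lpEmbedding hp hp' hd hf (a k)) - ⇑x) p μ) atTop
      (𝓝 0) := by
    have h0 : Tendsto (fun k : ℕ => ENNReal.ofReal (1 / ((k : ℝ) + 1))) atTop (𝓝 0) := by
      simpa using (ENNReal.tendsto_ofReal (tendsto_one_div_add_atTop_nhds_zero_nat (𝕜 := ℝ)))
    refine tendsto_of_tendsto_of_tendsto_of_le_of_le tendsto_const_nhds h0 (fun _ => bot_le)
      fun k => ?_
    have := (ha k).le
    rw [Lp.norm_def] at this
    rw [← eLpNorm_neg, neg_sub, ← eLpNorm_congr_ae (Lp.coeFn_sub x _)]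
    exact (ENNReal.le_ofReal_iff_toReal_le (Lp.eLpNorm_ne_top _) (by positivity)).2 this
  obtain ⟨ns, -, hns⟩ := (tendstoInMeasure_of_tendsto_eLpNorm hp.ne'
    (fun k => Lp.aestronglyMeasurable _) (Lp.aestronglyMeasurable x) hlim).exists_seq_tendsto_ae
  have hae : ∀ᵐ t ∂μ, ∀ k, lpEmbedding hp hp' hd hf (a k) t = ∑' n, a k n * f n t :=
    ae_all_iff.2 fun k => coeFn_lpEmbedding hp hp' hd hf (a k)
  have hβ : ∀ n, ∃ b : 𝕜, Tendsto (fun i => a (ns i) n) atTop (𝓝 b) := by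
    intro n
    have hne : ∃ᵐ t ∂μ, f n t ≠ 0 := by
      intro h
      simp only [not_not] at h
      have : f n = 0 := Lp.eq_zero_iff_ae_eq_zero.2 h
      have h1 := hf n
      rw [this, Lp.norm_zero] at h1
      exact zero_ne_one h1
    obtain ⟨t, h0, ⟨n₀, h1⟩, h2, h3⟩ :=
      (hne.and_eventually ((ae_exists_forall_ne_eq_zero hd).and (hae.and hns))).exists
    have hn : n = n₀ := by_contra fun h => h0 (h1 n h)
    subst hn
    simp only [h2, tsum_mul_eq_of_forall_ne h1] at h3
    refine ⟨x t * (f n t)⁻¹, (h3.mul_const (f n t)⁻¹).congr fun i => ?_⟩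
    rw [mul_assoc, mul_inv_cancel₀ h0, mul_one]
  choose β hβ using hβ
  have hxβ : (x : α → 𝕜) =ᵐ[μ] fun t => ∑' n, β n * f n t := by
    filter_upwards [ae_exists_forall_ne_eq_zero hd, hae, hns] with t ⟨n₀, h1⟩ h2 h3
    simp only [h2, tsum_mul_eq_of_forall_ne h1] at h3 ⊢
    exact tendsto_nhds_unique h3 ((hβ n₀).mul_const _)
  have hβm : Memℓp β p :=
    (memLp_tsum_disjoint_iff hp hp' hd hf β).1 ((memLp_congr_ae hxβ).1 (Lp.memLp x))
  refine ⟨⟨β, hβm⟩, ?_⟩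
  ext1
  exact (coeFn_lpEmbedding hp hp' hd hf ⟨β, hβm⟩).trans hxβ.symm

theorem isCopySpannedBy_lp :
    IsCopySpannedBy 𝕜 (fun a : lp (fun _ : ℕ => 𝕜) p => ‖a‖) (fun n => lp.single p n 1)
      (fun x : Lp 𝕜 p μ => ‖x‖) f (LinearMap.range (lpEmbedding hp hp' hd hf)) := by
  have hr : 0 < p.toReal := ENNReal.toReal_pos hp.ne' hp'
  refine ⟨fun x => ⟨?_, mem_range_lpEmbedding_of_approx hp hp' hd hf⟩, ?_⟩
  · rintro ⟨a, rfl⟩ ε hε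
    have h := lp.hasSum_norm hr a
    obtain ⟨s, hs⟩ := (h.eventually (lt_mem_nhds (sub_lt_self (‖a‖ ^ p.toReal)
      (Real.rpow_pos_of_pos hε p.toReal)))).exists
    refine ⟨lpEmbedding hp hp' hd hf (∑ i ∈ s, lp.single p i (a i)), ?_, ?_⟩
    · rw [map_sum]
      refine Submodule.sum_mem _ fun i _ => ?_
      have : (lp.single p i (a i) : lp (fun _ : ℕ => 𝕜) p) = a i • lp.single p i (1 : 𝕜) := by
        rw [← lp.single_smul, smul_eq_mul, mul_one]
      rw [this, map_smul, lpEmbedding_single]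
      exact Submodule.smul_mem _ _ (Submodule.subset_span ⟨i, rfl⟩)
    · beta_reduce
      rw [← map_sub, norm_lpEmbedding,
        ← Real.rpow_lt_rpow_iff (lp.norm_nonneg' _) hε.le hr, lp.norm_compl_sum_single hr]
      linarith
  · have hinj : Function.Injective (lpEmbedding hp hp' hd hf) := by
      rw [← LinearMap.ker_eq_bot, LinearMap.ker_eq_bot']
      intro a ha
      have := norm_lpEmbedding hp hp' hd hf a
      rw [ha, Lp.norm_zero] at this
      exact lp.norm_eq_zero_iff.1 this.symm
    refine ⟨LinearEquiv.ofInjective _ hinj, fun n => lpEmbedding_single hp hp' hd hf n, 1, 1,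
      one_pos, fun a => ?_⟩
    have := norm_lpEmbedding hp hp' hd hf a
    simp [LinearEquiv.ofInjective_apply, this]

end CopyOfLp

/-! ### Sequences with sup-norm estimates span an isometric copy of `c₀`. -/

section CopyOfC0

open Filter Topology

variable {𝕜 : Type*} [RCLike 𝕜]

theorem norm_sum_mul_disjoint_le {ι : Type*} {x : ι → 𝕜} (hx : ∀ m n, m ≠ n → x m = 0 ∨ x n = 0)
    (s : Finset ι) {a : ι → 𝕜} {M : ℝ} (hM : 0 ≤ M) (h : ∀ i ∈ s, ‖a i * x i‖ ≤ M) :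
    ‖∑ i ∈ s, a i * x i‖ ≤ M := by
  classical
  by_cases h0 : ∃ i ∈ s, x i ≠ 0
  · obtain ⟨i, hi, hi0⟩ := h0
    rw [Finset.sum_eq_single_of_mem i hi fun j _ hj => by
      rw [(hx j i hj).resolve_right hi0, mul_zero]]
    exact h i hi
  · push Not at h0
    rw [Finset.sum_eq_zero fun i hi => by rw [h0 i hi, mul_zero], norm_zero]
    exact hM

theorem norm_mul_le_norm_sum_disjoint {ι : Type*} {x : ι → 𝕜}
    (hx : ∀ m n, m ≠ n → x m = 0 ∨ x n = 0) {s : Finset ι} (a : ι → 𝕜) {j : ι} (hj : j ∈ s) :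
    ‖a j * x j‖ ≤ ‖∑ i ∈ s, a i * x i‖ := by
  by_cases h0 : x j = 0
  · simp [h0]
  · rw [Finset.sum_eq_single_of_mem j hj fun i _ hi => by
      rw [(hx i j hi).resolve_right h0, mul_zero]]

variable {X : Type*} [NormedAddCommGroup X] [NormedSpace 𝕜 X] [CompleteSpace X] {u : ℕ → X}
  (h1 : ∀ (s : Finset ℕ) (a : ℕ → 𝕜) (M : ℝ), 0 ≤ M → (∀ i ∈ s, ‖a i‖ ≤ M) →
    ‖∑ i ∈ s, a i • u i‖ ≤ M)
  (h2 : ∀ (s : Finset ℕ) (a : ℕ → 𝕜), ∀ j ∈ s, ‖a j‖ ≤ ‖∑ i ∈ s, a i • u i‖)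

theorem summable_smul_of_c0 {u : ℕ → X}
    (h1 : ∀ (s : Finset ℕ) (a : ℕ → 𝕜) (M : ℝ), 0 ≤ M → (∀ i ∈ s, ‖a i‖ ≤ M) →
      ‖∑ i ∈ s, a i • u i‖ ≤ M) (a : C₀(ℕ, 𝕜)) : Summable fun i => a i • u i := by
  rw [summable_iff_vanishing_norm]
  intro ε hε
  have ha : Tendsto a cofinite (𝓝 0) := by
    rw [← cocompact_eq_cofinite]
    exact zero_at_infty a
  have hfin := (ha.norm.eventually (gt_mem_nhds (by rw [norm_zero]; exact half_pos hε)))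
  refine ⟨(show {i | ¬ ‖a i‖ < ε / 2}.Finite from hfin).toFinset, fun t ht => ?_⟩
  refine (h1 t a (ε / 2) (half_pos hε).le fun i hi => ?_).trans_lt (half_lt_self hε)
  by_contra hcon
  refine Finset.disjoint_left.1 ht hi ?_
  simp only [Set.Finite.mem_toFinset, Set.mem_ofPred_eq]
  exact fun h => hcon h.le

/-- The isometry `a ↦ ∑ aₙ uₙ` of `c₀` into `X`. -/
noncomputable def c0Embedding : C₀(ℕ, 𝕜) →ₗᵢ[𝕜] X where
  toFun a := ∑' i, a i • u i
  map_add' a b := by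
    rw [← (summable_smul_of_c0 h1 a).tsum_add (summable_smul_of_c0 h1 b)]
    simp [add_smul]
  map_smul' c a := by
    rw [RingHom.id_apply, ← (summable_smul_of_c0 h1 a).tsum_const_smul]
    simp [smul_smul]
  norm_map' a := by
    have hs := (summable_smul_of_c0 h1 a).hasSum
    have hb : ∀ i, ‖a i‖ ≤ ‖a‖ := fun i => a.toBCF.norm_coe_le_norm i
    refine le_antisymm ?_ ?_
    · exact le_of_tendsto' hs.norm fun s => h1 s a ‖a‖ (norm_nonneg _) fun i _ => hb i
    · rw [← ZeroAtInftyContinuousMap.norm_toBCF_eq_norm]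
      refine (BoundedContinuousFunction.norm_le (norm_nonneg _)).2 fun j => ?_
      refine ge_of_tendsto hs.norm ?_
      filter_upwards [eventually_ge_atTop {j}] with s hsj
      exact h2 s a j (hsj (Finset.mem_singleton_self j))

theorem c0Embedding_single (n : ℕ) : c0Embedding h1 h2 (c0Single 𝕜 n) = u n := by
  have e : ∀ i, (c0Single 𝕜 n : C₀(ℕ, 𝕜)) i = (Pi.single n 1 : ℕ → 𝕜) i := fun i => rfl
  change ∑' i, (c0Single 𝕜 n : C₀(ℕ, 𝕜)) i • u i = u n
  rw [tsum_eq_single n fun i hi => by rw [e, Pi.single_eq_of_ne hi, zero_smul], e,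
    Pi.single_eq_same, one_smul]

/-- Together `h1` and `h2` say that a finite combination has exactly the sup norm of its
coefficients. The range is closed as the isometric image of a complete space. -/
theorem isCopySpannedBy_c0 :
    IsCopySpannedBy 𝕜 (fun a : C₀(ℕ, 𝕜) => ‖a‖) (c0Single 𝕜) (fun x : X => ‖x‖) u
      (LinearMap.range (c0Embedding h1 h2).toLinearMap) := by
  refine ⟨fun x => ⟨?_, fun hx => ?_⟩, ?_⟩
  · rintro ⟨a, rfl⟩ ε hε
    obtain ⟨s, hs⟩ := ((summable_smul_of_c0 h1 a).hasSum.eventually (Metric.ball_mem_nhds _ hε)).exists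
    refine ⟨∑ i ∈ s, a i • u i, Submodule.sum_mem _ fun i _ => Submodule.smul_mem _ (a i)
      (Submodule.subset_span ⟨i, rfl⟩), ?_⟩
    rw [dist_comm, dist_eq_norm] at hs
    exact hs
  · have hcl : IsClosed (Set.range (c0Embedding h1 h2)) :=
      (c0Embedding h1 h2).isometry.isClosedEmbedding.isClosed_range
    have hspan : Submodule.span 𝕜 (Set.range u) ≤
        LinearMap.range (c0Embedding h1 h2).toLinearMap := by
      rw [Submodule.span_le]
      rintro _ ⟨n, rfl⟩
      exact ⟨_, c0Embedding_single h1 h2 n⟩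
    have : x ∈ closure (Set.range (c0Embedding h1 h2)) := by
      rw [Metric.mem_closure_iff]
      intro ε hε
      obtain ⟨y, hy, hxy⟩ := hx ε hε
      exact ⟨y, hspan hy, by rwa [dist_eq_norm]⟩
    rwa [hcl.closure_eq] at this
  · refine ⟨LinearEquiv.ofInjective _ (c0Embedding h1 h2).injective,
      fun n => c0Embedding_single h1 h2 n, 1, 1, one_pos, fun a => ?_⟩
    have := (c0Embedding h1 h2).norm_map a
    have e : ((LinearEquiv.ofInjective _ (c0Embedding h1 h2).injective a :
      LinearMap.range (c0Embedding h1 h2).toLinearMap) : X) = c0Embedding h1 h2 a := rfl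
    beta_reduce
    rw [e, this]
    simp

end CopyOfC0

/-! ### Disjoint sequences in `L_∞` and `C(K)` satisfy these estimates. -/

section DisjointSequences

open MeasureTheory

variable {𝕜 : Type*} [RCLike 𝕜]

theorem exists_isCopySpannedBy_c0_Linfty {α : Type*} [MeasurableSpace α] {μ : Measure α}
    {u : ℕ → Lp 𝕜 ∞ μ} (hd : ∀ m n, m ≠ n → ∀ᵐ t ∂μ, u m t = 0 ∨ u n t = 0)
    (hu : ∀ n, ‖u n‖ = 1) :
    ∃ S, IsCopySpannedBy 𝕜 (fun a : C₀(ℕ, 𝕜) => ‖a‖) (c0Single 𝕜) (fun x : Lp 𝕜 ∞ μ => ‖x‖) u S := by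
  have hd' : ∀ᵐ t ∂μ, ∀ m n, m ≠ n → u m t = 0 ∨ u n t = 0 := by
    simp only [ae_all_iff]
    exact hd
  have hle : ∀ᵐ t ∂μ, ∀ n, ‖u n t‖ ≤ 1 := by
    rw [ae_all_iff]
    intro n
    filter_upwards [ae_le_eLpNormEssSup (f := u n) (μ := μ)] with t ht
    rw [← eLpNorm_exponent_top] at ht
    rw [← hu n, Lp.norm_def, ← toReal_enorm]
    exact ENNReal.toReal_mono (Lp.eLpNorm_ne_top _) ht
  have hsum : ∀ (s : Finset ℕ) (a : ℕ → 𝕜),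
      ⇑(∑ i ∈ s, a i • u i) =ᵐ[μ] fun t => ∑ i ∈ s, a i * u i t := by
    intro s a
    have : ∀ᵐ t ∂μ, ∀ i, (a i • u i : Lp 𝕜 ∞ μ) t = a i * u i t := ae_all_iff.2 fun i => by
      filter_upwards [Lp.coeFn_smul (a i) (u i)] with t ht
      rw [ht, Pi.smul_apply, smul_eq_mul]
    filter_upwards [Lp.coeFn_finsetSum s fun i => a i • u i, this] with t h1 h2
    rw [h1, Finset.sum_apply]
    exact Finset.sum_congr rfl fun i _ => h2 i
  refine ⟨_, isCopySpannedBy_c0 (fun s a M hM ha => ?_) fun s a j hj => ?_⟩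
  · rw [Lp.norm_def, eLpNorm_exponent_top]
    refine ENNReal.toReal_le_of_le_ofReal hM (eLpNormEssSup_le_of_ae_bound ?_)
    filter_upwards [hsum s a, hd', hle] with t h1 h2 h3
    rw [h1]
    refine norm_sum_mul_disjoint_le h2 s hM fun i hi => ?_
    rw [norm_mul]
    exact (mul_le_of_le_one_right (norm_nonneg _) (h3 i)).trans (ha i hi)
  · have : ‖a j‖ = ‖a j • u j‖ := by rw [norm_smul, hu, mul_one]
    rw [this]
    refine Lp.norm_le_norm_of_ae_le ?_
    filter_upwards [hsum s a, hd', Lp.coeFn_smul (a j) (u j)] with t h1 h2 h3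
    rw [h1, h3]
    exact norm_mul_le_norm_sum_disjoint h2 a hj

theorem exists_isCopySpannedBy_c0_continuousMap {K : Type*} [TopologicalSpace K] [CompactSpace K]
    {u : ℕ → C(K, 𝕜)} (hd : ∀ m n, m ≠ n → ∀ t, u m t = 0 ∨ u n t = 0) (hu : ∀ n, ‖u n‖ = 1) :
    ∃ S, IsCopySpannedBy 𝕜 (fun a : C₀(ℕ, 𝕜) => ‖a‖) (c0Single 𝕜) (fun x : C(K, 𝕜) => ‖x‖) u S := by
  refine ⟨_, isCopySpannedBy_c0 (fun s a M hM ha => ?_) fun s a j hj => ?_⟩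
  · refine (ContinuousMap.norm_le _ hM).2 fun t => ?_
    have e : (∑ i ∈ s, a i • u i) t = ∑ i ∈ s, a i * u i t := by simp
    rw [e]
    refine norm_sum_mul_disjoint_le (fun m n h => hd m n h t) s hM fun i hi => ?_
    rw [norm_mul]
    exact (mul_le_of_le_one_right (norm_nonneg _) (((u i).norm_coe_le_norm t).trans (hu i).le)).trans
      (ha i hi)
  · have : ‖a j‖ = ‖a j • u j‖ := by rw [norm_smul, hu, mul_one]
    rw [this]
    refine (ContinuousMap.norm_le _ (norm_nonneg _)).2 fun t => ?_
    refine le_trans ?_ ((∑ i ∈ s, a i • u i).norm_coe_le_norm t)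
    have e : (∑ i ∈ s, a i • u i) t = ∑ i ∈ s, a i * u i t := by simp
    rw [e]
    exact norm_mul_le_norm_sum_disjoint (fun m n h => hd m n h t) a hj

end DisjointSequences

/-! ### Disjoint families in `C(K)`: localizing badness at a point. -/

section ContinuousFamilies

open Filter Topology

variable {𝕜 : Type*} [RCLike 𝕜] {K : Type*} [TopologicalSpace K]

/-- Multiplication by a real-valued function, as a linear map on `C(K)`. -/
def ContinuousMap.realMul (𝕜 : Type*) [RCLike 𝕜] (φ : C(K, ℝ)) : C(K, 𝕜) →ₗ[𝕜] C(K, 𝕜) :=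
  LinearMap.mulLeft 𝕜 (⟨fun t => (φ t : 𝕜), by fun_prop⟩ : C(K, 𝕜))

@[simp]
theorem ContinuousMap.realMul_apply (φ : C(K, ℝ)) (f : C(K, 𝕜)) (t : K) :
    ContinuousMap.realMul 𝕜 φ f t = (φ t : 𝕜) * f t := rfl

theorem ContinuousMap.norm_realMul_le [CompactSpace K] {φ : C(K, ℝ)} (hφ : ∀ t, |φ t| ≤ 1)
    (f : C(K, 𝕜)) : ‖ContinuousMap.realMul 𝕜 φ f‖ ≤ ‖f‖ := by
  refine (ContinuousMap.norm_le _ (norm_nonneg _)).2 fun t => ?_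
  rw [realMul_apply, norm_mul, RCLike.norm_ofReal]
  exact (mul_le_of_le_one_left (norm_nonneg _) (hφ t)).trans (f.norm_coe_le_norm t)

theorem linearCombination_continuousMap_apply {ι : Type*} [Fintype ι] (w : ι → C(K, 𝕜))
    (v : ι → 𝕜) (t : K) : Fintype.linearCombination 𝕜 w v t = ∑ i, v i * w i t := by
  simp [Fintype.linearCombination_apply]

theorem linearCombination_injective_of_disjoint {ι : Type*} [Fintype ι] {w : ι → C(K, 𝕜)}
    (hd : ∀ i j, i ≠ j → ∀ t, w i t = 0 ∨ w j t = 0) (hw : ∀ i, w i ≠ 0) :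
    Function.Injective (Fintype.linearCombination 𝕜 w) := by
  rw [← LinearMap.ker_eq_bot, LinearMap.ker_eq_bot']
  intro v hv
  funext i
  obtain ⟨t, ht⟩ : ∃ t, w i t ≠ 0 := by
    by_contra! h
    exact hw i (ContinuousMap.ext h)
  have h1 := norm_mul_le_norm_sum_disjoint (fun i j hij => hd i j hij t) v (Finset.mem_univ i)
  rw [← linearCombination_continuousMap_apply, hv, ContinuousMap.zero_apply, norm_zero] at h1
  exact (mul_eq_zero.1 (norm_le_zero_iff.1 h1)).resolve_right ht

variable [CompactSpace K]

theorem isQuasiNorm_norm (X : Type*) [NormedAddCommGroup X] [NormedSpace 𝕜 X] :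
    IsQuasiNorm 𝕜 (fun x : X => ‖x‖) :=
  ⟨norm_nonneg, fun _ => norm_eq_zero, norm_smul, 1, fun x y => by
    rw [one_mul]; exact norm_add_le x y⟩

theorem norm_linearCombination_subfamily_le {ι : Type*} [Fintype ι] {w w' : ι → C(K, 𝕜)}
    (hd : ∀ i j, i ≠ j → ∀ t, w i t = 0 ∨ w j t = 0) (hw' : ∀ i, w' i = w i ∨ w' i = 0)
    (v : ι → 𝕜) :
    ‖Fintype.linearCombination 𝕜 w' v‖ ≤ ‖Fintype.linearCombination 𝕜 w v‖ := by
  refine (ContinuousMap.norm_le _ (norm_nonneg _)).2 fun t => ?_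
  refine le_trans ?_ ((Fintype.linearCombination 𝕜 w v).norm_coe_le_norm t)
  rw [linearCombination_continuousMap_apply, linearCombination_continuousMap_apply]
  refine norm_sum_mul_disjoint_le (fun i j hij => ?_) _ (norm_nonneg _) fun i _ => ?_
  · rcases hw' i with h | h <;> rcases hw' j with h' | h' <;> simp [h, h', hd i j hij t]
  · rcases hw' i with h | h
    · rw [h]
      exact norm_mul_le_norm_sum_disjoint (fun i j hij => hd i j hij t) v (Finset.mem_univ i)
    · simp [h]

variable {Y : Type*} [AddCommGroup Y] [Module 𝕜 Y] {NY : Y → ℝ} {Ω : C(K, 𝕜) → Y}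

/-- `Ω` is within `C` of a linear map on the span of each finite family of disjointly supported
continuous functions that vanish off `U`. -/
def NearLinearOnDisjointIn (NY : Y → ℝ) (Ω : C(K, 𝕜) → Y) (C : ℝ) (U : Set K) : Prop :=
  ∀ (ι : Type) [Fintype ι] (w : ι → C(K, 𝕜)),
    (∀ i j, i ≠ j → ∀ t, w i t = 0 ∨ w j t = 0) → (∀ i, ∀ t, t ∉ U → w i t = 0) →
    NearLinear 𝕜 (fun v => ‖Fintype.linearCombination 𝕜 w v‖) NY C
      (Ω ∘ Fintype.linearCombination 𝕜 w)

/-- Multiplication by the members of a subordinate partition of unity preserves disjointness and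
pushes a family into the sets of a finite cover. The number of summands does not depend on the
family. -/
theorem nearLinearOnDisjointIn_univ_of_locally [T2Space K] (hY : IsQuasiNorm 𝕜 NY)
    (hΩ : IsQuasiLinear 𝕜 (fun f : C(K, 𝕜) => ‖f‖) NY Ω)
    (h : ∀ x, ∃ U, IsOpen U ∧ x ∈ U ∧ ∃ C, NearLinearOnDisjointIn NY Ω C U) :
    ∃ C, NearLinearOnDisjointIn NY Ω C Set.univ := by
  choose U hUo hxU C hC using h
  obtain ⟨s, hs⟩ := isCompact_univ.elim_finite_subcover U hUo
    fun x _ => Set.mem_iUnion.2 ⟨x, hxU x⟩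
  obtain ⟨φ, hφ⟩ := PartitionOfUnity.exists_isSubordinate (isClosed_univ (X := K))
    (fun i : s => U i) (fun i => hUo i) (hs.trans (by simp [Set.iUnion_subtype]))
  obtain ⟨D, hD, B, hB, hsum⟩ := exists_nearLinear_sum (isQuasiNorm_norm C(K, 𝕜)) hY hΩ
    (Finset.univ : Finset s) fun i => |C i|
  have hφ1 : ∀ i t, |φ i t| ≤ 1 := fun i t => by
    rw [abs_of_nonneg (φ.nonneg i t)]
    exact φ.le_one i t
  refine ⟨D, fun ι _ w hd _ => ?_⟩
  have hT : ∑ i : s, ContinuousMap.realMul 𝕜 (φ i) ∘ₗ Fintype.linearCombination 𝕜 w =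
      Fintype.linearCombination 𝕜 w := by
    ext1 j
    ext t
    have := φ.sum_eq_one (Set.mem_univ t)
    rw [finsum_eq_sum_of_fintype] at this
    simp only [LinearMap.coe_comp, Function.comp, LinearMap.sum_apply,
      ContinuousMap.sum_apply, ContinuousMap.realMul_apply]
    rw [← Finset.sum_mul, ← RCLike.ofReal_sum, this]
    simp
  have := (hsum (ι → 𝕜) (fun v => ‖Fintype.linearCombination 𝕜 w v‖)
    (fun i => ContinuousMap.realMul 𝕜 (φ i) ∘ₗ Fintype.linearCombination 𝕜 w)
    (fun v => norm_nonneg _) (fun i _ v => ContinuousMap.norm_realMul_le (hφ1 i) _)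
    (fun i _ => ?_)).2
  · rwa [hT] at this
  · have := hC i ι (ContinuousMap.realMul 𝕜 (φ i) ∘ w)
      (fun j k hjk t => by
        rcases hd j k hjk t with h | h <;> simp [h])
      (fun j t ht => by
        have : φ i t = 0 := by
          by_contra h0
          exact ht (hφ i (subset_tsupport _ h0))
        simp [this])
    rw [← comp_linearCombination] at this
    refine this.mono fun v => ?_
    refine (mul_le_mul_of_nonneg_right (le_abs_self _) (norm_nonneg _)).trans ?_
    exact mul_le_mul_of_nonneg_left (ContinuousMap.norm_realMul_le (hφ1 i) _) (abs_nonneg _)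

/-- A disjoint family has at most one member that is nonzero at `x`, and that member costs only a
linear map. If all members vanish at `x`, cutting them off near `x` is a small perturbation. -/
theorem exists_not_nearLinear_vanishing_near [T2Space K] (hY : IsQuasiNorm 𝕜 NY)
    (hΩ : IsQuasiLinear 𝕜 (fun f : C(K, 𝕜) => ‖f‖) NY Ω) {U : Set K} {x : K}
    (hbad : ∀ C, ¬ NearLinearOnDisjointIn NY Ω C U) (n : ℝ) :
    ∃ (ι : Type) (_ : Fintype ι) (w : ι → C(K, 𝕜)),
      (∀ i j, i ≠ j → ∀ t, w i t = 0 ∨ w j t = 0) ∧ (∀ i, ∀ t, t ∉ U → w i t = 0) ∧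
      (∀ᶠ t in 𝓝 x, ∀ i, w i t = 0) ∧
      ¬ NearLinear 𝕜 (fun v => ‖Fintype.linearCombination 𝕜 w v‖) NY n
        (Ω ∘ Fintype.linearCombination 𝕜 w) := by
  classical
  by_contra! hcon
  obtain ⟨C₁, hC₁, happ⟩ := exists_nearLinear_of_approx.{0} (isQuasiNorm_norm C(K, 𝕜)) hY hΩ n
  obtain ⟨C₂, hC₂, hadd⟩ := exists_nearLinear_add (isQuasiNorm_norm C(K, 𝕜)) hY hΩ C₁ 0
  have hvan : ∀ (ι : Type) [Fintype ι] (w : ι → C(K, 𝕜)),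
      (∀ i j, i ≠ j → ∀ t, w i t = 0 ∨ w j t = 0) → (∀ i, ∀ t, t ∉ U → w i t = 0) →
      (∀ i, w i x = 0) →
      NearLinear 𝕜 (fun v => ‖Fintype.linearCombination 𝕜 w v‖) NY C₁
        (Ω ∘ Fintype.linearCombination 𝕜 w) := by
    intro ι _ w hd hs hx
    refine nearLinear_linearCombination_of_ne_zero w (happ _ _
      (linearCombination_injective_of_disjoint (fun i j hij => hd i j fun h => hij (Subtype.ext h))
        fun i => i.2) fun ε hε => ?_)
    have hOo : IsOpen (⋂ i, {t | ‖w i t‖ < ε}) :=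
      isOpen_iInter_of_finite fun i => isOpen_lt (w i).continuous.norm continuous_const
    have hO : (⋂ i, {t | ‖w i t‖ < ε}) ∈ 𝓝 x :=
      hOo.mem_nhds (Set.mem_iInter.2 fun i => by simpa [hx i] using hε)
    obtain ⟨V, hV, hVc, hVO⟩ := exists_mem_nhds_isClosed_subset hO
    -- The cutoff is `0` near `x` and `1` wherever some `w i` reaches `ε`, so it moves each function
    -- by at most `ε`.
    obtain ⟨χ, hχ0, hχ1, hχ⟩ := exists_continuous_zero_one_of_isClosed hVc hOo.isClosed_compl
      (Set.disjoint_compl_right_iff_subset.2 hVO)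
    refine ⟨Fintype.linearCombination 𝕜 fun i : {i // w i ≠ 0} => ContinuousMap.realMul 𝕜 χ (w i),
      fun i => ?_, hcon _ inferInstance _ (fun i j hij t => ?_) (fun i t ht => ?_) ?_⟩
    · simp only [Fintype.linearCombination_apply_single, one_smul]
      refine (ContinuousMap.norm_le _ hε.le).2 fun t => ?_
      have e : (w i - ContinuousMap.realMul 𝕜 χ (w i)) t = ((1 - χ t : ℝ) : 𝕜) * w i t := by
        simp [sub_mul]
      rw [e, norm_mul, RCLike.norm_ofReal, abs_of_nonneg (sub_nonneg.2 (hχ t).2)]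
      by_cases ht : t ∈ ⋂ i, {t | ‖w i t‖ < ε}
      · have h1 : ‖w i t‖ < ε := Set.mem_iInter.1 ht i
        have h2 := (hχ t).1
        exact (mul_le_of_le_one_left (norm_nonneg _) (by linarith)).trans h1.le
      · rw [hχ1 ht]
        simpa using hε.le
    · rcases hd i j (fun h => hij (Subtype.ext h)) t with h | h <;> simp [h]
    · simp [hs i t ht]
    · filter_upwards [hV] with t ht i
      simp [hχ0 ht]
  refine hbad (max C₁ C₂) fun ι _ w hd hs => ?_
  by_cases hex : ∃ i, w i x ≠ 0
  · obtain ⟨i, hi⟩ := hex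
    have hw' : ∀ j, Function.update w i 0 j = w j ∨ Function.update w i 0 j = 0 := fun j => by
      rcases eq_or_ne j i with rfl | h <;> simp [*]
    have hT : Fintype.linearCombination 𝕜 (Function.update w i 0) +
        (LinearMap.proj i : (ι → 𝕜) →ₗ[𝕜] 𝕜).smulRight (w i) = Fintype.linearCombination 𝕜 w := by
      ext1 j
      ext1
      rcases eq_or_ne j i with rfl | h
      · simp
      · simp [h, h.symm]
    have h1 := hvan ι (Function.update w i 0)
      (fun j k hjk t => by
        rcases hw' j with h | h <;> rcases hw' k with h' | h' <;> simp [h, h', hd j k hjk t])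
      (fun j t ht => by rcases hw' j with h | h <;> simp [h, hs j t ht])
      (fun j => by
        rcases eq_or_ne j i with rfl | h
        · simp
        · simpa [h] using (hd j i h x).resolve_right hi)
    have h2 := hadd (ι → 𝕜) (fun v => ‖Fintype.linearCombination 𝕜 w v‖)
      (Fintype.linearCombination 𝕜 (Function.update w i 0))
      ((LinearMap.proj i : (ι → 𝕜) →ₗ[𝕜] 𝕜).smulRight (w i)) (fun v => norm_nonneg _)
      (norm_linearCombination_subfamily_le hd hw')
      (fun v => by
        refine (ContinuousMap.norm_le _ (norm_nonneg _)).2 fun t => ?_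
        refine le_trans ?_ ((Fintype.linearCombination 𝕜 w v).norm_coe_le_norm t)
        rw [linearCombination_continuousMap_apply]
        exact norm_mul_le_norm_sum_disjoint (fun i j hij => hd i j hij t) v (Finset.mem_univ i))
      (h1.mono fun v => mul_le_mul_of_nonneg_left
        (norm_linearCombination_subfamily_le hd hw' v) hC₁)
      (hΩ.nearLinear_smulRight hY _ _ _)
    rw [hT] at h2
    exact h2.mono_const (fun v => norm_nonneg _) (le_max_right _ _)
  · push Not at hex
    exact (hvan ι w hd hs hex).mono_const (fun v => norm_nonneg _) (le_max_left _ _)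

/-- By compactness some point has only bad neighbourhoods. Each family vanishes on a smaller
neighbourhood of it, and all later families live there. -/
theorem exists_disjoint_families_continuousMap [T2Space K] (hY : IsQuasiNorm 𝕜 NY)
    (hΩ : IsQuasiLinear 𝕜 (fun f : C(K, 𝕜) => ‖f‖) NY Ω)
    (hbad : ∀ C, ¬ NearLinearOnDisjointIn NY Ω C Set.univ) :
    ∃ (ι : ℕ → Type) (_ : ∀ n, Fintype (ι n)) (w : ∀ n, ι n → C(K, 𝕜)), (∀ n i, w n i ≠ 0) ∧
      (∀ x y : Σ n, ι n, x ≠ y → ∀ t, w x.1 x.2 t = 0 ∨ w y.1 y.2 t = 0) ∧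
      ∀ n : ℕ, ¬ NearLinear 𝕜 ((fun f => ‖f‖) ∘ Fintype.linearCombination 𝕜 (w n)) NY n
        (Ω ∘ Fintype.linearCombination 𝕜 (w n)) := by
  classical
  obtain ⟨x, hx⟩ : ∃ x, ∀ U, IsOpen U → x ∈ U → ∀ C, ¬ NearLinearOnDisjointIn NY Ω C U := by
    by_contra! h
    obtain ⟨C, hC⟩ := nearLinearOnDisjointIn_univ_of_locally hY hΩ h
    exact hbad C hC
  have hstep : ∀ (U : {U : Set K // IsOpen U ∧ x ∈ U}) (n : ℕ),
      ∃ (V : {U : Set K // IsOpen U ∧ x ∈ U}) (ι : Type) (_ : Fintype ι) (w : ι → C(K, 𝕜)),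
      V.1 ⊆ U.1 ∧ (∀ i, ∀ t ∈ V.1, w i t = 0) ∧
      (∀ i j, i ≠ j → ∀ t, w i t = 0 ∨ w j t = 0) ∧ (∀ i, ∀ t, t ∉ U.1 → w i t = 0) ∧
      ¬ NearLinear 𝕜 (fun v => ‖Fintype.linearCombination 𝕜 w v‖) NY n
        (Ω ∘ Fintype.linearCombination 𝕜 w) := by
    intro U n
    obtain ⟨ι, hι, w, hd, hs, hev, hn⟩ :=
      exists_not_nearLinear_vanishing_near (x := x) hY hΩ (hx U.1 U.2.1 U.2.2) n
    obtain ⟨O, hO, hOo, hxO⟩ := eventually_nhds_iff.1 hev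
    exact ⟨⟨U.1 ∩ O, U.2.1.inter hOo, U.2.2, hxO⟩, ι, hι, w, Set.inter_subset_left,
      fun i t ht => hO t ht.2 i, hd, hs, hn⟩
  choose V κ hκ v hVU hvV hvd hvs hvn using hstep
  let R : ℕ → {U : Set K // IsOpen U ∧ x ∈ U} := fun n =>
    Nat.rec ⟨Set.univ, isOpen_univ, Set.mem_univ x⟩ (fun n U => V U n) n
  have hanti : Antitone fun n => (R n).1 := antitone_nat_of_succ_le fun n => hVU (R n) n
  have hlt : ∀ m n, m < n → ∀ i j t, v (R m) m i t = 0 ∨ v (R n) n j t = 0 := by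
    intro m n hmn i j t
    by_cases ht : t ∈ (R n).1
    · exact Or.inl (hvV (R m) m i t (hanti (Nat.succ_le_of_lt hmn) ht))
    · exact Or.inr (hvs (R n) n j t ht)
  refine ⟨fun n => {i : κ (R n) n // v (R n) n i ≠ 0}, fun n => inferInstance,
    fun n i => v (R n) n i, fun n i => i.2, ?_,
    fun n h => hvn (R n) n (nearLinear_linearCombination_of_ne_zero (v (R n) n) h)⟩
  rintro ⟨m, i, hi⟩ ⟨n, j, hj⟩ hne t
  rcases lt_trichotomy m n with h | rfl | h
  · exact hlt m n h i j t
  · exact hvd (R m) m i j (fun h => hne (by subst h; rfl)) t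
  · exact (hlt n m h j i t).symm

end ContinuousFamilies

/-! ### Multigraphs with many edges in which small edge sets are forests. -/

section SparseGraphs

/-- The multigraph with edge set `E` and endpoint maps `a`, `b` spans a forest on each set of at
most `d` edges. -/
def IsLocallyForest {V E : Type} [DecidableEq V] (a b : E → V) (d : ℕ) : Prop :=
  ∀ T : Finset E, T.Nonempty → T.card ≤ d → T.card + 1 ≤ (T.image a ∪ T.image b).card

/-- Negate the value of `S` at `e`. -/
def flipAt {E : Type} [DecidableEq E] (S : E → Bool) (e : E) : E → Bool :=
  Function.update S e (!S e)

theorem flipAt_injective {E : Type} [DecidableEq E] (e : E) :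
    Function.Injective fun S : E → Bool => flipAt S e := by
  intro S S' h
  funext i
  have := congrFun h i
  rcases eq_or_ne i e with rfl | hi
  · simpa [flipAt] using this
  · simpa [flipAt, hi] using this

/-- The degrees sum to `2 * T.card`, less than twice the number of vertices, so some vertex has
degree one. -/
theorem exists_leaf {V E : Type} [DecidableEq V] {a b : E → V} {T : Finset E}
    (hT : T.card + 1 ≤ (T.image a ∪ T.image b).card) :
    ∃ v, ∃ e ∈ T, (∀ e' ∈ T, e' ≠ e → a e' ≠ v ∧ b e' ≠ v) ∧
      (a e = v ∧ b e ≠ v ∨ b e = v ∧ a e ≠ v) := by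
  classical
  have ha : T.card = ∑ v ∈ T.image a ∪ T.image b, (T.filter fun e => a e = v).card :=
    Finset.card_eq_sum_card_fiberwise fun e he =>
      Finset.mem_coe.2 (Finset.mem_union_left _ (Finset.mem_image_of_mem a he))
  have hb : T.card = ∑ v ∈ T.image a ∪ T.image b, (T.filter fun e => b e = v).card :=
    Finset.card_eq_sum_card_fiberwise fun e he =>
      Finset.mem_coe.2 (Finset.mem_union_right _ (Finset.mem_image_of_mem b he))
  have hlt : ∑ v ∈ T.image a ∪ T.image b, ((T.filter fun e => a e = v).card +
      (T.filter fun e => b e = v).card) < ∑ v ∈ T.image a ∪ T.image b, 2 := by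
    rw [Finset.sum_add_distrib, ← ha, ← hb, Finset.sum_const, smul_eq_mul]
    omega
  obtain ⟨v, hv, hlt⟩ := Finset.exists_lt_of_sum_lt hlt
  have key : ∀ (f g : E → V) (e : E), e ∈ T → f e = v →
      (T.filter fun e => f e = v).card + (T.filter fun e => g e = v).card < 2 →
      (∀ e' ∈ T, e' ≠ e → f e' ≠ v ∧ g e' ≠ v) ∧ g e ≠ v := by
    intro f g e he hfe hlt
    have h1 : 0 < (T.filter fun e => f e = v).card :=
      Finset.card_pos.2 ⟨e, Finset.mem_filter.2 ⟨he, hfe⟩⟩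
    have h2 : T.filter (fun e => g e = v) = ∅ := Finset.card_eq_zero.1 (by omega)
    have h3 : ∀ e' ∈ T, g e' ≠ v := fun e' he' h =>
      Finset.notMem_empty e' (h2 ▸ Finset.mem_filter.2 ⟨he', h⟩)
    refine ⟨fun e' he' hne => ⟨fun h => hne ?_, h3 e' he'⟩, h3 e he⟩
    exact (Finset.card_le_one (s := T.filter fun e => f e = v)).1 (by omega) e' (Finset.mem_filter.2 ⟨he', h⟩) e
      (Finset.mem_filter.2 ⟨he, hfe⟩)
  rcases Finset.mem_union.1 hv with h | h
  · obtain ⟨e, he, hev⟩ := Finset.mem_image.1 h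
    obtain ⟨h1, h2⟩ := key a b e he hev hlt
    exact ⟨v, e, he, h1, Or.inl ⟨hev, h2⟩⟩
  · obtain ⟨e, he, hev⟩ := Finset.mem_image.1 h
    obtain ⟨h1, h2⟩ := key b a e he hev (by omega)
    exact ⟨v, e, he, fun e' he' hne => (h1 e' he' hne).symm, Or.inr ⟨hev, h2⟩⟩

/-- Passing to the `2 ^ E`-fold cover in which every edge flips its own coordinate enlarges the
size of the edge sets that span forests. -/
theorem IsLocallyForest.cover {V E : Type} [DecidableEq V] [DecidableEq E] [Fintype E]
    {a b : E → V} {d : ℕ} (h : IsLocallyForest a b d) :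
    IsLocallyForest (fun x : E × (E → Bool) => (a x.1, x.2))
      (fun x : E × (E → Bool) => (b x.1, flipAt x.2 x.1)) (d + 1) := by
  intro T
  induction T using Finset.strongInduction with
  | H T ih =>
  intro hne hcard
  set a' := fun x : E × (E → Bool) => (a x.1, x.2) with ha'
  set b' := fun x : E × (E → Bool) => (b x.1, flipAt x.2 x.1) with hb'
  set N := T.image a' ∪ T.image b' with hN
  have haN : ∀ x ∈ T, a' x ∈ N := fun x hx =>
    Finset.mem_union_left _ (Finset.mem_image_of_mem a' hx)
  have hbN : ∀ x ∈ T, b' x ∈ N := fun x hx =>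
    Finset.mem_union_right _ (Finset.mem_image_of_mem b' hx)
  -- If `t` is the only lift in `T` of its base edge, no other edge of `T` flips the coordinate
  -- `t.1`. That coordinate splits the rest into two forests on disjoint vertex sets, with `t`
  -- joining the two sides.
  by_cases hone : ∃ t ∈ T, ∀ x ∈ T, x.1 = t.1 → x = t
  · obtain ⟨t, ht, huniq⟩ := hone
    have hside : ∀ i : Bool, (T.filter fun x => x ≠ t ∧ x.2 t.1 = i).card + 1 ≤
        (N.filter fun v => v.2 t.1 = i).card := by
      intro i
      rcases (T.filter fun x => x ≠ t ∧ x.2 t.1 = i).eq_empty_or_nonempty with h0 | h0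
      · rw [h0, Finset.card_empty, zero_add]
        refine Finset.card_pos.2 ?_
        by_cases hi : t.2 t.1 = i
        · exact ⟨a' t, Finset.mem_filter.2 ⟨haN t ht, hi⟩⟩
        · refine ⟨b' t, Finset.mem_filter.2 ⟨hbN t ht, ?_⟩⟩
          simp only [hb', flipAt, Function.update_self]
          cases i <;> simp_all
      · have hss : T.filter (fun x => x ≠ t ∧ x.2 t.1 = i) ⊂ T :=
          Finset.filter_ssubset.2 ⟨t, ht, by simp⟩
        refine (ih _ hss h0 ((Finset.card_le_card hss.1).trans hcard)).trans
          (Finset.card_le_card ?_)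
        intro v hv
        rcases Finset.mem_union.1 hv with hv | hv <;> obtain ⟨x, hx, rfl⟩ := Finset.mem_image.1 hv
        · obtain ⟨hxT, -, hxi⟩ := Finset.mem_filter.1 hx
          exact Finset.mem_filter.2 ⟨haN x hxT, hxi⟩
        · obtain ⟨hxT, hxt, hxi⟩ := Finset.mem_filter.1 hx
          have : t.1 ≠ x.1 := fun h => hxt (huniq x hxT h.symm)
          exact Finset.mem_filter.2 ⟨hbN x hxT, by simpa [hb', flipAt, this] using hxi⟩
    have h1 := hside true
    have h2 := hside false
    have h3 : (N.filter fun v => v.2 t.1 = true).card + (N.filter fun v => v.2 t.1 = false).card =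
        N.card := by
      rw [← Finset.card_filter_add_card_filter_not (s := N) (fun v => v.2 t.1 = true)]
      simp
    have h4 : T.card ≤ (T.filter fun x => x ≠ t ∧ x.2 t.1 = true).card +
        (T.filter fun x => x ≠ t ∧ x.2 t.1 = false).card + 1 := by
      have : T ⊆ insert t ((T.filter fun x => x ≠ t ∧ x.2 t.1 = true) ∪
          (T.filter fun x => x ≠ t ∧ x.2 t.1 = false)) := by
        intro x hx
        by_cases hxt : x = t
        · simp [hxt]
        · cases hxi : x.2 t.1 <;> simp [hx, hxt, hxi]
      refine (Finset.card_le_card this).trans ((Finset.card_insert_le _ _).trans ?_)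
      have := Finset.card_union_le (T.filter fun x => x ≠ t ∧ x.2 t.1 = true)
        (T.filter fun x => x ≠ t ∧ x.2 t.1 = false)
      omega
    omega
  · push Not at hone
    have hfib : ∀ e ∈ T.image Prod.fst, 2 ≤ (T.filter fun x => x.1 = e).card := by
      intro e he
      obtain ⟨t, ht, rfl⟩ := Finset.mem_image.1 he
      obtain ⟨x, hx, hxt, hne⟩ := hone t ht
      exact Finset.one_lt_card.2 ⟨x, Finset.mem_filter.2 ⟨hx, hxt⟩, t,
        Finset.mem_filter.2 ⟨ht, rfl⟩, hne⟩
    have h2 : (T.image Prod.fst).card * 2 ≤ T.card := by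
      rw [Finset.card_eq_sum_card_image Prod.fst T, ← smul_eq_mul]
      exact Finset.card_nsmul_le_sum _ _ _ hfib
    have hne' : (T.image Prod.fst).Nonempty := hne.image _
    have hpos := Finset.card_pos.2 hne'
    -- Otherwise each base edge is used at least twice, so at most `d` base edges occur and `h`
    -- gives them a leaf.
    obtain ⟨v, e, he, hleaf, hends⟩ := exists_leaf (h _ hne' (by omega))
    obtain ⟨t, ht, hte⟩ := Finset.mem_image.1 he
    have hmem : ∀ x ∈ T, x.1 ∈ T.image Prod.fst := fun x hx => Finset.mem_image_of_mem _ hx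
    have herase : (T.erase t).Nonempty := by
      obtain ⟨x, hx, -, hxne⟩ := hone t ht
      exact ⟨x, Finset.mem_erase.2 ⟨hxne, hx⟩⟩
    have h3 := ih _ (Finset.erase_ssubset ht) herase
      ((Finset.card_le_card (Finset.erase_subset t T)).trans hcard)
    rw [Finset.card_erase_of_mem ht] at h3
    have hTpos := Finset.card_pos.2 hne
    -- Distinct lifts of the leaf edge end at distinct points above `v`, so the endpoint of `t`
    -- above `v` is lost when `t` is erased.
    obtain ⟨v', hv'N, hv'⟩ : ∃ v' ∈ N,
        v' ∉ (T.erase t).image a' ∪ (T.erase t).image b' := by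
      have hedge : ∀ x ∈ T, a x.1 = v ∨ b x.1 = v → x.1 = t.1 := by
        intro x hx hv
        by_contra hxe
        obtain ⟨h1, h2⟩ := hleaf x.1 (hmem x hx) (by rwa [← hte])
        tauto
      rcases hends with ⟨h1, h2⟩ | ⟨h1, h2⟩
      · refine ⟨a' t, haN t ht, fun hmem' => ?_⟩
        rcases Finset.mem_union.1 hmem' with hv | hv <;>
          obtain ⟨x, hx, hxv⟩ := Finset.mem_image.1 hv <;>
          obtain ⟨hxt, hxT⟩ := Finset.mem_erase.1 hx <;>
          obtain ⟨e1, e2⟩ := Prod.ext_iff.1 hxv <;>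
          simp only [ha', hb', hte, h1] at e1 e2
        · exact hxt (Prod.ext (hedge x hxT (Or.inl e1)) e2)
        · have := hedge x hxT (Or.inr e1)
          rw [this, hte] at e1
          exact h2 e1
      · refine ⟨b' t, hbN t ht, fun hmem' => ?_⟩
        rcases Finset.mem_union.1 hmem' with hv | hv <;>
          obtain ⟨x, hx, hxv⟩ := Finset.mem_image.1 hv <;>
          obtain ⟨hxt, hxT⟩ := Finset.mem_erase.1 hx <;>
          obtain ⟨e1, e2⟩ := Prod.ext_iff.1 hxv <;>
          simp only [ha', hb', hte, h1] at e1 e2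
        · have := hedge x hxT (Or.inl e1)
          rw [this, hte] at e1
          exact h2 e1
        · have h5 := hedge x hxT (Or.inr e1)
          rw [h5, hte] at e2
          exact hxt (Prod.ext h5 (flipAt_injective e e2))
    have hsub : insert v' ((T.erase t).image a' ∪ (T.erase t).image b') ⊆ N := by
      refine Finset.insert_subset hv'N (Finset.union_subset_union ?_ ?_) <;>
        exact Finset.image_subset_image (Finset.erase_subset t T)
    have h4 := Finset.card_le_card hsub
    rw [Finset.card_insert_of_notMem hv'] at h4
    omega

/-- There are finite multigraphs with twice as many edges as vertices in which small edge sets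
span forests. -/
theorem exists_isLocallyForest (d : ℕ) :
    ∃ (V E : Type) (_ : Fintype V) (_ : DecidableEq V) (_ : Fintype E) (_ : DecidableEq E)
      (a b : E → V), 0 < Fintype.card V ∧ Fintype.card E = 2 * Fintype.card V ∧
      IsLocallyForest a b d := by
  induction d with
  | zero =>
    -- One vertex with two loops: for `d = 0` the forest condition is vacuous.
    refine ⟨Unit, Bool, inferInstance, inferInstance, inferInstance, inferInstance,
      fun _ => (), fun _ => (), by simp, by simp, fun T hT hc => ?_⟩
    have := Finset.card_pos.2 hT
    omega
  | succ d ih =>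
    obtain ⟨V, E, _, _, _, _, a, b, h0, hc, h⟩ := ih
    refine ⟨V × (E → Bool), E × (E → Bool), inferInstance, inferInstance, inferInstance,
      inferInstance, _, _, ?_, ?_, h.cover⟩
    · rw [Fintype.card_prod]
      exact Nat.mul_pos h0 Fintype.card_pos
    · rw [Fintype.card_prod, Fintype.card_prod, hc, mul_assoc]

/-- Hall's theorem: a nonempty forest has more vertices than edges. -/
theorem IsLocallyForest.exists_injOn {V E : Type} [DecidableEq V] {a b : E → V} {d : ℕ}
    (h : IsLocallyForest a b d) {T : Finset E} (hT : T.card ≤ d) :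
    ∃ σ : E → V, (∀ e ∈ T, σ e = a e ∨ σ e = b e) ∧ Set.InjOn σ T := by
  classical
  have hall : ∀ s : Finset {x // x ∈ T},
      s.card ≤ (s.biUnion fun x => ({a x.1, b x.1} : Finset V)).card := by
    intro s
    rcases s.eq_empty_or_nonempty with rfl | hs
    · simp
    have h1 := h (s.map (Function.Embedding.subtype _)) (by simpa using hs) (by
      rw [Finset.card_map]
      refine le_trans ?_ hT
      simpa using Finset.card_le_univ s)
    rw [Finset.card_map] at h1
    refine (Nat.le_succ _).trans (h1.trans (Finset.card_le_card ?_))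
    intro v hv
    simp only [Finset.mem_union, Finset.mem_image, Finset.mem_map, Finset.mem_biUnion,
      Finset.mem_insert, Finset.mem_singleton] at hv ⊢
    rcases hv with ⟨_, ⟨x, hx, rfl⟩, rfl⟩ | ⟨_, ⟨x, hx, rfl⟩, rfl⟩
    · exact ⟨x, hx, Or.inl rfl⟩
    · exact ⟨x, hx, Or.inr rfl⟩
  obtain ⟨f, hf, hft⟩ := (Finset.all_card_le_biUnion_card_iff_exists_injective _).1 hall
  refine ⟨fun e => if he : e ∈ T then f ⟨e, he⟩ else a e, fun e he => ?_, fun e he e' he' hee => ?_⟩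
  · have := hft ⟨e, he⟩
    simpa [he] using this
  · rw [Finset.mem_coe] at he he'
    simp only [he, he', dif_pos] at hee
    exact congrArg Subtype.val (hf hee)

end SparseGraphs

/-! ### Regrouping vectors of small overlap along a graph. -/

section Overlap

variable {𝕜 : Type*} [RCLike 𝕜] {Y : Type*} [NormedAddCommGroup Y] {κ : Type*} [Fintype κ]
  {R : (κ → 𝕜) → Y} {C Γ q : ℝ}

theorem norm_sum_pi_disjoint_le {ι : Type*} {s : Finset ι} {c : ι → κ → 𝕜} (hq : 0 ≤ q)
    (hc : ∀ x ∈ s, ‖c x‖ ≤ q) (hd : ∀ k, ∀ x ∈ s, ∀ y ∈ s, c x k ≠ 0 → c y k ≠ 0 → x = y) :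
    ‖∑ x ∈ s, c x‖ ≤ q := by
  classical
  refine (pi_norm_le_iff_of_nonneg hq).2 fun k => ?_
  rw [Finset.sum_apply]
  by_cases h0 : ∃ x ∈ s, c x k ≠ 0
  · obtain ⟨x, hx, hxk⟩ := h0
    rw [Finset.sum_eq_single_of_mem x hx fun y hy hyx =>
      by_contra fun h => hyx (hd k y hy x hx h hxk)]
    exact (norm_le_pi_norm _ k).trans (hc x hx)
  · push Not at h0
    rw [Finset.sum_eq_zero h0, norm_zero]
    exact hq

/-- Disjointness keeps every partial sum within `q`, so each addition costs at most `2 * C * q`. -/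
theorem norm_map_sum_sub_le (hC : 0 ≤ C)
    (hRadd : ∀ x y, ‖R (x + y) - R x - R y‖ ≤ C * (‖x‖ + ‖y‖)) (hR0 : R 0 = 0)
    {ι : Type*} {s : Finset ι} {c : ι → κ → 𝕜} (hq : 0 ≤ q)
    (hc : ∀ x ∈ s, ‖c x‖ ≤ q) (hd : ∀ k, ∀ x ∈ s, ∀ y ∈ s, c x k ≠ 0 → c y k ≠ 0 → x = y) :
    ‖R (∑ x ∈ s, c x) - ∑ x ∈ s, R (c x)‖ ≤ s.card * (2 * C * q) := by
  classical
  induction s using Finset.induction_on with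
  | empty => simp [hR0]
  | insert i s his ih =>
    have hc' : ∀ x ∈ s, ‖c x‖ ≤ q := fun x hx => hc x (Finset.mem_insert_of_mem hx)
    have hd' : ∀ k, ∀ x ∈ s, ∀ y ∈ s, c x k ≠ 0 → c y k ≠ 0 → x = y := fun k x hx y hy =>
      hd k x (Finset.mem_insert_of_mem hx) y (Finset.mem_insert_of_mem hy)
    rw [Finset.sum_insert his, Finset.sum_insert his, Finset.card_insert_of_notMem his]
    have e : R (c i + ∑ x ∈ s, c x) - (R (c i) + ∑ x ∈ s, R (c x)) =
        (R (c i + ∑ x ∈ s, c x) - R (c i) - R (∑ x ∈ s, c x)) +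
        (R (∑ x ∈ s, c x) - ∑ x ∈ s, R (c x)) := by abel
    rw [e]
    have h1 := hRadd (c i) (∑ x ∈ s, c x)
    have h2 := hc i (Finset.mem_insert_self i s)
    have h3 := norm_sum_pi_disjoint_le hq hc' hd'
    have h4 : C * (‖c i‖ + ‖∑ x ∈ s, c x‖) ≤ C * (q + q) := by gcongr
    refine (norm_add_le _ _).trans ((add_le_add (h1.trans h4) (ih hc' hd')).trans (le_of_eq ?_))
    push_cast
    ring

/-- If few of the vectors `c e` overlap at each coordinate, then the sum of the `R (c e)` is
smaller, by the factor `|V| / |E|`, than its trivial bound, up to an error that does not depend on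
`Γ`. -/
theorem norm_sum_map_le_of_overlap {V E : Type} [Fintype V] [DecidableEq V] [Fintype E]
    {a b : E → V} {d : ℕ} (hG : IsLocallyForest a b d) (hC : 0 ≤ C)
    (hRadd : ∀ x y, ‖R (x + y) - R x - R y‖ ≤ C * (‖x‖ + ‖y‖)) (hΓ : 0 ≤ Γ)
    (hR : ∀ x, ‖R x‖ ≤ Γ * ‖x‖) {c : E → κ → 𝕜} (hq : 0 ≤ q) (hc : ∀ e, ‖c e‖ ≤ q)
    (hd : ∀ k, {e | c e k ≠ 0}.ncard ≤ d) :
    ‖∑ e, R (c e)‖ ≤ Fintype.card V * (Γ * q) + Fintype.card E * (6 * C * q) := by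
  classical
  have hR0 : R 0 = 0 := by simpa using hR 0
  -- At each coordinate at most `d` vectors are active, so their edges can be assigned to distinct
  -- endpoints.
  have hσ : ∀ k, ∃ σ : E → V, (∀ e, c e k ≠ 0 → σ e = a e ∨ σ e = b e) ∧
      ∀ e e', c e k ≠ 0 → c e' k ≠ 0 → σ e = σ e' → e = e' := by
    intro k
    have hcard : (Finset.univ.filter fun e => c e k ≠ 0).card ≤ d := by
      rw [← Set.ncard_coe_finset]
      simpa using hd k
    obtain ⟨σ, h1, h2⟩ := hG.exists_injOn hcard
    exact ⟨σ, fun e he => h1 e (by simpa using he),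
      fun e e' he he' h => h2 (by simpa using he) (by simpa using he') h⟩
  choose σ hσ1 hσ2 using hσ
  let p : E × Bool → V := fun x => if x.2 then a x.1 else b x.1
  -- Each `c e` is split into two pieces, one per endpoint, according to the assignment at each
  -- coordinate. Pieces attached to the same vertex are disjoint.
  let γ : E × Bool → κ → 𝕜 := fun x k => if (σ k x.1 = a x.1 ↔ x.2 = true) then c x.1 k else 0
  have hγ : ∀ x, ‖γ x‖ ≤ q := fun x => by
    refine (pi_norm_le_iff_of_nonneg hq).2 fun k => ?_
    simp only [γ]
    split_ifs
    · exact (norm_le_pi_norm _ k).trans (hc x.1)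
    · simpa using hq
  have hsplit : ∀ e, c e = γ (e, true) + γ (e, false) := fun e => by
    funext k
    by_cases h : σ k e = a e <;> simp [γ, h]
  have hγp : ∀ x k, γ x k ≠ 0 → c x.1 k ≠ 0 ∧ σ k x.1 = p x := by
    rintro ⟨e, i⟩ k h
    have h1 : (σ k e = a e ↔ i = true) ∧ c e k ≠ 0 := by simpa [γ] using h
    refine ⟨h1.2, ?_⟩
    cases i
    · have : σ k e ≠ a e := fun h => by simpa using h1.1.1 h
      simpa [p] using (hσ1 k e h1.2).resolve_left this
    · simpa [p] using h1.1.2 rfl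
  have hγd : ∀ v k, ∀ x ∈ Finset.univ.filter (fun x => p x = v),
      ∀ y ∈ Finset.univ.filter (fun x => p x = v), γ x k ≠ 0 → γ y k ≠ 0 → x = y := by
    intro v k x hx y hy hxk hyk
    obtain ⟨h1, h2⟩ := hγp x k hxk
    obtain ⟨h3, h4⟩ := hγp y k hyk
    have hxv : p x = v := by simpa using hx
    have hyv : p y = v := by simpa using hy
    have he : x.1 = y.1 := hσ2 k _ _ h1 h3 (by rw [h2, h4, hxv, hyv])
    have hx' : (σ k x.1 = a x.1 ↔ x.2 = true) := by
      by_contra hcon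
      exact hxk (by simp only [γ, if_neg hcon])
    have hy' : (σ k y.1 = a y.1 ↔ y.2 = true) := by
      by_contra hcon
      exact hyk (by simp only [γ, if_neg hcon])
    rw [← he] at hy'
    refine Prod.ext he ?_
    have := hx'.symm.trans hy'
    cases hx2 : x.2 <;> cases hy2 : y.2 <;> simp_all
  have hvertex : ∀ v, ‖∑ x ∈ Finset.univ.filter (fun x => p x = v), R (γ x)‖ ≤
      Γ * q + (Finset.univ.filter (fun x => p x = v)).card * (2 * C * q) := by
    intro v
    have h1 := norm_map_sum_sub_le hC hRadd hR0 hq (fun x _ => hγ x) (hγd v)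
    have h2 := norm_sum_pi_disjoint_le hq (fun x _ => hγ x) (hγd v)
    have h3 := (hR (∑ x ∈ Finset.univ.filter (fun x => p x = v), γ x)).trans
      (mul_le_mul_of_nonneg_left h2 hΓ)
    rw [norm_sub_rev] at h1
    exact (norm_le_norm_add_norm_sub' _ _).trans (add_le_add h3 h1)
  have hγsum : ‖∑ x, R (γ x)‖ ≤
      Fintype.card V * (Γ * q) + (2 * Fintype.card E : ℝ) * (2 * C * q) := by
    rw [← Finset.sum_fiberwise_of_maps_to (t := Finset.univ) (g := p)
      (fun x _ => Finset.mem_univ _)]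
    refine (norm_sum_le _ _).trans ((Finset.sum_le_sum fun v _ => hvertex v).trans (le_of_eq ?_))
    have hcard : ∑ v : V, ((Finset.univ.filter fun x => p x = v).card : ℝ) =
        2 * Fintype.card E := by
      rw [← Nat.cast_sum, ← Finset.card_eq_sum_card_fiberwise
        (fun x _ => Finset.mem_coe.2 (Finset.mem_univ _))]
      simp [mul_comm]
    rw [Finset.sum_add_distrib, Finset.sum_const, Finset.card_univ, nsmul_eq_mul,
      ← Finset.sum_mul Finset.univ (fun v => ((Finset.univ.filter fun x => p x = v).card : ℝ)),
      hcard]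
  have e : ∑ e, R (c e) = ∑ e, (R (c e) - R (γ (e, true)) - R (γ (e, false))) +
      ∑ x, R (γ x) := by
    rw [Fintype.sum_prod_type, ← Finset.sum_add_distrib]
    refine Finset.sum_congr rfl fun e _ => ?_
    rw [Fintype.sum_bool]
    abel
  have herr : ∀ e, ‖R (c e) - R (γ (e, true)) - R (γ (e, false))‖ ≤ 2 * C * q := by
    intro e
    have h1 := hRadd (γ (e, true)) (γ (e, false))
    rw [← hsplit] at h1
    have h2 : C * (‖γ (e, true)‖ + ‖γ (e, false)‖) ≤ C * (q + q) := by
      gcongr <;> exact hγ _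
    linarith
  rw [e]
  refine (norm_add_le _ _).trans ?_
  -- Splitting costs `2 * C * q` per edge; regrouping the `2 * |E|` pieces costs `4 * C * q` per
  -- edge. This gives the `6`.
  have h5 : ‖∑ e, (R (c e) - R (γ (e, true)) - R (γ (e, false)))‖ ≤
      Fintype.card E * (2 * C * q) := by
    refine (norm_sum_le _ _).trans ((Finset.sum_le_sum fun e _ => herr e).trans (le_of_eq ?_))
    simp
  linarith

end Overlap

/-! ### Shifted grids in Euclidean space. -/

section GapSystems

/-- A continuous function supported in `[-1/2, 1/2]` that equals `1` on `[-1/2 + η, 1/2 - η]`. -/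
noncomputable def plateau (η u : ℝ) : ℝ := max 0 (min 1 ((1 / 2 - |u|) / η))

theorem continuous_plateau (η : ℝ) : Continuous (plateau η) := by
  unfold plateau
  fun_prop

theorem plateau_nonneg (η u : ℝ) : 0 ≤ plateau η u := le_max_left _ _

theorem plateau_le_one (η u : ℝ) : plateau η u ≤ 1 := max_le zero_le_one (min_le_left _ _)

theorem abs_lt_of_plateau_ne_zero {η u : ℝ} (hη : 0 ≤ η) (h : plateau η u ≠ 0) : |u| < 1 / 2 := by
  by_contra! h'
  refine h (max_eq_left ((min_le_right _ _).trans ?_))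
  exact div_nonpos_of_nonpos_of_nonneg (by linarith) hη

theorem plateau_eq_one {η u : ℝ} (hη : 0 < η) (h : |u| ≤ 1 / 2 - η) : plateau η u = 1 := by
  have : 1 ≤ (1 / 2 - |u|) / η := by
    rw [le_div_iff₀ hη]
    linarith
  rw [plateau, min_eq_left this, max_eq_right zero_le_one]

theorem plateau_sub_intCast_disjoint {η : ℝ} (hη : 0 ≤ η) (s : ℝ) {k k' : ℤ} (hk : k ≠ k') :
    plateau η (s - k) = 0 ∨ plateau η (s - k') = 0 := by
  by_contra! h
  have h1 := abs_lt.1 (abs_lt_of_plateau_ne_zero hη h.1)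
  have h2 := abs_lt.1 (abs_lt_of_plateau_ne_zero hη h.2)
  have h3 : (k : ℝ) < k' + 1 := by linarith
  have h4 : (k' : ℝ) < k + 1 := by linarith
  norm_cast at h3 h4
  omega

/-- Away from the half-integers the integer nearest to `s`, which is `⌊s⌋` or `⌊s⌋ + 1`, has plateau
value `1` and the others have `0`. -/
theorem sum_plateau_eq_one {η : ℝ} (hη : 0 < η) {s : ℝ} {I : Finset ℤ} (h0 : ⌊s⌋ ∈ I)
    (h1 : ⌊s⌋ + 1 ∈ I) (hs : ∀ h : ℤ, η ≤ |s - (h + 1 / 2)|) :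
    ∑ k ∈ I, plateau η (s - k) = 1 := by
  have key : ∀ k ∈ I, plateau η (s - k) = 1 → ∑ k ∈ I, plateau η (s - k) = 1 := by
    intro k hk h
    rw [Finset.sum_eq_single_of_mem k hk, h]
    intro k' _ hne
    exact (plateau_sub_intCast_disjoint hη.le s hne).resolve_right (by rw [h]; exact one_ne_zero)
  have f0 := Int.floor_le s
  have f1 := Int.lt_floor_add_one s
  rcases le_abs.1 (hs ⌊s⌋) with h | h
  · refine key _ h1 (plateau_eq_one hη ?_)
    push_cast
    rw [abs_le]
    constructor <;> linarith
  · refine key _ h0 (plateau_eq_one hη ?_)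
    rw [abs_le]
    constructor <;> linarith

/-- For any number of colours `θ` there are families of `[0, 1]`-valued functions, disjoint within
each colour and of small supports, such that at every point all but `N` of the colours sum
to `1`. -/
def HasGapSystems (K : Type*) [PseudoMetricSpace K] (N : ℕ) : Prop :=
  ∀ (Θ : Type) [Fintype Θ] (δ : ℝ), 0 < δ → ∃ (J : Type) (_ : Fintype J) (Ψ : Θ → J → C(K, ℝ)),
    (∀ θ j t, 0 ≤ Ψ θ j t ∧ Ψ θ j t ≤ 1) ∧
    (∀ θ j j', j ≠ j' → ∀ t, Ψ θ j t = 0 ∨ Ψ θ j' t = 0) ∧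
    (∀ θ j t t', Ψ θ j t ≠ 0 → Ψ θ j t' ≠ 0 → dist t t' < δ) ∧
    ∀ t, {θ | ∑ j, Ψ θ j t ≠ 1}.ncard ≤ N

/-- Colour `θ` uses the grid of mesh `δ` shifted by a multiple of `δ / m` peculiar to it. In each
coordinate the gaps of different colours are disjoint, so a point is in a gap of at most one colour
per coordinate. -/
theorem hasGapSystems_of_isBounded {ι : Type} [Fintype ι] {A : Set (ι → ℝ)}
    (hA : Bornology.IsBounded A) : HasGapSystems A (Fintype.card ι) := by
  classical
  intro Θ _ δ hδ
  obtain ⟨B, hB⟩ := hA.exists_norm_le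
  set m : ℝ := ((Fintype.card Θ : ℕ) : ℝ) with hm
  set η : ℝ := 1 / (2 * m) with hη
  -- If there are no colours then `m = 0` and `η = 0`; strict positivity is available only once some
  -- `θ` is given.
  have hη0 : 0 ≤ η := by positivity
  let r : Θ → ℕ := fun θ => (Fintype.equivFin Θ θ : ℕ)
  have hr : ∀ θ, (r θ : ℝ) + 1 ≤ m := fun θ => by
    rw [hm]
    exact_mod_cast (Fintype.equivFin Θ θ).isLt
  have hr' : Function.Injective r := fun θ θ' h => (Fintype.equivFin Θ).injective (Fin.ext h)
  -- Large enough that `⌊s θ x i⌋` and its successor lie in `[-M, M]` for every point of `A` and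
  -- every shift.
  let M : ℤ := ⌈B / δ⌉ + 3
  let s : Θ → A → ι → ℝ := fun θ x i => x.1 i / δ - r θ / m
  have hs : ∀ θ i, Continuous fun x => s θ x i := fun θ i => by
    have : Continuous fun x : A => x.1 i := (continuous_apply i).comp continuous_subtype_val
    exact (this.div_const δ).sub continuous_const
  refine ⟨ι → Finset.Icc (-M) M, Pi.instFintype,
    fun θ k => ⟨fun x => ∏ i, plateau η (s θ x i - (k i : ℤ)), continuous_finsetProd _ fun i _ =>
      (continuous_plateau η).comp ((hs θ i).sub continuous_const)⟩, ?_, ?_, ?_, ?_⟩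
  · exact fun θ k x => ⟨Finset.prod_nonneg fun i _ => plateau_nonneg _ _,
      Finset.prod_le_one (fun i _ => plateau_nonneg _ _) fun i _ => plateau_le_one _ _⟩
  · intro θ k k' hk x
    obtain ⟨i, hi⟩ := Function.ne_iff.1 hk
    rcases plateau_sub_intCast_disjoint hη0 (s θ x i) (fun h => hi (Subtype.ext h)) with h | h
    · exact Or.inl (Finset.prod_eq_zero (Finset.mem_univ i) h)
    · exact Or.inr (Finset.prod_eq_zero (Finset.mem_univ i) h)
  · intro θ k x x' h h'
    rw [Subtype.dist_eq, dist_pi_lt_iff hδ]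
    intro i
    have h1 := abs_lt.1 (abs_lt_of_plateau_ne_zero hη0
      (Finset.prod_ne_zero_iff.1 h i (Finset.mem_univ i)))
    have h2 := abs_lt.1 (abs_lt_of_plateau_ne_zero hη0
      (Finset.prod_ne_zero_iff.1 h' i (Finset.mem_univ i)))
    simp only [s] at h1 h2
    have h3 : |(x.1 i - x'.1 i) / δ| < 1 := by
      rw [sub_div, abs_lt]
      constructor <;> linarith
    rwa [abs_div, abs_of_pos hδ, div_lt_one hδ] at h3
  · intro x
    have hbad : ∀ θ, ∑ k : ι → Finset.Icc (-M) M, ∏ i, plateau η (s θ x i - (k i : ℤ)) ≠ 1 →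
        ∃ i, ∃ h : ℤ, |s θ x i - (h + 1 / 2)| < η := by
      intro θ
      contrapose!
      intro h
      have hm0 : 0 < m := by linarith [hr θ, Nat.cast_nonneg (α := ℝ) (r θ)]
      have e := Finset.prod_univ_sum (fun _ : ι => (Finset.univ : Finset (Finset.Icc (-M) M)))
        (fun i k => plateau η (s θ x i - (k : ℤ)))
      rw [Fintype.piFinset_univ] at e
      rw [← e]
      refine Finset.prod_eq_one fun i _ => ?_
      rw [Finset.sum_coe_sort (Finset.Icc (-M) M) (fun k : ℤ => plateau η (s θ x i - k))]
      have hx : |x.1 i / δ| ≤ B / δ := by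
        rw [abs_div, abs_of_pos hδ]
        gcongr
        exact (norm_le_pi_norm x.1 i).trans (hB x.1 x.2)
      have hr0 : 0 ≤ r θ / m := by positivity
      have hr1 : r θ / m ≤ 1 := (div_le_one hm0).2 (by linarith [hr θ])
      have hc := Int.le_ceil (B / δ)
      have hx' := abs_le.1 hx
      have f0 := Int.floor_le (s θ x i)
      have f1 := Int.lt_floor_add_one (s θ x i)
      have g0 : (-M : ℝ) ≤ ⌊s θ x i⌋ := by
        simp only [s, M] at *
        push_cast
        linarith
      have g1 : (⌊s θ x i⌋ : ℝ) + 1 ≤ M := by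
        simp only [s, M] at *
        push_cast
        linarith
      norm_cast at g0 g1
      exact sum_plateau_eq_one (by positivity) (Finset.mem_Icc.2 ⟨g0, by omega⟩)
        (Finset.mem_Icc.2 ⟨by omega, g1⟩) (h i)
    have huniq : ∀ θ θ' i, (∃ h : ℤ, |s θ x i - (h + 1 / 2)| < η) →
        (∃ h : ℤ, |s θ' x i - (h + 1 / 2)| < η) → θ = θ' := by
      rintro θ θ' i ⟨h, hh⟩ ⟨h', hh'⟩
      have hm0 : 0 < m := by linarith [hr θ, Nat.cast_nonneg (α := ℝ) (r θ)]
      have a1 := abs_lt.1 hh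
      have a2 := abs_lt.1 hh'
      simp only [s] at a1 a2
      have e2 : 2 * η = 1 / m := by rw [hη]; field_simp
      have b : |((r θ' : ℝ) - r θ) / m - (h - h')| < 1 / m := by
        rw [sub_div, abs_lt]
        constructor <;> linarith
      have b' : |((r θ' : ℝ) - r θ) - (h - h') * m| < 1 := by
        have := mul_lt_mul_of_pos_right b hm0
        rw [← abs_of_pos hm0, ← abs_mul, abs_of_pos hm0, sub_mul, div_mul_cancel₀ _ hm0.ne',
          div_mul_cancel₀ _ hm0.ne'] at this
        exact this
      -- Two gaps of width `1 / m` that meet force an integer of absolute value less than `1`. Hence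
      -- the shifts agree modulo the number of colours, and so are equal.
      have hz : ((r θ' : ℤ) - r θ) - (h - h') * (Fintype.card Θ : ℤ) = 0 := by
        rw [← Int.abs_lt_one_iff]
        rw [hm] at b'
        exact_mod_cast b'
      have c1 := hr θ
      have c2 := hr θ'
      rw [hm] at c1 c2
      norm_cast at c1 c2
      have hzero : (r θ' : ℤ) - r θ = 0 := by
        refine Int.eq_zero_of_abs_lt_dvd (m := (Fintype.card Θ : ℤ)) ⟨h - h', by linarith⟩ ?_
        rw [abs_lt]
        constructor <;> omega
      exact hr' (by omega)
    simp only [ContinuousMap.coe_mk]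
    rcases isEmpty_or_nonempty ι with hι | hι
    · refine ((Set.ncard_eq_zero (Set.toFinite _)).2 ?_).le.trans (Nat.zero_le _)
      exact Set.eq_empty_of_forall_notMem fun θ h => hι.elim (hbad θ h).choose
    · choose! g hg using hbad
      rw [← Nat.card_eq_fintype_card, ← Set.ncard_univ]
      refine Set.ncard_le_ncard_of_injOn g (fun _ _ => Set.mem_univ _) ?_
      intro θ h θ' h' hgg
      exact huniq θ θ' (g θ) (hg θ h) (hgg ▸ hg θ' h')

end GapSystems

/-! ### Approximating a function by its values at sample points. -/

section Sampling

open Filter Topology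

variable {𝕜 : Type*} [RCLike 𝕜] {K : Type*} [TopologicalSpace K]

/-- The linear map that sends `a` to the function `∑ j, a j * ψ j`. -/
noncomputable def ContinuousMap.combination (𝕜 : Type*) [RCLike 𝕜] {J : Type*} [Fintype J]
    (ψ : J → C(K, ℝ)) : (J → 𝕜) →ₗ[𝕜] C(K, 𝕜) :=
  Fintype.linearCombination 𝕜 fun j => ContinuousMap.realMul 𝕜 (ψ j) 1

/-- Evaluation at the points `x j`. -/
def ContinuousMap.evalAt (𝕜 : Type*) [RCLike 𝕜] {J : Type*} (x : J → K) :
    C(K, 𝕜) →ₗ[𝕜] (J → 𝕜) where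
  toFun f j := f (x j)
  map_add' _ _ := rfl
  map_smul' _ _ := rfl

@[simp]
theorem ContinuousMap.evalAt_apply {J : Type*} (x : J → K) (f : C(K, 𝕜)) (j : J) :
    ContinuousMap.evalAt 𝕜 x f j = f (x j) := rfl

theorem ContinuousMap.realMul_eq_self {φ : C(K, ℝ)} (hφ : ∀ t, φ t = 1) (f : C(K, 𝕜)) :
    ContinuousMap.realMul 𝕜 φ f = f :=
  ContinuousMap.ext fun t => by simp [hφ]

/-- A sample point in the support of each `ψ j` that is not identically zero; an arbitrary point
serves for the others. -/
theorem exists_forall_apply_ne_zero {J : Type*} [Nonempty K] (ψ : J → C(K, ℝ)) :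
    ∃ x : J → K, ∀ j t, ψ j t ≠ 0 → ψ j (x j) ≠ 0 := by
  have : ∀ j, ∃ x, ∀ t, ψ j t ≠ 0 → ψ j x ≠ 0 := fun j => by
    by_cases h : ∃ x, ψ j x ≠ 0
    · exact h.imp fun x hx _ _ => hx
    · push Not at h
      exact ⟨Classical.arbitrary K, fun t ht => (ht (h t)).elim⟩
  choose x hx using this
  exact ⟨x, hx⟩

variable {J : Type*} [Fintype J] {ψ : J → C(K, ℝ)}

theorem ContinuousMap.combination_apply (ψ : J → C(K, ℝ)) (a : J → 𝕜) (t : K) :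
    ContinuousMap.combination 𝕜 ψ a t = ∑ j, a j * (ψ j t : 𝕜) := by
  simp [combination, linearCombination_continuousMap_apply]

theorem sum_le_one_of_disjoint (h01 : ∀ j t, 0 ≤ ψ j t ∧ ψ j t ≤ 1)
    (hd : ∀ j j', j ≠ j' → ∀ t, ψ j t = 0 ∨ ψ j' t = 0) (t : K) : ∑ j, ψ j t ≤ 1 := by
  by_cases h : ∃ j, ψ j t ≠ 0
  · obtain ⟨j, hj⟩ := h
    rw [Finset.sum_eq_single_of_mem j (Finset.mem_univ j)]
    · exact (h01 j t).2
    · exact fun j' _ hne => (hd j' j hne t).resolve_right hj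
  · push Not at h
    simp [h]

variable [CompactSpace K]

theorem ContinuousMap.norm_combination_le (h0 : ∀ j t, 0 ≤ ψ j t) (h1 : ∀ t, ∑ j, ψ j t ≤ 1)
    (a : J → 𝕜) : ‖ContinuousMap.combination 𝕜 ψ a‖ ≤ ‖a‖ := by
  refine (ContinuousMap.norm_le _ (norm_nonneg _)).2 fun t => ?_
  rw [combination_apply]
  calc ‖∑ j, a j * (ψ j t : 𝕜)‖ ≤ ∑ j, ‖a‖ * ψ j t := by
        refine (norm_sum_le _ _).trans (Finset.sum_le_sum fun j _ => ?_)
        rw [norm_mul, RCLike.norm_ofReal, abs_of_nonneg (h0 j t)]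
        exact mul_le_mul_of_nonneg_right (norm_le_pi_norm a j) (h0 j t)
    _ ≤ ‖a‖ * 1 := by
        rw [← Finset.mul_sum]
        exact mul_le_mul_of_nonneg_left (h1 t) (norm_nonneg _)
    _ = ‖a‖ := mul_one _

theorem ContinuousMap.norm_evalAt_le (x : J → K) (f : C(K, 𝕜)) :
    ‖ContinuousMap.evalAt 𝕜 x f‖ ≤ ‖f‖ :=
  (pi_norm_le_iff_of_nonneg (norm_nonneg _)).2 fun j => f.norm_coe_le_norm (x j)

theorem norm_realMul_sum_sub_sampling_le (h0 : ∀ j t, 0 ≤ ψ j t) (h1 : ∀ t, ∑ j, ψ j t ≤ 1)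
    {x : J → K} {f : C(K, 𝕜)} {η : ℝ} (hη : 0 ≤ η)
    (h : ∀ j t, ψ j t ≠ 0 → ‖f t - f (x j)‖ ≤ η) :
    ‖ContinuousMap.realMul 𝕜 (∑ j, ψ j) f -
      ContinuousMap.combination 𝕜 ψ (ContinuousMap.evalAt 𝕜 x f)‖ ≤ η := by
  refine (ContinuousMap.norm_le _ hη).2 fun t => ?_
  have e : (ContinuousMap.realMul 𝕜 (∑ j, ψ j) f -
      ContinuousMap.combination 𝕜 ψ (ContinuousMap.evalAt 𝕜 x f)) t =
      ∑ j, (ψ j t : 𝕜) * (f t - f (x j)) := by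
    rw [ContinuousMap.sub_apply, ContinuousMap.combination_apply, ContinuousMap.realMul_apply,
      ContinuousMap.sum_apply, RCLike.ofReal_sum, Finset.sum_mul, ← Finset.sum_sub_distrib]
    exact Finset.sum_congr rfl fun j _ => by rw [ContinuousMap.evalAt_apply]; ring
  rw [e]
  calc ‖∑ j, (ψ j t : 𝕜) * (f t - f (x j))‖ ≤ ∑ j, ψ j t * η := by
        refine (norm_sum_le _ _).trans (Finset.sum_le_sum fun j _ => ?_)
        rw [norm_mul, RCLike.norm_ofReal, abs_of_nonneg (h0 j t)]
        rcases eq_or_ne (ψ j t) 0 with hz | hz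
        · simp [hz]
        · exact mul_le_mul_of_nonneg_left (h j t hz) (h0 j t)
    _ ≤ 1 * η := by
        rw [← Finset.sum_mul]
        exact mul_le_mul_of_nonneg_right (h1 t) hη
    _ = η := one_mul _

end Sampling

/-! ### Local triviality with a constant depending on the dimension. -/

section FineApproximation

/-- With `N + 1` colours some colour sums to `1` at every point, so the total is positive and one
may divide by it. -/
theorem HasGapSystems.exists_partition {K : Type*} [PseudoMetricSpace K] {N : ℕ}
    (hK : HasGapSystems K N) {δ : ℝ} (hδ : 0 < δ) :
    ∃ (J : Type) (_ : Fintype J) (φ : Fin (N + 1) → J → C(K, ℝ)),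
      (∀ θ j t, 0 ≤ φ θ j t) ∧ (∀ t, ∑ θ, ∑ j, φ θ j t = 1) ∧
      (∀ θ j j', j ≠ j' → ∀ t, φ θ j t = 0 ∨ φ θ j' t = 0) ∧
      ∀ θ j t t', φ θ j t ≠ 0 → φ θ j t' ≠ 0 → dist t t' < δ := by
  obtain ⟨J, _, Ψ, h01, hd, hdist, hN⟩ := hK (Fin (N + 1)) δ hδ
  let σ : C(K, ℝ) := ∑ θ, ∑ j, Ψ θ j
  have hσ : ∀ t, σ t = ∑ θ, ∑ j, Ψ θ j t := fun t => by simp [σ, ContinuousMap.sum_apply]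
  have hσ1 : ∀ t, 0 < σ t := by
    intro t
    obtain ⟨θ, hθ⟩ : ∃ θ, ∑ j, Ψ θ j t = 1 := by
      by_contra! h
      have h1 := hN t
      have h2 : {θ | ∑ j, Ψ θ j t ≠ 1} = Set.univ := Set.eq_univ_of_forall h
      rw [h2, Set.ncard_univ, Nat.card_eq_fintype_card, Fintype.card_fin] at h1
      omega
    rw [hσ]
    refine lt_of_lt_of_le zero_lt_one (hθ ▸ ?_)
    exact Finset.single_le_sum (f := fun θ => ∑ j, Ψ θ j t)
      (fun θ _ => Finset.sum_nonneg fun j _ => (h01 θ j t).1) (Finset.mem_univ θ)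
  refine ⟨J, inferInstance, fun θ j => ⟨fun t => Ψ θ j t / σ t,
    (Ψ θ j).continuous.div σ.continuous fun t => (hσ1 t).ne'⟩, fun θ j t => ?_, fun t => ?_,
    fun θ j j' hj t => ?_, fun θ j t t' h h' => hdist θ j t t' ?_ ?_⟩
  · exact div_nonneg (h01 θ j t).1 (hσ1 t).le
  · simp only [ContinuousMap.coe_mk]
    simp_rw [← Finset.sum_div]
    rw [← hσ, div_self (hσ1 t).ne']
  · exact (hd θ j j' hj t).imp (fun h => by simp [h]) (fun h => by simp [h])
  · exact fun h0 => h (by simp [h0])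
  · exact fun h0 => h' (by simp [h0])

open Filter Topology

variable {𝕜 : Type*} [RCLike 𝕜] {K : Type*} [PseudoMetricSpace K] [CompactSpace K]

theorem eventually_norm_sub_le_of_dist_lt {n : Type*} [Fintype n] (T : (n → 𝕜) →ₗ[𝕜] C(K, 𝕜))
    {η : ℝ} (hη : 0 < η) :
    ∀ᶠ δ in 𝓝[>] (0 : ℝ), ∀ t t', dist t t' < δ → ∀ v, ‖T v t - T v t'‖ ≤ η * ‖v‖ := by
  classical
  set η' := η / (Fintype.card n + 1) with hη'
  have hη0 : 0 < η' := by positivity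
  have : ∀ i, ∀ᶠ δ in 𝓝[>] (0 : ℝ), ∀ t t', dist t t' < δ →
      ‖T (Pi.single i 1) t - T (Pi.single i 1) t'‖ ≤ η' := by
    intro i
    obtain ⟨δ, hδ, h⟩ := Metric.uniformContinuous_iff.1
      (CompactSpace.uniformContinuous_of_continuous (T (Pi.single i 1)).continuous) η' hη0
    filter_upwards [Ioo_mem_nhdsGT hδ] with δ' hδ' t t' ht
    rw [← dist_eq_norm]
    exact (h (ht.trans hδ'.2)).le
  filter_upwards [eventually_all.2 this] with δ hδ t t' ht v
  have e : T v t - T v t' = ∑ i, v i * (T (Pi.single i 1) t - T (Pi.single i 1) t') := by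
    have : T v = ∑ i, v i • T (Pi.single i 1) := by
      conv_lhs => rw [pi_eq_sum_univ' v, map_sum]
      simp_rw [map_smul]
    rw [this, ContinuousMap.sum_apply, ContinuousMap.sum_apply, ← Finset.sum_sub_distrib]
    simp [mul_sub]
  rw [e]
  calc ‖∑ i, v i * (T (Pi.single i 1) t - T (Pi.single i 1) t')‖ ≤ ∑ _i : n, ‖v‖ * η' := by
        refine (norm_sum_le _ _).trans (Finset.sum_le_sum fun i _ => ?_)
        rw [norm_mul]
        exact mul_le_mul (norm_le_pi_norm v i) (hδ i t t' ht) (norm_nonneg _) (norm_nonneg _)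
    _ = (Fintype.card n * η') * ‖v‖ := by
        rw [Finset.sum_const, Finset.card_univ, nsmul_eq_mul]
        ring
    _ ≤ η * ‖v‖ := by
        refine mul_le_mul_of_nonneg_right ?_ (norm_nonneg _)
        rw [hη', mul_div_assoc', div_le_iff₀ (by positivity)]
        nlinarith

variable {Y : Type*} [AddCommGroup Y] [Module 𝕜 Y] {NY : Y → ℝ} {Ω : C(K, 𝕜) → Y}

theorem NearLinearOnDisjointIn.combination {M : ℝ} (hM : NearLinearOnDisjointIn NY Ω M Set.univ)
    {J : Type} [Fintype J] {ψ : J → C(K, ℝ)}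
    (hd : ∀ j j', j ≠ j' → ∀ t, ψ j t = 0 ∨ ψ j' t = 0) :
    NearLinear 𝕜 (fun a => ‖ContinuousMap.combination 𝕜 ψ a‖) NY M
      (Ω ∘ ContinuousMap.combination 𝕜 ψ) :=
  hM J _ (fun i j hij t => by rcases hd i j hij t with h | h <;> simp [h])
    fun i t ht => (ht (Set.mem_univ t)).elim

/-- A quasi-linear map that is uniformly near linear on disjoint families is locally trivial. -/
theorem exists_isLocallyTrivialWith_of_hasGapSystems {N : ℕ} (hK : HasGapSystems K N)
    (hY : IsQuasiNorm 𝕜 NY) (hΩ : IsQuasiLinear 𝕜 (fun f : C(K, 𝕜) => ‖f‖) NY Ω) {M : ℝ}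
    (hM : NearLinearOnDisjointIn NY Ω M Set.univ) :
    ∃ Γ, 0 ≤ Γ ∧ IsLocallyTrivialWith 𝕜 (fun f : C(K, 𝕜) => ‖f‖) NY Ω Γ := by
  have hX := isQuasiNorm_norm (𝕜 := 𝕜) C(K, 𝕜)
  obtain ⟨D, hD, B, hB, hsum⟩ := exists_nearLinear_sum hX hY hΩ
    (Finset.univ : Finset (Fin (N + 1))) fun _ => |M|
  -- The gauge must include the norm of `T v`: each `Q θ v` is bounded by it, but not by the norm of
  -- the sum of the `Q θ v`.
  obtain ⟨Γ, hΓ, happ⟩ := exists_nearLinear_of_approx_gauge.{0} hX hY hΩ D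
  refine ⟨Γ, hΓ, isLocallyTrivialWith_of_forall_injective fun n T hT => ?_⟩
  rcases isEmpty_or_nonempty K with hKe | hKe
  · refine ⟨0, fun v => ?_⟩
    have : T v = 0 := ContinuousMap.ext fun t => hKe.elim t
    simp [this, hΩ.map_zero, hY.map_zero]
  refine happ (Fin n) T hT fun ε hε => ?_
  obtain ⟨δ, hδT, hδ⟩ := ((eventually_norm_sub_le_of_dist_lt T hε).and self_mem_nhdsWithin).exists
  obtain ⟨J, _, φ, h0, h1, hd, hdist⟩ := hK.exists_partition (δ := δ) hδ
  choose x hx using fun θ => exists_forall_apply_ne_zero (φ θ)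
  have h1' : ∀ θ t, ∑ j, φ θ j t ≤ 1 := fun θ t => by
    rw [← h1 t]
    exact Finset.single_le_sum (f := fun θ => ∑ j, φ θ j t)
      (fun θ _ => Finset.sum_nonneg fun j _ => h0 θ j t) (Finset.mem_univ θ)
  let Q : Fin (N + 1) → (Fin n → 𝕜) →ₗ[𝕜] C(K, 𝕜) := fun θ =>
    ContinuousMap.combination 𝕜 (φ θ) ∘ₗ ContinuousMap.evalAt 𝕜 (x θ) ∘ₗ T
  have hQ : ∀ θ v, ‖Q θ v‖ ≤ ‖T v‖ := fun θ v =>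
    (ContinuousMap.norm_combination_le (h0 θ) (h1' θ) _).trans (ContinuousMap.norm_evalAt_le _ _)
  refine ⟨∑ θ, Q θ, fun i => ?_, ?_⟩
  · have e := norm_realMul_sum_sub_sampling_le (ψ := fun k : Fin (N + 1) × J => φ k.1 k.2)
      (x := fun k => x k.1 k.2) (f := T (Pi.single i 1)) (fun k t => h0 k.1 k.2 t)
      (fun t => by rw [Fintype.sum_prod_type, h1]) hε.le (fun k t hk => by
        refine (hδT t _ (hdist k.1 k.2 t _ hk (hx k.1 k.2 t hk)) (Pi.single i 1)).trans_eq ?_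
        rw [Pi.norm_single, norm_one, mul_one])
    rw [ContinuousMap.realMul_eq_self fun t => by
      rw [ContinuousMap.sum_apply, Fintype.sum_prod_type, h1]] at e
    have e2 : (∑ θ, Q θ) (Pi.single i 1) = ContinuousMap.combination 𝕜 (fun k => φ k.1 k.2)
        (ContinuousMap.evalAt 𝕜 (fun k : Fin (N + 1) × J => x k.1 k.2) (T (Pi.single i 1))) := by
      ext t
      simp [Q, ContinuousMap.combination_apply, ContinuousMap.sum_apply, Fintype.sum_prod_type]
    rwa [e2]
  · have := (hsum (Fin n → 𝕜) (fun v => ‖T v‖) Q (fun v => norm_nonneg _) (fun θ _ => hQ θ)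
      (fun θ _ => ?_)).2
    · exact this.mono fun v => mul_le_mul_of_nonneg_left
        (le_add_of_nonneg_right (norm_nonneg _)) hD
    · refine ((hM.combination (hd θ)).comp (ContinuousMap.evalAt 𝕜 (x θ) ∘ₗ T)).mono fun v => ?_
      refine (mul_le_mul_of_nonneg_right (le_abs_self _) (norm_nonneg _)).trans ?_
      exact mul_le_mul_of_nonneg_left (hQ θ v) (abs_nonneg _)

end FineApproximation

/-! ### Improving the constant by averaging over colours. -/

section Contraction

open Filter Topology

variable {𝕜 : Type*} [RCLike 𝕜] {K : Type*} [PseudoMetricSpace K] [CompactSpace K]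
  {Y : Type*} [NormedAddCommGroup Y] [NormedSpace 𝕜 Y] {Ω : C(K, 𝕜) → Y}

/-- For each colour, the main part `A e` is sampled into a disjoint family, costing `M`, and the
remainder `B e` into a space common to all colours. The sampling errors cost `Γ / 4`. The remainders
cost `Γ / 2` after averaging. -/
theorem IsLocallyTrivialWith.exists_contraction {N : ℕ} (hK : HasGapSystems K N) {C M Γ : ℝ}
    (hC : 0 ≤ C) (hΩC : ∀ f g, ‖Ω (f + g) - Ω f - Ω g‖ ≤ C * (‖f‖ + ‖g‖)) (hΩ0 : Ω 0 = 0)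
    (hM : NearLinearOnDisjointIn (fun y => ‖y‖) Ω M Set.univ) (hM0 : 0 ≤ M) (hΓ0 : 0 ≤ Γ)
    (hΓ : IsLocallyTrivialWith 𝕜 (fun f : C(K, 𝕜) => ‖f‖) (fun y => ‖y‖) Ω Γ) :
    IsLocallyTrivialWith 𝕜 (fun f : C(K, 𝕜) => ‖f‖) (fun y => ‖y‖) Ω
      (3 / 4 * Γ + (M + 13 * C)) := by
  classical
  refine isLocallyTrivialWith_of_forall_injective fun n T hT => ?_
  rcases isEmpty_or_nonempty K with hKe | hKe
  · refine ⟨0, fun v => ?_⟩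
    have : T v = 0 := ContinuousMap.ext fun t => hKe.elim t
    simp [this, hΩ0]
  obtain ⟨V, E, _, _, _, _, a, b, hV, hE, hG⟩ := exists_isLocallyForest N
  obtain ⟨c, hc0, hc⟩ := (isQuasiNorm_norm (𝕜 := 𝕜) C(K, 𝕜)).exists_norm_le T hT
  -- Makes both sampling errors at most `‖T v‖ / 8`, so applying the old constant `Γ` to the two of
  -- them costs `Γ / 4`.
  set ε : ℝ := 1 / 8 / c with hε
  have hε0 : 0 < ε := by positivity
  have hεc : ∀ v, ε * ‖v‖ ≤ 1 / 8 * ‖T v‖ := fun v => by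
    rw [hε, div_mul_eq_mul_div, div_le_iff₀ hc0]
    linarith [hc v]
  obtain ⟨δ, hδT, hδ⟩ :=
    ((eventually_norm_sub_le_of_dist_lt T hε0).and self_mem_nhdsWithin).exists
  obtain ⟨J, _, Ψ, hΨ01, hΨd, hΨdist, hΨN⟩ := hK E δ hδ
  choose x hx using fun e => exists_forall_apply_ne_zero (Ψ e)
  have hΨ1 : ∀ e t, ∑ j, Ψ e j t ≤ 1 := fun e t => sum_le_one_of_disjoint (hΨ01 e) (hΨd e) t
  have hΨ0 : ∀ e t, 0 ≤ ∑ j, Ψ e j t := fun e t => Finset.sum_nonneg fun j _ => (hΨ01 e j t).1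
  let A : E → (Fin n → 𝕜) →ₗ[𝕜] C(K, 𝕜) := fun e =>
    ContinuousMap.realMul 𝕜 (∑ j, Ψ e j) ∘ₗ T
  let B : E → (Fin n → 𝕜) →ₗ[𝕜] C(K, 𝕜) := fun e =>
    ContinuousMap.realMul 𝕜 (1 - ∑ j, Ψ e j) ∘ₗ T
  have hAB : ∀ e v, A e v + B e v = T v := fun e v => by
    ext t
    simp only [A, B, LinearMap.comp_apply, ContinuousMap.add_apply, ContinuousMap.realMul_apply,
      ContinuousMap.sub_apply, ContinuousMap.one_apply, RCLike.ofReal_sub, RCLike.ofReal_one]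
    ring
  have hA : ∀ e v, ‖A e v‖ ≤ ‖T v‖ := fun e v => ContinuousMap.norm_realMul_le (fun t => by
    rw [ContinuousMap.sum_apply, abs_of_nonneg (hΨ0 e t)]
    exact hΨ1 e t) _
  have hB : ∀ e v, ‖B e v‖ ≤ ‖T v‖ := fun e v => ContinuousMap.norm_realMul_le (fun t => by
    rw [ContinuousMap.sub_apply, ContinuousMap.one_apply, ContinuousMap.sum_apply, abs_of_nonneg]
    · linarith [hΨ0 e t]
    · linarith [hΨ1 e t]) _
  obtain ⟨δ', hδB, hδ'⟩ := ((eventually_all.2 fun e =>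
    eventually_norm_sub_le_of_dist_lt (B e) hε0).and self_mem_nhdsWithin).exists
  obtain ⟨J', _, φ', hφ'0, hφ'1, -, hφ'dist⟩ := hK.exists_partition (δ := δ') hδ'
  let φ : Fin (N + 1) × J' → C(K, ℝ) := fun k => φ' k.1 k.2
  have hφ0 : ∀ k t, 0 ≤ φ k t := fun k t => hφ'0 _ _ t
  have hφ1 : ∀ t, ∑ k, φ k t = 1 := fun t => by rw [Fintype.sum_prod_type, hφ'1]
  have hφdist : ∀ k t t', φ k t ≠ 0 → φ k t' ≠ 0 → dist t t' < δ' := fun k => hφ'dist k.1 k.2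
  obtain ⟨z, hz⟩ := exists_forall_apply_ne_zero φ
  let P : E → (Fin n → 𝕜) →ₗ[𝕜] C(K, 𝕜) := fun e =>
    ContinuousMap.combination 𝕜 (Ψ e) ∘ₗ ContinuousMap.evalAt 𝕜 (x e) ∘ₗ T
  let S : (Fin (N + 1) × J' → 𝕜) →ₗ[𝕜] C(K, 𝕜) := ContinuousMap.combination 𝕜 φ
  let d : E → (Fin n → 𝕜) →ₗ[𝕜] (Fin (N + 1) × J' → 𝕜) := fun e =>
    ContinuousMap.evalAt 𝕜 z ∘ₗ B e
  have hP : ∀ e v, ‖P e v‖ ≤ ‖T v‖ := fun e v =>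
    (ContinuousMap.norm_combination_le (fun j t => (hΨ01 e j t).1) (hΨ1 e) _).trans
      (ContinuousMap.norm_evalAt_le _ _)
  have hS : ∀ y, ‖S y‖ ≤ ‖y‖ :=
    ContinuousMap.norm_combination_le hφ0 fun t => (hφ1 t).le
  have hd : ∀ e v, ‖d e v‖ ≤ ‖T v‖ := fun e v =>
    (ContinuousMap.norm_evalAt_le _ _).trans (hB e v)
  have hAP : ∀ e v, ‖(A e - P e) v‖ ≤ 1 / 8 * ‖T v‖ := fun e v =>
    norm_realMul_sum_sub_sampling_le (fun j t => (hΨ01 e j t).1) (hΨ1 e) (by positivity)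
      fun j t ht => (hδT t _ (hΨdist e j t _ ht (hx e j t ht)) v).trans (hεc v)
  have hBS : ∀ e v, ‖(B e - S ∘ₗ d e) v‖ ≤ 1 / 8 * ‖T v‖ := fun e v => by
    have := norm_realMul_sum_sub_sampling_le (f := B e v) hφ0 (fun t => (hφ1 t).le)
      (by positivity) fun k t ht =>
        (hδB e t _ (hφdist k t _ ht (hz k t ht)) v).trans (hεc v)
    rwa [ContinuousMap.realMul_eq_self fun t => by rw [ContinuousMap.sum_apply, hφ1]] at this
  choose L₁ hL₁ using fun e => hΓ.nearLinear (A e - P e)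
  choose L₂ hL₂ using fun e => hΓ.nearLinear (B e - S ∘ₗ d e)
  choose L₃ hL₃ using fun e =>
    (hM.combination (hΨd e)).comp (ContinuousMap.evalAt 𝕜 (x e) ∘ₗ T)
  obtain ⟨L₄, hL₄⟩ := hΓ.nearLinear S
  simp only [Function.comp] at hL₁ hL₂ hL₃ hL₄
  -- The error of one linear approximation `L₄` on the common sample space. Linearity of `L₄` leaves
  -- the quasi-additivity constant `C` unchanged.
  let R : (Fin (N + 1) × J' → 𝕜) → Y := fun y => Ω (S y) - L₄ y
  have hRadd : ∀ y y', ‖R (y + y') - R y - R y'‖ ≤ C * (‖y‖ + ‖y'‖) := fun y y' => by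
    have e : R (y + y') - R y - R y' = Ω (S y + S y') - Ω (S y) - Ω (S y') := by
      simp only [R, map_add]
      abel
    rw [e]
    refine (hΩC _ _).trans ?_
    gcongr <;> exact hS _
  have hRΓ : ∀ y, ‖R y‖ ≤ Γ * ‖y‖ := fun y =>
    (hL₄ y).trans (mul_le_mul_of_nonneg_left (hS y) hΓ0)
  -- The coordinate `k` of `d e v` vanishes unless `z k` lies in a gap of colour `e`, which happens
  -- for at most `N` colours.
  have hsum : ∀ v, ‖∑ e, R (d e v)‖ ≤
      Fintype.card V * (Γ * ‖T v‖) + Fintype.card E * (6 * C * ‖T v‖) := fun v =>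
    norm_sum_map_le_of_overlap hG hC hRadd hΓ0 hRΓ (norm_nonneg _) (fun e => hd e v) fun k => by
      refine (Set.ncard_le_ncard ?_ (Set.toFinite _)).trans (hΨN (z k))
      intro e he h1
      refine he ?_
      simp only [d, B, LinearMap.comp_apply, ContinuousMap.evalAt_apply,
        ContinuousMap.realMul_apply, ContinuousMap.sub_apply, ContinuousMap.sum_apply,
        ContinuousMap.one_apply, h1]
      simp
  let L : E → (Fin n → 𝕜) →ₗ[𝕜] Y := fun e => L₁ e + L₂ e + L₃ e + L₄ ∘ₗ d e
  have hone : ∀ e v, ‖Ω (T v) - L e v - R (d e v)‖ ≤ (17 / 4 * C + M + Γ / 4) * ‖T v‖ := by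
    intro e v
    have q0 := norm_nonneg (T v)
    have b1 := hΩC (A e v) (B e v)
    rw [hAB] at b1
    have b2 := hΩC (P e v) ((A e - P e) v)
    have b3 := hΩC (S (d e v)) ((B e - S ∘ₗ d e) v)
    have e2 : P e v + (A e - P e) v = A e v := by simp
    have e3 : S (d e v) + (B e - S ∘ₗ d e) v = B e v := by simp
    rw [e2] at b2
    rw [e3] at b3
    have b4 := (hL₁ e v).trans (mul_le_mul_of_nonneg_left (hAP e v) hΓ0)
    have b5 := (hL₂ e v).trans (mul_le_mul_of_nonneg_left (hBS e v) hΓ0)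
    have b6 : ‖Ω (P e v) - L₃ e v‖ ≤ M * ‖T v‖ :=
      (hL₃ e v).trans (mul_le_mul_of_nonneg_left (hP e v) hM0)
    have c1 : C * (‖A e v‖ + ‖B e v‖) ≤ C * (‖T v‖ + ‖T v‖) := by
      gcongr
      exacts [hA e v, hB e v]
    have c2 : C * (‖P e v‖ + ‖(A e - P e) v‖) ≤ C * (‖T v‖ + 1 / 8 * ‖T v‖) := by
      gcongr
      exacts [hP e v, hAP e v]
    have c3 : C * (‖S (d e v)‖ + ‖(B e - S ∘ₗ d e) v‖) ≤ C * (‖T v‖ + 1 / 8 * ‖T v‖) := by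
      gcongr
      exacts [(hS _).trans (hd e v), hBS e v]
    have e1 : Ω (T v) - L e v - R (d e v) =
        (Ω (T v) - Ω (A e v) - Ω (B e v)) +
        ((Ω (A e v) - Ω (P e v) - Ω ((A e - P e) v)) +
        ((Ω (B e v) - Ω (S (d e v)) - Ω ((B e - S ∘ₗ d e) v)) +
        ((Ω ((A e - P e) v) - L₁ e v) + ((Ω ((B e - S ∘ₗ d e) v) - L₂ e v) +
        (Ω (P e v) - L₃ e v))))) := by
      simp only [L, R, LinearMap.add_apply, LinearMap.comp_apply]
      abel
    rw [e1]
    refine (norm_add_le_of_le (b1.trans c1) (norm_add_le_of_le (b2.trans c2)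
      (norm_add_le_of_le (b3.trans c3) (norm_add_le_of_le b4 (norm_add_le_of_le b5 b6))))).trans
      (le_of_eq (by ring))
  have hE0 : (0 : ℝ) < Fintype.card E := by
    rw [hE]
    exact_mod_cast Nat.mul_pos two_pos hV
  have hVE : (Fintype.card V : ℝ) = Fintype.card E / 2 := by
    rw [hE]
    push_cast
    ring
  refine ⟨((Fintype.card E : 𝕜)⁻¹) • ∑ e, L e, fun v => ?_⟩
  have hE𝕜 : (Fintype.card E : 𝕜) ≠ 0 := by
    have := hE0.ne'
    exact_mod_cast this
  have e : (Ω ∘ T) v - (((Fintype.card E : 𝕜)⁻¹) • ∑ e, L e) v = (Fintype.card E : 𝕜)⁻¹ •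
      (∑ e, (Ω (T v) - L e v - R (d e v)) + ∑ e, R (d e v)) := by
    rw [← Finset.sum_add_distrib]
    simp only [sub_add_cancel, Finset.sum_sub_distrib, Finset.sum_const, Finset.card_univ,
      smul_sub, LinearMap.smul_apply, LinearMap.sum_apply, Function.comp]
    rw [← Nat.cast_smul_eq_nsmul 𝕜, inv_smul_smul₀ hE𝕜]
  have h1 : ‖∑ e, (Ω (T v) - L e v - R (d e v))‖ ≤
      Fintype.card E * ((17 / 4 * C + M + Γ / 4) * ‖T v‖) := by
    refine (norm_sum_le _ _).trans ((Finset.sum_le_sum fun e _ => hone e v).trans (le_of_eq ?_))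
    simp
  beta_reduce
  rw [e, norm_smul, norm_inv, RCLike.norm_natCast, inv_mul_le_iff₀ hE0]
  refine (norm_add_le_of_le h1 (hsum v)).trans ?_
  rw [hVE]
  have : 0 ≤ C * ‖T v‖ := by positivity
  simp only [Function.comp]
  -- Since `|V| = |E| / 2`, the coefficient of `Γ` is `1 / 4 + 1 / 2` and that of `C` is `17 / 4 +
  -- 6`, below `13`.
  nlinarith [mul_nonneg hE0.le this]

/-- The map `Γ ↦ 3 / 4 * Γ + B` has fixed point `4 * B`, and the excess over it shrinks
geometrically. Stopping once it is below `1` avoids any limit of linear maps. -/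
theorem isLocallyTrivialWith_of_forall_contraction {X : Type*} [AddCommGroup X] [Module 𝕜 X]
    {NX : X → ℝ} {NY : Y → ℝ} {Ω : X → Y} {B Γ : ℝ} (hX : ∀ x, 0 ≤ NX x) (hB : 0 ≤ B)
    (hΓ0 : 0 ≤ Γ) (hΓ : IsLocallyTrivialWith 𝕜 NX NY Ω Γ)
    (h : ∀ Γ, 0 ≤ Γ → IsLocallyTrivialWith 𝕜 NX NY Ω Γ →
      IsLocallyTrivialWith 𝕜 NX NY Ω (3 / 4 * Γ + B)) :
    IsLocallyTrivialWith 𝕜 NX NY Ω (4 * B + 1) := by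
  have key : ∀ k : ℕ, IsLocallyTrivialWith 𝕜 NX NY Ω (4 * B + (3 / 4) ^ k * Γ) := by
    intro k
    induction k with
    | zero =>
      intro F hF
      obtain ⟨L, hL⟩ := hΓ F hF
      refine ⟨L, fun x => (hL x).trans (mul_le_mul_of_nonneg_right ?_ (hX _))⟩
      simpa using hB
    | succ k ih =>
      have := h _ (by positivity) ih
      convert this using 1
      ring
  obtain ⟨k, hk⟩ := exists_pow_lt_of_lt_one (show (0 : ℝ) < 1 / (Γ + 1) by positivity)
    (show (3 / 4 : ℝ) < 1 by norm_num)
  intro F hF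
  obtain ⟨L, hL⟩ := key k F hF
  refine ⟨L, fun x => (hL x).trans (mul_le_mul_of_nonneg_right ?_ (hX _))⟩
  rw [lt_div_iff₀ (by positivity)] at hk
  have : (0 : ℝ) ≤ (3 / 4) ^ k := by positivity
  nlinarith

/-- The constant of local triviality does not depend on the dimension of `K`. -/
theorem isLocallyTrivialWith_of_hasGapSystems {N : ℕ} (hK : HasGapSystems K N) {C M : ℝ}
    (hC : 0 ≤ C) (hsmul : ∀ (c : 𝕜) (f : C(K, 𝕜)), Ω (c • f) = c • Ω f)
    (hΩC : ∀ f g, ‖Ω (f + g) - Ω f - Ω g‖ ≤ C * (‖f‖ + ‖g‖)) (hM0 : 0 ≤ M)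
    (hM : NearLinearOnDisjointIn (fun y => ‖y‖) Ω M Set.univ) :
    IsLocallyTrivialWith 𝕜 (fun f : C(K, 𝕜) => ‖f‖) (fun y => ‖y‖) Ω
      (4 * (M + 13 * C) + 1) := by
  have hΩ : IsQuasiLinear 𝕜 (fun f : C(K, 𝕜) => ‖f‖) (fun y => ‖y‖) Ω := ⟨hsmul, C, hΩC⟩
  obtain ⟨Γ, hΓ0, hΓ⟩ :=
    exists_isLocallyTrivialWith_of_hasGapSystems hK (isQuasiNorm_norm Y) hΩ hM
  exact isLocallyTrivialWith_of_forall_contraction (fun f => norm_nonneg f) (by positivity) hΓ0 hΓ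
    fun Γ hΓ0 hΓ => hΓ.exists_contraction hK hC hΩC hΩ.map_zero hM hM0 hΓ0

end Contraction

/-! ### From compact subsets of Euclidean space to general compact spaces. -/

section CompactHausdorff

variable {𝕜 : Type*} [RCLike 𝕜] {K : Type*} [TopologicalSpace K] [CompactSpace K]
  {Y : Type*} [NormedAddCommGroup Y] [NormedSpace 𝕜 Y] {Ω : C(K, 𝕜) → Y}

/-- Finitely many functions on `K` factor through a compact subset of a Euclidean space. -/
theorem exists_factorization_continuousMap {n : ℕ} (w : Fin n → C(K, 𝕜)) :
    ∃ (A : Set (Fin n ⊕ Fin n → ℝ)) (_ : CompactSpace A) (ρ : C(K, A)) (w' : Fin n → C(A, 𝕜)),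
      Function.Surjective ρ ∧ ∀ i t, w' i (ρ t) = w i t := by
  let π : K → (Fin n ⊕ Fin n → ℝ) := fun t =>
    Sum.elim (fun i => RCLike.re (w i t)) (fun i => RCLike.im (w i t))
  have hπ : Continuous π := continuous_pi fun i => by
    rcases i with i | i
    · exact RCLike.continuous_re.comp (w i).continuous
    · exact RCLike.continuous_im.comp (w i).continuous
  have hA : Continuous fun z : Set.range π => z.1 := continuous_subtype_val
  refine ⟨Set.range π, isCompact_iff_compactSpace.1 (isCompact_range hπ),
    ⟨Set.rangeFactorization π, hπ.subtype_mk _⟩,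
    fun i => ⟨fun z => (z.1 (Sum.inl i) : 𝕜) + (z.1 (Sum.inr i) : 𝕜) * RCLike.I, ?_⟩,
    Set.rangeFactorization_surjective, fun i t => RCLike.re_add_im (w i t)⟩
  exact (RCLike.continuous_ofReal.comp ((continuous_apply _).comp hA)).add
    ((RCLike.continuous_ofReal.comp ((continuous_apply _).comp hA)).mul continuous_const)

/-- A finite-dimensional subspace is pulled back isometrically from a compact set `A` in a Euclidean
space. Pullback preserves disjointness, so `M` and `C` pass to `A`, and the bound there does not
depend on the dimension. -/
theorem isLocallyTrivialWith_of_nearLinearOnDisjointIn {C M : ℝ}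
    (hC : 0 ≤ C) (hsmul : ∀ (c : 𝕜) (f : C(K, 𝕜)), Ω (c • f) = c • Ω f)
    (hΩC : ∀ f g, ‖Ω (f + g) - Ω f - Ω g‖ ≤ C * (‖f‖ + ‖g‖)) (hM0 : 0 ≤ M)
    (hM : NearLinearOnDisjointIn (fun y => ‖y‖) Ω M Set.univ) :
    IsLocallyTrivialWith 𝕜 (fun f : C(K, 𝕜) => ‖f‖) (fun y => ‖y‖) Ω
      (4 * (M + 13 * C) + 1) := by
  refine isLocallyTrivialWith_of_forall_injective fun n T hT => ?_
  obtain ⟨A, _, ρ, w', hρ, hw'⟩ := exists_factorization_continuousMap fun i => T (Pi.single i 1)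
  let pull : C(A, 𝕜) →ₗ[𝕜] C(K, 𝕜) :=
    { toFun := fun f => f.comp ρ, map_add' := fun _ _ => rfl, map_smul' := fun _ _ => rfl }
  have hpull : ∀ f t, pull f t = f (ρ t) := fun _ _ => rfl
  have hnorm : ∀ f, ‖pull f‖ = ‖f‖ := fun f => by
    refine le_antisymm ((ContinuousMap.norm_le _ (norm_nonneg _)).2 fun t =>
      f.norm_coe_le_norm (ρ t)) ((ContinuousMap.norm_le _ (norm_nonneg _)).2 fun z => ?_)
    obtain ⟨t, rfl⟩ := hρ z
    exact (pull f).norm_coe_le_norm t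
  have hT : pull ∘ₗ Fintype.linearCombination 𝕜 w' = T := by
    ext i t
    simp [hpull, hw']
  have hMA : NearLinearOnDisjointIn (fun y => ‖y‖) (fun f => Ω (pull f)) M Set.univ := by
    intro ι _ w hd _
    have e := comp_linearCombination pull w
    have := hM ι (pull ∘ w) (fun i j hij t => hd i j hij (ρ t))
      fun i t ht => (ht (Set.mem_univ t)).elim
    rw [← e] at this
    exact this.mono fun v => by rw [LinearMap.comp_apply, hnorm]
  have hA : Bornology.IsBounded A := (isCompact_iff_compactSpace.2 inferInstance).isBounded
  have h := isLocallyTrivialWith_of_hasGapSystems (hasGapSystems_of_isBounded hA) hC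
    (Ω := fun f => Ω (pull f)) (fun c f => by rw [map_smul, hsmul])
    (fun f g => by rw [map_add, ← hnorm f, ← hnorm g]; exact hΩC _ _) hM0 hMA
  obtain ⟨L, hL⟩ := h.nearLinear (Fintype.linearCombination 𝕜 w')
  refine ⟨L, fun v => ?_⟩
  have := hL v
  simp only [Function.comp, ← hnorm] at this
  rw [← hT]
  exact this

theorem isLocallyTrivial_of_nearLinearOnDisjointIn
    (hΩ : IsQuasiLinear 𝕜 (fun f : C(K, 𝕜) => ‖f‖) (fun y => ‖y‖) Ω) {M : ℝ}
    (hM : NearLinearOnDisjointIn (fun y => ‖y‖) Ω M Set.univ) :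
    IsLocallyTrivial 𝕜 (fun f : C(K, 𝕜) => ‖f‖) (fun y => ‖y‖) Ω := by
  obtain ⟨C, hC, hΩC⟩ := hΩ.exists_nonneg (isQuasiNorm_norm C(K, 𝕜))
  exact ⟨_, isLocallyTrivialWith_of_nearLinearOnDisjointIn hC hΩ.1 hΩC (le_max_right M 0)
    fun ι _ w hd hw => (hM ι w hd hw).mono_const (fun v => norm_nonneg _) (le_max_left M 0)⟩

end CompactHausdorff

/-! ### Assembling the disjoint sequences and the theorem. -/

section CopyOfSequenceSpace

open MeasureTheory

variable {𝕜 : Type*} [RCLike 𝕜] {X Y E : Type*} [AddCommGroup X] [Module 𝕜 X]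
  [AddCommGroup Y] [Module 𝕜 Y] [AddCommGroup E] [Module 𝕜 E] {NY : Y → ℝ}

theorem IsCopySpannedBy.mem {NE : E → ℝ} {e : ℕ → E} {NX : X → ℝ} {u : ℕ → X}
    {S : Submodule 𝕜 X} (h : IsCopySpannedBy 𝕜 NE e NX u S) (n : ℕ) : u n ∈ S := by
  obtain ⟨-, T, hT, -⟩ := h
  rw [← hT n]
  exact (T (e n)).2

theorem exists_disjoint_sequence_Lp {α : Type*} [MeasurableSpace α] {μ : Measure α}
    [SigmaFinite μ] {p : ℝ≥0∞} (hp : 0 < p) (hY : IsQuasiNorm 𝕜 NY) {Ω : Lp 𝕜 p μ → Y}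
    (hΩ : IsQuasiLinear 𝕜 (fun f : Lp 𝕜 p μ => ‖f‖) NY Ω)
    (hbad : ¬ IsLocallyTrivial 𝕜 (fun f : Lp 𝕜 p μ => ‖f‖) NY Ω) :
    ∃ u : ℕ → Lp 𝕜 p μ, (∀ m n, m ≠ n → ∀ᵐ t ∂μ, u m t = 0 ∨ u n t = 0) ∧ (∀ n, ‖u n‖ = 1) ∧
      ∀ S : Submodule 𝕜 (Lp 𝕜 p μ), (∀ n, u n ∈ S) →
        ¬ IsLocallyTrivialOn 𝕜 (fun f : Lp 𝕜 p μ => ‖f‖) NY Ω S := by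
  obtain ⟨ι, _, w, hw0, hwd, hw⟩ := exists_disjoint_families_Lp hp hY hΩ hbad
  obtain ⟨e, u, c, hu, hu1, hS⟩ := exists_normalized_sequence (isQuasiNorm_Lp hp) hY hΩ w hw0 hw
  refine ⟨u, fun m n hmn => ?_, hu1, hS⟩
  rw [hu m, hu n]
  filter_upwards [hwd _ _ (e.injective.ne hmn), Lp.coeFn_smul (c m) (w (e m).1 (e m).2),
    Lp.coeFn_smul (c n) (w (e n).1 (e n).2)] with t h h1 h2
  rw [h1, h2]
  exact h.imp (fun h => by simp [h]) (fun h => by simp [h])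

theorem exists_disjoint_sequence_continuousMap {K : Type*} [TopologicalSpace K] [CompactSpace K]
    [T2Space K] {Y : Type*} [NormedAddCommGroup Y] [NormedSpace 𝕜 Y] {Ω : C(K, 𝕜) → Y}
    (hΩ : IsQuasiLinear 𝕜 (fun f : C(K, 𝕜) => ‖f‖) (fun y => ‖y‖) Ω)
    (hbad : ¬ IsLocallyTrivial 𝕜 (fun f : C(K, 𝕜) => ‖f‖) (fun y => ‖y‖) Ω) :
    ∃ u : ℕ → C(K, 𝕜), (∀ m n, m ≠ n → ∀ t, u m t = 0 ∨ u n t = 0) ∧ (∀ n, ‖u n‖ = 1) ∧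
      ∀ S : Submodule 𝕜 C(K, 𝕜), (∀ n, u n ∈ S) →
        ¬ IsLocallyTrivialOn 𝕜 (fun f : C(K, 𝕜) => ‖f‖) (fun y => ‖y‖) Ω S := by
  obtain ⟨ι, _, w, hw0, hwd, hw⟩ := exists_disjoint_families_continuousMap (isQuasiNorm_norm Y) hΩ
    fun C hC => hbad (isLocallyTrivial_of_nearLinearOnDisjointIn hΩ hC)
  obtain ⟨e, u, c, hu, hu1, hS⟩ := exists_normalized_sequence (isQuasiNorm_norm C(K, 𝕜))
    (isQuasiNorm_norm Y) hΩ w hw0 hw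
  refine ⟨u, fun m n hmn t => ?_, hu1, hS⟩
  rw [hu m, hu n]
  exact (hwd _ _ (e.injective.ne hmn) t).imp (fun h => by simp [h]) (fun h => by simp [h])

end CopyOfSequenceSpace

theorem mainTheorem12 {𝕜 : Type*} [RCLike 𝕜] :
    -- `L_p(μ)`, `0 < p < ∞`
    (∀ {α : Type*} [MeasurableSpace α] (μ : MeasureTheory.Measure α) [MeasureTheory.SigmaFinite μ]
      (p : ℝ≥0∞), 0 < p → p ≠ ∞ →
      ∀ {Y : Type*} [AddCommGroup Y] [Module 𝕜 Y] (NY : Y → ℝ), IsQuasiNorm 𝕜 NY →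
      ∀ Ω : MeasureTheory.Lp 𝕜 p μ → Y,
        IsQuasiLinear 𝕜 (fun f => ‖f‖) NY Ω → ¬ IsLocallyTrivial 𝕜 (fun f => ‖f‖) NY Ω →
        ∃ (u : ℕ → MeasureTheory.Lp 𝕜 p μ) (S : Submodule 𝕜 (MeasureTheory.Lp 𝕜 p μ)),
          (∀ m n, m ≠ n → ∀ᵐ t ∂μ, u m t = 0 ∨ u n t = 0) ∧
          IsCopySpannedBy 𝕜 (fun a : lp (fun _ : ℕ => 𝕜) p => ‖a‖) (fun n => lp.single p n 1)
            (fun f => ‖f‖) u S ∧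
          ¬ IsLocallyTrivialOn 𝕜 (fun f => ‖f‖) NY Ω S) ∧
    -- `L_∞(μ)`
    (∀ {α : Type*} [MeasurableSpace α] (μ : MeasureTheory.Measure α) [MeasureTheory.SigmaFinite μ]
      {Y : Type*} [AddCommGroup Y] [Module 𝕜 Y] (NY : Y → ℝ), IsQuasiNorm 𝕜 NY →
      ∀ Ω : MeasureTheory.Lp 𝕜 ∞ μ → Y,
        IsQuasiLinear 𝕜 (fun f => ‖f‖) NY Ω → ¬ IsLocallyTrivial 𝕜 (fun f => ‖f‖) NY Ω →
        ∃ (u : ℕ → MeasureTheory.Lp 𝕜 ∞ μ) (S : Submodule 𝕜 (MeasureTheory.Lp 𝕜 ∞ μ)),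
          (∀ m n, m ≠ n → ∀ᵐ t ∂μ, u m t = 0 ∨ u n t = 0) ∧
          IsCopySpannedBy 𝕜 (fun a : C₀(ℕ, 𝕜) => ‖a‖) (c0Single 𝕜) (fun f => ‖f‖) u S ∧
          ¬ IsLocallyTrivialOn 𝕜 (fun f => ‖f‖) NY Ω S) ∧
    -- `C(K)`
    (∀ {K : Type*} [TopologicalSpace K] [CompactSpace K] [T2Space K]
      {Y : Type*} [NormedAddCommGroup Y] [NormedSpace 𝕜 Y] (Ω : C(K, 𝕜) → Y),
        IsQuasiLinear 𝕜 (fun f => ‖f‖) (fun y => ‖y‖) Ω →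
        ¬ IsLocallyTrivial 𝕜 (fun f => ‖f‖) (fun y => ‖y‖) Ω →
        ∃ (u : ℕ → C(K, 𝕜)) (S : Submodule 𝕜 C(K, 𝕜)),
          (∀ m n, m ≠ n → ∀ t, u m t = 0 ∨ u n t = 0) ∧
          IsCopySpannedBy 𝕜 (fun a : C₀(ℕ, 𝕜) => ‖a‖) (c0Single 𝕜) (fun f => ‖f‖) u S ∧
          ¬ IsLocallyTrivialOn 𝕜 (fun f => ‖f‖) (fun y => ‖y‖) Ω S) := by
  refine ⟨?_, ?_, ?_⟩
  · intro α _ μ _ p hp hp' Y _ _ NY hY Ω hΩ hbad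
    obtain ⟨u, hd, hu, hS⟩ := exists_disjoint_sequence_Lp hp hY hΩ hbad
    have hcopy := isCopySpannedBy_lp hp hp' hd hu
    exact ⟨u, _, hd, hcopy, hS _ hcopy.mem⟩
  · intro α _ μ _ Y _ _ NY hY Ω hΩ hbad
    obtain ⟨u, hd, hu, hS⟩ := exists_disjoint_sequence_Lp ENNReal.zero_lt_top hY hΩ hbad
    obtain ⟨S, hcopy⟩ := exists_isCopySpannedBy_c0_Linfty hd hu
    exact ⟨u, S, hd, hcopy, hS S hcopy.mem⟩
  · intro K _ _ _ Y _ _ Ω hΩ hbad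
    obtain ⟨u, hd, hu, hS⟩ := exists_disjoint_sequence_continuousMap hΩ hbad
    obtain ⟨S, hcopy⟩ := exists_isCopySpannedBy_c0_continuousMap hd hu
    exact ⟨u, S, hd, hcopy, hS S hcopy.mem⟩
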